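/- Let $\mathbb K$ be a field, $m\ge 1$ an integer and $A$ an infinite totally ordered alphabet. **Conventions.** The standardisation $\mathrm{std}(u)$ of a word $u$ over a totally ordered alphabet is obtained by numbering its letters $1,2,\dots$ from the smallest to the largest letter and, among equal letters, from left to right. A word is *$m$-stuttering* if each letter occurs in it a multiple of $m$ times. An *$m$-stuttering permutation of size $n$* is a rearrangement of $1^m2^m\cdots n^m$. Every $m$-stuttering word $u$ has a unique *$m$-standardisation* $\mathrm{std}^{(m)}(u)$, the $m$-stuttering permutation $\sigma$ with $\mathrm{std}(\sigma)=\mathrm{std}(u)$. For an $m$-stuttering permutation $\sigma$ let $$\mathbf G^{(m)}_\sigma=\mathbf G^{(m)}_\sigma(A)=\sum_{\mathrm{std}^{(m)}(u)=\sigma}u ,$$ the sum over the $m$-stuttering words $u$ over $A$, a noncommutative formal series in $A$ over $\mathbb K$, and let $\mathbf{FQSym}^{(m)}$ be the algebra generated by all the $\mathbf G^{(m)}_\sigma$ (for the concatenation product of series). For a second infinite totally ordered alphabet $B$, $A\hat+B$ is the ordered sum, in which all letters of $A$ are smaller than all letters of $B$; letting the letters of $A$ commute with those of $B$, a series over $A\hat+B$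 becomes an infinite sum of terms $u\otimes v$ with $u$ a word over $A$ and $v$ a word over $B$. **Statement.** 1. (Product) For all $m$-stuttering permutations $\sigma,\mu$, $$\mathbf G^{(m)}_\sigma\,\mathbf G^{(m)}_\mu=\sum_\nu\mathbf G^{(m)}_\nu ,$$ the (finite) sum over the $m$-stuttering permutations of the form $\nu=u\cdot v$ with $u,v$ $m$-stuttering words, $\mathrm{std}^{(m)}(u)=\sigma$, $\mathrm{std}^{(m)}(v)=\mu$. 2. (Coproduct) For every $m$-stuttering permutation $\sigma$ of size $n$, $$\mathbf G^{(m)}_\sigma(A\hat+B)=\sum_{(\mu,\nu)}\mathbf G^{(m)}_\mu(A)\otimes\mathbf G^{(m)}_\nu(B),$$ the (finite) sum over the pairs $(\mu,\nu)$ of $m$-stuttering permutations such that for some $k\le n$, $\mu$ is the subword of $\sigma$ formed by the letters $\le k$ and $\nu$ is the $m$-standardisation of the subword formed by the letters $>k$. 3. (Hopf algebra) The $\mathbf G^{(m)}_\sigma$ form a linear basis of $\mathbf{FQSym}^{(m)}$. With the product of series and with the coproduct $\Delta(\mathbf G^{(m)}_\sigma)=\mathbf G^{(m)}_\sigma(A\hat+A)=\sum\mathbf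 G^{(m)}_\mu\otimes\mathbf G^{(m)}_\nu$ (the same sum as in 2, with $B$ a copy of $A$), $\mathbf{FQSym}^{(m)}$ is a Hopf algebra. 4. (Dual) Let $\mathbf F^{(m)}_\sigma$ be the linear forms on $\mathbf{FQSym}^{(m)}$ dual to the basis $\mathbf G^{(m)}_\sigma$. Their linear span, with the product and the coproduct transposed from the coproduct and the product of $\mathbf{FQSym}^{(m)}$, is a Hopf algebra, the (graded) dual of $\mathbf{FQSym}^{(m)}$. 5. ($\mathbf{PBT}^{(m)}$) An *$m$-binary tree* is a binary tree that is either empty or composed of $m+1$ $m$-binary trees $T_L,T_{R_1},\dots,T_{R_m}$ grafted on $m$ root nodes: $T_L$ is the left subtree of the first root node, the right subtree of the $i$-th root node ($i<m$) is $T_{R_i}$ with the $(i+1)$-st root node grafted as left child of its leftmost node (if $T_{R_i}$ is empty, the $(i+1)$-st root node is itself the right child), and the right subtree of the $m$-th root node is $T_{R_m}$. For an $m$-stuttering permutation $\sigma$ let $\mathrm{ABR}(\sigma)$ be the shape of the binary search tree obtained by inserting the letters of $\sigma$ from right to left ($k$ goes to the left of a node $x$ if $k\le x$, otherwise to the right).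 For an $m$-binary tree $T$ with left-right mirror image $\tilde T$ let $$\mathbf P^{(m)}_T=\sum_{\mathrm{ABR}(\sigma)=\tilde T}\mathbf F^{(m)}_\sigma ,$$ the sum over a sylvester class of $m$-stuttering permutations. The $\mathbf P^{(m)}_T$, $T$ ranging over all $m$-binary trees, are linearly independent and span a Hopf subalgebra $\mathbf{PBT}^{(m)}$ of the Hopf algebra of 4. 6. (Products are $m$-Tamari intervals) Order the $m$-binary trees by the $m$-Tamari order, i.e. the restriction of the Tamari order on binary trees, whose relations are generated by the right rotations $y(x(A,B),C)\to x(A,y(B,C))$. For all $m$-binary trees $T_1,T_2$, $$\mathbf P^{(m)}_{T_1}\,\mathbf P^{(m)}_{T_2}=\sum_{T\in[T_-,T_+]}\mathbf P^{(m)}_T ,$$ where $T_-$ is $T_1$ with $T_2$ grafted to the left of its leftmost node, $T_+$ is $T_2$ with $T_1$ grafted to the right of its rightmost node, $T_-$ and $T_+$ are $m$-binary, and the interval is taken in the $m$-Tamari order on $m$-binary trees. -/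

import Mathlib

open scoped TensorProduct

noncomputable section

namespace MStut

/-! ### Words, standardisation, `m`-stuttering words and permutations -/

/-- The standardisation of a word `u`: its letters are numbered `1, 2, …` from the smallest to the
largest letter and, among equal letters, from left to right. -/
def std {A : Type*} [LinearOrder A] (u : List A) : List ℕ :=
  List.ofFn fun i : Fin u.length =>
    (Finset.univ.filter fun j : Fin u.length =>
      u.get j < u.get i ∨ (u.get j = u.get i ∧ j ≤ i)).card

/-- An `m`-stuttering word: every letter occurs a multiple of `m` times. -/
def IsStutWord {A : Type*} [LinearOrder A] (m : ℕ) (u : List A) : Prop :=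
  ∀ a : A, m ∣ u.count a

/-- The word `1^m 2^m ⋯ n^m`. -/
def blockWord (m n : ℕ) : List ℕ :=
  (List.range n).flatMap fun i => List.replicate m (i + 1)

/-- The `m`-stuttering permutations, of all sizes `n`: the rearrangements of `1^m 2^m ⋯ n^m`. -/
def StutPerm (m : ℕ) : Type :=
  {w : List ℕ // ∃ n : ℕ, w.Perm (blockWord m n)}

/-- The underlying word. -/
def StutPerm.word {m : ℕ} (σ : StutPerm m) : List ℕ := σ.1

/-- The size `n` of a rearrangement of `1^m 2^m ⋯ n^m`: its number of letters divided by `m`. -/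
def StutPerm.size {m : ℕ} (σ : StutPerm m) : ℕ := σ.word.length / m

/-- `σ` is an `m`-standardisation of the word `u`: the `m`-stuttering permutation `σ` has the same
standardisation as `u`. -/
def HasMStd {A : Type*} [LinearOrder A] {m : ℕ} (u : List A) (σ : StutPerm m) : Prop :=
  std u = std σ.word

/-! ### Noncommutative formal series and the elements `G` -/

/-- Formal series `∑ f(w) w` in the noncommuting letters of `A`, with coefficients in `K`. -/
def NCSeries (K A : Type*) : Type _ := List A → K

namespace NCSeries

variable {K A : Type*} [Field K]

instance : AddCommGroup (NCSeries K A) := inferInstanceAs (AddCommGroup (List A → K))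

instance : SMul K (NCSeries K A) where
  smul c f := fun w => c * f w

instance : Module K (NCSeries K A) where
  one_smul f := funext fun w => one_mul (f w)
  mul_smul c d f := funext fun w => mul_assoc c d (f w)
  smul_zero c := funext fun _ => mul_zero c
  smul_add c f g := funext fun w => mul_add c (f w) (g w)
  add_smul c d f := funext fun w => add_mul c d (f w)
  zero_smul f := funext fun w => zero_mul (f w)

instance : One (NCSeries K A) where
  one := fun w => match w with
    | [] => 1
    | _ :: _ => 0

/-- The concatenation product: the coefficient of `w` is the sum of `f(u) g(v)` over the
factorisations `w = u v`. -/
instance : Mul (NCSeries K A) where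
  mul f g := fun w => ∑ i ∈ Finset.range (w.length + 1), f (w.take i) * g (w.drop i)

theorem add_apply (f g : NCSeries K A) (w : List A) : (f + g) w = f w + g w := rfl

theorem zero_apply (w : List A) : (0 : NCSeries K A) w = 0 := rfl

theorem smul_apply (c : K) (f : NCSeries K A) (w : List A) : (c • f) w = c * f w := rfl

theorem one_apply_nil : (1 : NCSeries K A) [] = 1 := rfl

theorem one_apply_of_ne {w : List A} (h : w ≠ []) : (1 : NCSeries K A) w = 0 := by
  cases w with
  | nil => exact absurd rfl h
  | cons a w => rfl

theorem mul_apply (f g : NCSeries K A) (w : List A) :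
    (f * g) w = ∑ i ∈ Finset.range (w.length + 1), f (w.take i) * g (w.drop i) := rfl

theorem one_mul' (f : NCSeries K A) : 1 * f = f := by
  funext w
  rw [mul_apply, Finset.sum_eq_single 0]
  · rw [List.take_zero, List.drop_zero, one_apply_nil, one_mul]
  · intro i hi h0
    rw [one_apply_of_ne, zero_mul]
    intro h
    rcases List.take_eq_nil_iff.1 h with h | h
    · exact h0 h
    · subst h
      simp at hi
      exact h0 hi
  · intro h
    simp at h

theorem mul_one' (f : NCSeries K A) : f * 1 = f := by
  funext w
  rw [mul_apply, Finset.sum_eq_single w.length]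
  · rw [List.take_length, List.drop_length, one_apply_nil, mul_one]
  · intro i hi h0
    rw [one_apply_of_ne, mul_zero]
    intro h
    have h1 := List.drop_eq_nil_iff.1 h
    have h2 := Finset.mem_range.1 hi
    omega
  · intro h
    simp at h

theorem mul_assoc' (f g h : NCSeries K A) : f * g * h = f * (g * h) := by
  funext w
  simp only [mul_apply, Finset.sum_mul, Finset.mul_sum]
  rw [Finset.sum_sigma', Finset.sum_sigma']
  refine Finset.sum_bij' (fun p _ => ⟨p.2, p.1 - p.2⟩) (fun p _ => ⟨p.1 + p.2, p.1⟩)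
    ?_ ?_ ?_ ?_ ?_
  · rintro ⟨i, j⟩ hp
    simp only [Finset.mem_sigma, Finset.mem_range, List.length_take, List.length_drop] at hp ⊢
    omega
  · rintro ⟨i, j⟩ hp
    simp only [Finset.mem_sigma, Finset.mem_range, List.length_take, List.length_drop] at hp ⊢
    omega
  · rintro ⟨i, j⟩ hp
    simp only [Finset.mem_sigma, Finset.mem_range, List.length_take] at hp
    simp only [Sigma.mk.injEq, heq_eq_eq, and_true]
    omega
  · rintro ⟨i, j⟩ hp
    simp only [Sigma.mk.injEq, heq_eq_eq, true_and]
    omega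
  · rintro ⟨i, j⟩ hp
    simp only [Finset.mem_sigma, Finset.mem_range, List.length_take] at hp
    have hj : j ≤ i := by omega
    have e1 : (w.take i).take j = w.take j := by
      rw [List.take_take, min_eq_left hj]
    have e2 : (w.take i).drop j = (w.drop j).take (i - j) := List.drop_take
    have e3 : (w.drop j).drop (i - j) = w.drop i := by
      rw [List.drop_drop]
      congr 1
      omega
    simp only [e1, e2, e3, mul_assoc]

instance : Ring (NCSeries K A) where
  __ := (inferInstance : AddCommGroup (NCSeries K A))
  left_distrib f g h := by
    funext w
    simp only [mul_apply, add_apply, mul_add, Finset.sum_add_distrib]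
  right_distrib f g h := by
    funext w
    simp only [mul_apply, add_apply, add_mul, Finset.sum_add_distrib]
  zero_mul f := by
    funext w
    simp [mul_apply, zero_apply]
  mul_zero f := by
    funext w
    simp [mul_apply, zero_apply]
  mul_assoc := mul_assoc'
  one_mul := one_mul'
  mul_one := mul_one'

theorem smul_mul' (c : K) (f g : NCSeries K A) : c • f * g = c • (f * g) := by
  funext w
  simp only [mul_apply, smul_apply, Finset.mul_sum, mul_assoc]

theorem mul_smul' (c : K) (f g : NCSeries K A) : f * c • g = c • (f * g) := by
  funext w
  simp only [mul_apply, smul_apply, Finset.mul_sum]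
  exact Finset.sum_congr rfl fun i _ => by ring

instance : Algebra K (NCSeries K A) where
  algebraMap :=
    { toFun := fun c => c • (1 : NCSeries K A)
      map_one' := one_smul K _
      map_mul' := fun c d => by rw [smul_mul', one_mul, mul_smul]
      map_zero' := zero_smul K _
      map_add' := fun c d => add_smul c d _ }
  commutes' c f := by
    change c • (1 : NCSeries K A) * f = f * c • (1 : NCSeries K A)
    rw [smul_mul', mul_smul', one_mul, mul_one]
  smul_def' c f := by
    change c • f = c • (1 : NCSeries K A) * f
    rw [smul_mul', one_mul]

end NCSeries

open Classical in
/-- `G_σ^{(m)}(A)`: the sum of the `m`-stuttering words over `A` whose `m`-standardisation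
is `σ`. -/
def G (K A : Type*) [Field K] [LinearOrder A] {m : ℕ} (σ : StutPerm m) : NCSeries K A :=
  fun w => if IsStutWord m w ∧ HasMStd w σ then 1 else 0

/-- `FQSym^{(m)}`, the algebra generated by the series `G_σ^{(m)}(A)`. -/
def FQSym (K A : Type*) [Field K] [LinearOrder A] (m : ℕ) : Subalgebra K (NCSeries K A) :=
  Algebra.adjoin K (Set.range fun σ : StutPerm m => G K A σ)

/-- The index set of the product `G_σ G_μ`: the `m`-stuttering permutations `ν = u v` where `u`, `v`
are `m`-stuttering words with `m`-standardisations `σ` and `μ`. -/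
def prodSet {m : ℕ} (σ μ : StutPerm m) : Set (StutPerm m) :=
  {ν | ∃ u v : List ℕ, ν.word = u ++ v ∧ IsStutWord m u ∧ IsStutWord m v ∧
    HasMStd u σ ∧ HasMStd v μ}

/-- The index set of the coproduct of `G_σ`: the pairs `(μ, ν)` such that for some `k ≤ n`, `μ` is
the subword of `σ` of the letters `≤ k` and `ν` is the `m`-standardisation of the subword of the
letters `> k`. -/
def coprodSet {m : ℕ} (σ : StutPerm m) : Set (StutPerm m × StutPerm m) :=
  {p | ∃ k ≤ σ.size, p.1.word = σ.word.filter (fun a => a ≤ k) ∧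
    HasMStd (σ.word.filter (fun a => k < a)) p.2}

/-! ### Doubling the alphabet

`A ⊕ₗ B` is the ordered sum: the letters of `A` are smaller than those of `B`. When the
letters of `A` commute with those of `B`, a word over `A ⊕ₗ B` becomes a pair (word over `A`,
word over `B`), and a series becomes a function on such pairs. -/

/-- The subword of the letters from `A`. -/
def leftPart {A B : Type*} (w : List (A ⊕ₗ B)) : List A :=
  w.filterMap fun x => (ofLex x).getLeft?

/-- The subword of the letters from `B`. -/
def rightPart {A B : Type*} (w : List (A ⊕ₗ B)) : List B :=
  w.filterMap fun x => (ofLex x).getRight?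

/-- The series obtained from a series over `A ⊕ₗ B` by letting the letters of `A` commute with those
of `B`: the coefficient of `u ⊗ v` is the sum of the coefficients of the (finitely many) words `w`
whose subwords over `A` and `B` are `u` and `v`. -/
def separate {K A B : Type*} [Field K] (f : NCSeries K (A ⊕ₗ B)) : List A → List B → K :=
  fun u v => ∑ᶠ w ∈ {w : List (A ⊕ₗ B) | leftPart w = u ∧ rightPart w = v}, f w

/-- The external product `f ⊗ g` of a series over `A` and a series over `B`; the coefficient of
`u ⊗ v` is `f(u) g(v)`. -/
def seriesTensor (K A B : Type*) [Field K] :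
    NCSeries K A →ₗ[K] NCSeries K B →ₗ[K] (List A → List B → K) :=
  LinearMap.mk₂ K (fun f g u v => f u * g v)
    (fun f f' g => by funext u v; simp [NCSeries.add_apply, add_mul])
    (fun c f g => by funext u v; simp [NCSeries.smul_apply, mul_assoc])
    (fun f g g' => by funext u v; simp [NCSeries.add_apply, mul_add])
    (fun c f g => by funext u v; simp [NCSeries.smul_apply, mul_left_comm])

/-- The realisation of `FQSym^{(m)} ⊗ FQSym^{(m)}` as series in two mutually commuting copies
of `A`. -/
def realizeTensor (K A : Type*) [Field K] [LinearOrder A] (m : ℕ) :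
    (FQSym K A m) ⊗[K] (FQSym K A m) →ₗ[K] (List A → List A → K) :=
  TensorProduct.lift ((seriesTensor K A A).compl₁₂
    (FQSym K A m).val.toLinearMap (FQSym K A m).val.toLinearMap)

/-! ### Hopf algebras and duality

Mathlib's `HopfAlgebra K X` carries its own algebra structure. Here the algebra structure of `X` is
given beforehand, so the axioms are stated for a coalgebra structure on the given algebra. -/

section Hopf

variable (K : Type*) {X : Type*} [Field K] [Semiring X] [Algebra K X] [Coalgebra K X]

/-- `S` is an antipode: a two-sided convolution inverse of the identity. -/
def IsAntipode (S : X →ₗ[K] X) : Prop :=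
  LinearMap.mul' K X ∘ₗ S.rTensor X ∘ₗ CoalgebraStruct.comul =
    Algebra.linearMap K X ∘ₗ CoalgebraStruct.counit ∧
  LinearMap.mul' K X ∘ₗ S.lTensor X ∘ₗ CoalgebraStruct.comul =
    Algebra.linearMap K X ∘ₗ CoalgebraStruct.counit

variable (X) in
/-- The algebra `X` with its coalgebra structure is a Hopf algebra: the counit and the coproduct are
algebra morphisms, and there is an antipode. -/
structure IsHopf : Prop where
  counit_one : CoalgebraStruct.counit (R := K) (1 : X) = 1
  counit_mul : ∀ x y : X, CoalgebraStruct.counit (R := K) (x * y) =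
    CoalgebraStruct.counit (R := K) x * CoalgebraStruct.counit (R := K) y
  comul_one : CoalgebraStruct.comul (R := K) (1 : X) = 1
  comul_mul : ∀ x y : X, CoalgebraStruct.comul (R := K) (x * y) =
    CoalgebraStruct.comul (R := K) x * CoalgebraStruct.comul (R := K) y
  exists_antipode : ∃ S : X →ₗ[K] X, IsAntipode K S

/-- The Hopf algebra structure in Mathlib's sense. -/
abbrev IsHopf.toHopfAlgebra (h : IsHopf K X) : HopfAlgebra K X :=
  { Bialgebra.mk' K X h.counit_one (h.counit_mul _ _) h.comul_one (h.comul_mul _ _) with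
    antipode := h.exists_antipode.choose
    mul_antipode_rTensor_comul := h.exists_antipode.choose_spec.1
    mul_antipode_lTensor_comul := h.exists_antipode.choose_spec.2 }

/-- A subalgebra of a Hopf algebra that is a Hopf subalgebra: it is stable under the coproduct and
under the antipode. -/
def IsHopfSubalgebra (Q : Subalgebra K X) : Prop :=
  (∀ z ∈ Q, CoalgebraStruct.comul (R := K) z ∈
    LinearMap.range (TensorProduct.map Q.val.toLinearMap Q.val.toLinearMap)) ∧
  (∀ S : X →ₗ[K] X, IsAntipode K S → ∀ z ∈ Q, S z ∈ Q)

variable {K}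

/-- The linear forms on the coalgebra `X` form the convolution algebra `WithConv (X →ₗ[K] K)`, whose
product is the transpose of the coproduct: `⟨y * z, x⟩ = ⟨y ⊗ z, Δ x⟩`. This map sends an element of
a subalgebra `D` of it to the linear form that it is. -/
def toDual (D : Subalgebra K (WithConv (X →ₗ[K] K))) : D →ₗ[K] Module.Dual K X :=
  (WithConv.linearEquiv K (X →ₗ[K] K)).toLinearMap ∘ₗ D.val.toLinearMap

/-- The pairing `⟨y ⊗ z, a ⊗ b⟩ = ⟨y, a⟩ ⟨z, b⟩`. -/
def dualPairing (D : Subalgebra K (WithConv (X →ₗ[K] K))) :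
    D ⊗[K] D →ₗ[K] Module.Dual K (X ⊗[K] X) :=
  TensorProduct.dualDistrib K X X ∘ₗ TensorProduct.map (toDual D) (toDual D)

end Hopf

/-! ### Binary trees, the Tamari order and `m`-binary trees -/

/-- Binary trees: empty, or a root with a left and a right subtree. -/
abbrev BTree : Type := BinaryTree Unit

/-- The tree with left subtree `l` and right subtree `r`. -/
abbrev bnode (l r : BTree) : BTree := BinaryTree.node () l r

/-- Insertion of `k` in a binary search tree: to the left when `k ≤ root`, otherwise to the
right. -/
def bstInsert (k : ℕ) : BinaryTree ℕ → BinaryTree ℕ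
  | .nil => .node k .nil .nil
  | .node x l r => if k ≤ x then .node x (bstInsert k l) r else .node x l (bstInsert k r)

/-- The binary search tree of a word: its letters are inserted from right to left. -/
def bst (w : List ℕ) : BinaryTree ℕ := w.foldr bstInsert .nil

/-- The underlying unlabelled binary tree. -/
def shape (t : BinaryTree ℕ) : BTree := t.map fun _ => ()

/-- The left-right mirror image. -/
def mirror : BTree → BTree
  | .nil => .nil
  | .node _ l r => bnode (mirror r) (mirror l)

/-- `T` with `S` grafted as left child of its leftmost node. -/
def graftLeft (S : BTree) : BTree → BTree
  | .nil => S
  | .node _ l r => bnode (graftLeft S l) r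

/-- `T` with `S` grafted as right child of its rightmost node. -/
def graftRight (S : BTree) : BTree → BTree
  | .nil => S
  | .node _ l r => bnode l (graftRight S r)

/-- The binary tree built from `L` and `R₁, …, R_m` on `m` root nodes: `L` is the left subtree of
the first root node; its right subtree is `R₁` with the second root node grafted to the left of the
leftmost node of `R₁`; the right subtree of the second root node is `R₂` with the third root node
grafted in the same way, and so on; the right subtree of the last root node is `R_m`. -/
def rootChain (L : BTree) : List BTree → BTree
  | [] => L
  | R :: Rs => bnode L (graftLeft (rootChain .nil Rs) R)

/-- The `m`-binary trees: the empty tree, or `m + 1` `m`-binary trees grafted on `m` root nodes. -/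
inductive IsMBinary (m : ℕ) : BTree → Prop
  | nil : IsMBinary m .nil
  | chain (L : BTree) (Rs : List BTree) (hlen : Rs.length = m) (hL : IsMBinary m L)
      (hR : ∀ R ∈ Rs, IsMBinary m R) : IsMBinary m (rootChain L Rs)

/-- A right rotation at some node: `y(x(A, B), C)` becomes `x(A, y(B, C))`. -/
inductive Rotation : BTree → BTree → Prop
  | root (A B C : BTree) : Rotation (bnode (bnode A B) C) (bnode A (bnode B C))
  | left {S S' : BTree} (R : BTree) (h : Rotation S S') : Rotation (bnode S R) (bnode S' R)
  | right (L : BTree) {S S' : BTree} (h : Rotation S S') : Rotation (bnode L S) (bnode L S')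

/-- The Tamari order: `T'` is obtained from `T` by a sequence of right rotations. -/
def TamariLE (T T' : BTree) : Prop := Relation.ReflTransGen Rotation T T'

/-- The type of `m`-binary trees. -/
def MBinTree (m : ℕ) : Type := {T : BTree // IsMBinary m T}

/-- The underlying binary tree. -/
def MBinTree.tree {m : ℕ} (T : MBinTree m) : BTree := T.1

/-- The `m`-Tamari order on `m`-binary trees: the restriction of the Tamari order. -/
instance (m : ℕ) : Preorder (MBinTree m) where
  le T T' := TamariLE T.tree T'.tree
  le_refl _ := Relation.ReflTransGen.refl
  le_trans _ _ _ h h' := Relation.ReflTransGen.trans h h'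

/-- The sylvester class attached to the `m`-binary tree `T`: the `m`-stuttering permutations whose
binary search tree has the shape of the mirror image of `T`. -/
def sylvesterClass {m : ℕ} (T : MBinTree m) : Set (StutPerm m) :=
  {σ | shape (bst σ.word) = mirror T.tree}

end MStut

end

open scoped TensorProduct
open MStut

noncomputable section

namespace MStut

/-! ### Standardisation -/

/-! Words are compared through `SameStd`: equal lengths, and the same truth value of `u_i ≤ u_j` for
all `i < j`. This is equivalent to equality of standardisations and passes to factors and to
increasing relabellings. Stuttering enters through one counting argument, `lt_of_lt_of_count`: a
stuttering word compared with a word of the same standardisation in which every letter occurs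
exactly `m` times keeps its strict inequalities strict, because numbers of smaller letters are
multiples of `m`. So a stuttering word is a weakly increasing relabelling of its
`m`-standardisation.

The product and coproduct formulas compare coefficients, and every sum involved has at most one
nonzero term. For the product, the point is that a prefix of a word stutters exactly when the same
prefix of its `m`-standardisation does (`isStutWord_take_iff`). For the coproduct, the letters from
`A` of a word over the ordered sum sit at the places of the letters `≤ k` of `σ` for some `k`, and
comparisons across the two alphabets then agree by themselves. Separation of the alphabets is
multiplicative (`separate_mul`) and tensors are faithfully realised by series in two alphabets, so
the coproduct is an algebra morphism. The grading by size is connected, so the antipode is a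
geometric series for convolution.

The dual is the span `D` of the coordinate forms. Elements of `D` and of its tensor powers are
determined by their values on basis elements, and this transposes the axioms.

The sum over a sylvester class is the form equal to 1 on the `b ν` whose tree is `T` and to 0 on the
others. The product of two such forms, at `b ν`, asks whether some cut of the letters of `ν` yields
the two given trees. Cutting the letters cuts the search tree in infix order (`Splits`), and the
trees that can be cut into `U` and `V` form exactly the Tamari interval from `graftLeft U V` to
`graftRight V U` (`splits_iff`), since along rotations the two parts of a cut can only go up. The
coproduct stays in the span because the search tree of a concatenation depends only on the search
trees of the factors (`bst_append_congr`). The trees that occur are exactly the `m`-binary ones: the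
`m` root nodes carry `m` equal labels (`isMBinary_and_exists_chain`, `IsMBinary.hasLabelling`). -/

theorem card_filter_le_iff {N : ℕ} {L : Type*} [LinearOrder L] (f : Fin N → L) (i j : Fin N) :
    (Finset.univ.filter fun k => f k ≤ f i).card ≤ (Finset.univ.filter fun k => f k ≤ f j).card ↔
      f i ≤ f j := by
  constructor
  · intro h
    by_contra hlt
    push Not at hlt
    refine absurd h (not_le.2 (Finset.card_lt_card ?_))
    rw [Finset.ssubset_iff_of_subset]
    · exact ⟨i, by simp, by simpa using hlt⟩
    · intro k
      simp only [Finset.mem_filter, Finset.mem_univ, true_and]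
      exact fun hk => hk.trans hlt.le
  · intro h
    refine Finset.card_le_card fun k => ?_
    simp only [Finset.mem_filter, Finset.mem_univ, true_and]
    exact fun hk => hk.trans h

/-- The position `i` of `u` with its letter, in the order in which the letters are numbered. -/
def stdKey {A : Type*} [LinearOrder A] (u : List A) (i : Fin u.length) : A ×ₗ Fin u.length :=
  toLex (u.get i, i)

theorem stdKey_injective {A : Type*} [LinearOrder A] (u : List A) :
    Function.Injective (stdKey u) := fun i j h => by
  simpa [stdKey] using congrArg (fun x => (ofLex x).2) h

/-- The number of the position `i` in the standardisation. -/
def stdRank {A : Type*} [LinearOrder A] (u : List A) (i : Fin u.length) : ℕ :=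
  (Finset.univ.filter fun j => stdKey u j ≤ stdKey u i).card

theorem std_eq_ofFn {A : Type*} [LinearOrder A] (u : List A) :
    std u = List.ofFn (stdRank u) := by
  unfold std
  congr 1
  funext i
  simp [stdRank, stdKey, Prod.Lex.toLex_le_toLex]

/-- Equal letters are numbered from left to right, so for `i < j` a tie gives increasing ranks; this
is why only weak comparisons from left to right are recorded. -/
theorem stdRank_le_iff {A : Type*} [LinearOrder A] (u : List A) {i j : Fin u.length}
    (hij : i < j) : stdRank u i ≤ stdRank u j ↔ u.get i ≤ u.get j := by
  rw [stdRank, stdRank, card_filter_le_iff (stdKey u), stdKey, stdKey,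
    Prod.Lex.toLex_le_toLex, le_iff_lt_or_eq (a := u.get i)]
  simp only [hij.le, and_true]

theorem stdRank_injective {A : Type*} [LinearOrder A] (u : List A) :
    Function.Injective (stdRank u) := fun i j h => by
  have h1 := (card_filter_le_iff (stdKey u) i j).1 h.le
  have h2 := (card_filter_le_iff (stdKey u) j i).1 h.ge
  exact stdKey_injective u (le_antisymm h1 h2)

@[simp] theorem length_std {A : Type*} [LinearOrder A] (u : List A) :
    (std u).length = u.length := by simp [std]

/-- Two words with the same length and the same inversions. -/
def SameStd {A B : Type*} [LE A] [LE B] (u : List A) (v : List B) : Prop :=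
  u.length = v.length ∧ (u.zip v).Pairwise fun p q => p.1 ≤ q.1 ↔ p.2 ≤ q.2

theorem sameStd_iff_get {A B : Type*} [LE A] [LE B] {u : List A} {v : List B} :
    SameStd u v ↔ u.length = v.length ∧ ∀ i j (hiu : i < u.length) (hju : j < u.length)
      (hiv : i < v.length) (hjv : j < v.length), i < j → (u[i] ≤ u[j] ↔ v[i] ≤ v[j]) := by
  unfold SameStd
  refine and_congr_right fun h => ?_
  rw [List.pairwise_iff_getElem]
  simp only [List.length_zip, List.getElem_zip, lt_min_iff]
  constructor
  · intro H i j hiu hju hiv hjv hij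
    exact H i j ⟨hiu, hiv⟩ ⟨hju, hjv⟩ hij
  · intro H i j hi hj hij
    exact H i j hi.1 hj.1 hi.2 hj.2 hij

theorem sameStd_std {A : Type*} [LinearOrder A] (u : List A) : SameStd u (std u) := by
  rw [sameStd_iff_get]
  refine ⟨by simp, fun i j hiu hju hiv hjv hij => ?_⟩
  simp only [std_eq_ofFn, List.getElem_ofFn]
  exact (stdRank_le_iff u (i := ⟨i, hiu⟩) (j := ⟨j, hju⟩) hij).symm

theorem SameStd.symm {A B : Type*} [LE A] [LE B] {u : List A} {v : List B} (h : SameStd u v) :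
    SameStd v u := by
  rw [sameStd_iff_get] at h ⊢
  exact ⟨h.1.symm, fun i j hiu hju hiv hjv hij => (h.2 i j hiv hjv hiu hju hij).symm⟩

theorem SameStd.trans {A B C : Type*} [LE A] [LE B] [LE C] {u : List A} {v : List B} {w : List C}
    (h : SameStd u v) (h' : SameStd v w) : SameStd u w := by
  rw [sameStd_iff_get] at h h' ⊢
  refine ⟨h.1.trans h'.1, fun i j hiu hju hiv hjv hij => ?_⟩
  have hi : i < v.length := h.1 ▸ hiu
  have hj : j < v.length := h.1 ▸ hju
  exact (h.2 i j hiu hju hi hj hij).trans (h'.2 i j hi hj hiv hjv hij)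

/-- The rank of `i` counts the earlier positions `k` with `u_k ≤ u_i` and the later ones with `u_k <
u_i`, the latter being the negation of `u_i ≤ u_k`. Both conditions are visible to `SameStd`. -/
theorem std_eq_of_sameStd {A B : Type*} [LinearOrder A] [LinearOrder B] {u : List A} {v : List B}
    (h : SameStd u v) : std u = std v := by
  rw [sameStd_iff_get] at h
  obtain ⟨hl, h⟩ := h
  refine List.ext_getElem (by simpa using hl) fun i hi hi' => ?_
  simp only [std, List.getElem_ofFn, List.get_eq_getElem]
  simp only [length_std] at hi hi'
  refine Finset.card_bij (fun k _ => Fin.cast hl k) ?_ ?_ ?_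
  · rintro ⟨k, hk⟩
    simp only [Finset.mem_filter, Finset.mem_univ, true_and, Fin.cast_mk, Fin.mk_le_mk]
    rcases lt_trichotomy k i with hki | rfl | hki
    · have := h k i hk hi (hl ▸ hk) hi' hki
      simp only [hki.le, and_true, ← le_iff_lt_or_eq]
      exact this.1
    · simp
    · have := h i k hi hk hi' (hl ▸ hk) hki
      simp only [hki.not_ge, and_false, or_false, ← not_le, this]
      exact id
  · intro a _ b _ hab
    simpa using hab
  · rintro ⟨k, hk⟩ hk'
    refine ⟨⟨k, hl ▸ hk⟩, ?_, rfl⟩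
    simp only [Finset.mem_filter, Finset.mem_univ, true_and, Fin.mk_le_mk] at hk' ⊢
    have hk2 : k < u.length := hl ▸ hk
    rcases lt_trichotomy k i with hki | rfl | hki
    · have := h k i hk2 hi hk hi' hki
      simp only [hki.le, and_true, ← le_iff_lt_or_eq] at hk' ⊢
      exact this.2 hk'
    · simp
    · have := h i k hi hk2 hi' hk hki
      simp only [hki.not_ge, and_false, or_false, ← not_le, this] at hk' ⊢
      exact hk'

theorem std_eq_iff {A B : Type*} [LinearOrder A] [LinearOrder B] {u : List A} {v : List B} :
    std u = std v ↔ SameStd u v :=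
  ⟨fun h => (sameStd_std u).trans (h ▸ (sameStd_std v).symm), std_eq_of_sameStd⟩

theorem std_perm {A : Type*} [LinearOrder A] (u : List A) :
    (std u).Perm ((List.range u.length).map (· + 1)) := by
  refine List.Subperm.perm_of_length_le ?_ (by simp)
  rw [std_eq_ofFn]
  refine (List.nodup_ofFn.2 (stdRank_injective u)).subperm fun r hr => ?_
  obtain ⟨i, rfl⟩ := (List.mem_ofFn' _ _).1 hr
  have h1 : 0 < stdRank u i := Finset.card_pos.2 ⟨i, by simp⟩
  have h2 : stdRank u i ≤ u.length := (Finset.card_le_univ _).trans (by simp)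
  simp only [List.mem_map, List.mem_range]
  exact ⟨stdRank u i - 1, by omega, by omega⟩

theorem sameStd_take {A B : Type*} [LE A] [LE B] {u : List A} {v : List B} (h : SameStd u v)
    (i : ℕ) : SameStd (u.take i) (v.take i) := by
  refine ⟨by simp [h.1], ?_⟩
  unfold List.zip
  rw [← List.take_zipWith]
  exact h.2.sublist (List.take_sublist _ _)

theorem sameStd_drop {A B : Type*} [LE A] [LE B] {u : List A} {v : List B} (h : SameStd u v)
    (i : ℕ) : SameStd (u.drop i) (v.drop i) := by
  refine ⟨by simp [h.1], ?_⟩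
  unfold List.zip
  rw [← List.drop_zipWith]
  exact h.2.sublist (List.drop_sublist _ _)

theorem sameStd_map {A B : Type*} [LE A] [LE B] (u : List A) (f : A → B)
    (h : ∀ a ∈ u, ∀ b ∈ u, (a ≤ b ↔ f a ≤ f b)) : SameStd u (u.map f) := by
  rw [sameStd_iff_get]
  refine ⟨by simp, fun i j hiu hju hiv hjv hij => ?_⟩
  simp only [List.getElem_map]
  exact h _ (List.getElem_mem _) _ (List.getElem_mem _)

/-- Strictness may be lost: a strict rise from left to right in `u` can be a tie in `v`, as
`SameStd` does not tell `<` from `=` in that direction. -/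
theorem SameStd.le_of_lt {A B : Type*} [LinearOrder A] [LinearOrder B] {u : List A} {v : List B}
    (h : SameStd u v) : ∀ p ∈ u.zip v, ∀ q ∈ u.zip v, p.1 < q.1 → p.2 ≤ q.2 := by
  intro p hp q hq hlt
  obtain ⟨i, hi, rfl⟩ := List.getElem_of_mem hp
  obtain ⟨j, hj, rfl⟩ := List.getElem_of_mem hq
  have h2 := List.pairwise_iff_getElem.1 h.2
  rcases lt_trichotomy i j with hij | rfl | hij
  · exact (h2 i j hi hj hij).1 hlt.le
  · exact absurd hlt (lt_irrefl _)
  · exact (not_le.1 (mt (h2 j i hj hi hij).2 hlt.not_ge)).le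

/-! ### `m`-stuttering words -/

/-- The count over any set of letters is a sum of counts of single letters. -/
theorem IsStutWord.dvd_countP {A : Type*} [LinearOrder A] {m : ℕ} {u : List A}
    (h : IsStutWord m u) (p : A → Bool) : m ∣ u.countP p := by
  rw [← List.sum_map_count_dedup_filter_eq_countP]
  refine List.dvd_sum fun x hx => ?_
  obtain ⟨a, _, rfl⟩ := List.mem_map.1 hx
  exact h a

theorem IsStutWord.dvd_length {A : Type*} [LinearOrder A] {m : ℕ} {u : List A}
    (h : IsStutWord m u) : m ∣ u.length := by
  simpa using h.dvd_countP fun _ => true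

theorem IsStutWord.map {A B : Type*} [LinearOrder A] [LinearOrder B] {m : ℕ} {u : List A}
    (h : IsStutWord m u) (f : A → B) : IsStutWord m (u.map f) := fun b => by
  rw [List.count, List.countP_map]
  exact h.dvd_countP _

theorem IsStutWord.append {A : Type*} [LinearOrder A] {m : ℕ} {u v : List A}
    (h : IsStutWord m u) (h' : IsStutWord m v) : IsStutWord m (u ++ v) := fun a => by
  rw [List.count_append]
  exact dvd_add (h a) (h' a)

theorem countP_lt_countP {A : Type*} {p q : A → Bool} {l : List A}
    (h : ∀ a ∈ l, p a → q a) {a : A} (ha : a ∈ l) (hp : ¬ p a) (hq : q a) :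
    l.countP p < l.countP q := by
  obtain ⟨s, t, rfl⟩ := List.append_of_mem ha
  have h1 : s.countP p ≤ s.countP q := List.countP_mono_left fun x hx => h x (by simp [hx])
  have h2 : t.countP p ≤ t.countP q := List.countP_mono_left fun x hx => h x (by simp [hx])
  simp only [List.countP_append, List.countP_cons, hp, hq]
  simp only [Bool.false_eq_true, if_true, if_false]
  omega

/-- If `p.1 < q.1` but `p.2 = q.2 = c`, the number of letters `≤ p.1` of `u` lies strictly between
the numbers of letters `< c` and `≤ c` of `v`. These are consecutive multiples of `m`, while the
number in between is itself a multiple of `m`. -/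
theorem lt_of_lt_of_count {A B : Type*} [LinearOrder A] [LinearOrder B] {m : ℕ} {u : List A}
    {v : List B} (h : SameStd u v) (hu : IsStutWord m u) (hv : ∀ b ∈ v, v.count b = m) :
    ∀ p ∈ u.zip v, ∀ q ∈ u.zip v, p.1 < q.1 → p.2 < q.2 := by
  intro p hp q hq hlt
  refine lt_of_le_of_ne (h.le_of_lt p hp q hq hlt) fun heq => ?_
  have key := h.le_of_lt
  have hvs : IsStutWord m v := fun b => by
    by_cases hb : b ∈ v
    · rw [hv b hb]
    · rw [List.count_eq_zero_of_not_mem hb]; exact dvd_zero m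
  have hfst : (u.zip v).map Prod.fst = u := List.map_fst_zip h.1.le
  have hsnd : (u.zip v).map Prod.snd = v := List.map_snd_zip h.1.ge
  have c1 : m ∣ (u.zip v).countP fun r => decide (r.2 < q.2) := by
    have := hvs.dvd_countP fun b => decide (b < q.2)
    rwa [← hsnd, List.countP_map] at this
  have c2 : m ∣ (u.zip v).countP fun r => decide (r.1 ≤ p.1) := by
    have := hu.dvd_countP fun b => decide (b ≤ p.1)
    rwa [← hfst, List.countP_map] at this
  have c3 : (u.zip v).countP (fun r => decide (r.2 ≤ q.2)) =
      (u.zip v).countP (fun r => decide (r.2 < q.2)) + m := by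
    have hq2 : q.2 ∈ v := hsnd ▸ List.mem_map_of_mem hq
    have h1 : v.countP (fun b => decide (b ≤ q.2)) =
        v.countP (fun b => decide (b < q.2)) + v.count q.2 := by
      generalize q.2 = c
      clear * -
      induction v with
      | nil => simp
      | cons x v ih =>
        simp only [List.countP_cons, List.count_cons, ih, decide_eq_true_eq, beq_iff_eq]
        rcases lt_trichotomy x c with hx | hx | hx
        · simp only [hx.le, hx, hx.ne, if_true, if_false]; omega
        · simp only [hx, le_refl, lt_irrefl, if_true, if_false]; omega
        · simp only [hx.not_ge, hx.not_gt, hx.ne', if_false]; omega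
    rw [hv _ hq2] at h1
    rw [← hsnd, List.countP_map, List.countP_map] at h1
    exact h1
  -- The position of `p` makes this inequality strict, and the position of `q` the next one.
  have l1 : (u.zip v).countP (fun r => decide (r.2 < q.2)) <
      (u.zip v).countP fun r => decide (r.1 ≤ p.1) := by
    refine countP_lt_countP ?_ hp ?_ ?_
    · intro r hr
      simp only [decide_eq_true_eq]
      intro hr2
      by_contra hcon
      exact absurd (key p hp r hr (not_le.1 hcon)) (by rw [heq]; exact hr2.not_ge)
    · simp [heq]
    · simp
  have l2 : (u.zip v).countP (fun r => decide (r.1 ≤ p.1)) <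
      (u.zip v).countP fun r => decide (r.2 ≤ q.2) := by
    refine countP_lt_countP ?_ hq ?_ ?_
    · intro r hr
      simp only [decide_eq_true_eq]
      intro hr1
      exact key r hr q hq (hr1.trans_lt hlt)
    · simpa using hlt
    · simp
  obtain ⟨a, ha⟩ := c1
  obtain ⟨b, hb⟩ := c2
  rw [c3] at l2
  rw [ha, hb] at l1
  rw [ha, hb] at l2
  have e1 : a < b := lt_of_mul_lt_mul_left l1 (Nat.zero_le m)
  have e2 : b < a + 1 := by
    refine lt_of_mul_lt_mul_left (a := m) ?_ (Nat.zero_le m)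
    rw [mul_add, mul_one]; exact l2
  omega

/-! ### `m`-stuttering permutations -/

theorem blockWord_succ (m n : ℕ) :
    blockWord m (n + 1) = blockWord m n ++ List.replicate m (n + 1) := by
  simp [blockWord, List.range_succ]

theorem count_blockWord (m n a : ℕ) :
    (blockWord m n).count a = if 1 ≤ a ∧ a ≤ n then m else 0 := by
  induction n with
  | zero =>
    rw [if_neg (by omega)]
    simp [blockWord]
  | succ n ih =>
    rw [blockWord_succ, List.count_append, ih, List.count_replicate]
    by_cases h : a = n + 1
    · subst h
      simp
    · rw [if_neg (c := (n + 1 == a) = true) (by simpa using Ne.symm h), add_zero]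
      congr 1
      simp only [eq_iff_iff]
      omega

theorem length_blockWord (m n : ℕ) : (blockWord m n).length = m * n := by
  induction n with
  | zero => simp [blockWord]
  | succ n ih => rw [blockWord_succ, List.length_append, ih, List.length_replicate, mul_add, mul_one]

/-- Grouping ranks `m` by `m` turns a standardisation into an `m`-standardisation. -/
theorem map_div_range (m n : ℕ) (hm : 1 ≤ m) :
    (List.range (m * n)).map (fun r => r / m + 1) = blockWord m n := by
  induction n with
  | zero => simp [blockWord]
  | succ n ih =>
    rw [blockWord_succ, ← ih, mul_add, mul_one, List.range_add, List.map_append, List.map_map]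
    congr 1
    rw [List.eq_replicate_iff]
    refine ⟨by simp, fun b hb => ?_⟩
    obtain ⟨x, hx, rfl⟩ := List.mem_map.1 hb
    rw [List.mem_range] at hx
    simp only [Function.comp_apply]
    rw [Nat.mul_add_div (by omega), Nat.div_eq_of_lt hx, add_zero]

theorem perm_blockWord_iff {m n : ℕ} {w : List ℕ} :
    w.Perm (blockWord m n) ↔ ∀ a, w.count a = if 1 ≤ a ∧ a ≤ n then m else 0 := by
  rw [List.perm_iff_count]
  simp only [count_blockWord]

theorem countP_lt_blockWord (m n c : ℕ) (hc : 1 ≤ c) (hn : c ≤ n + 1) :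
    (blockWord m n).countP (fun b => decide (b < c)) = m * (c - 1) := by
  induction n with
  | zero =>
    obtain rfl : c = 1 := by omega
    simp [blockWord]
  | succ n ih =>
    rw [blockWord_succ, List.countP_append, List.countP_replicate]
    by_cases h : c ≤ n + 1
    · rw [ih h, if_neg (by simp; omega), add_zero]
    · obtain rfl : c = n + 2 := by omega
      rw [if_pos (by simp), List.countP_eq_length.2, length_blockWord]
      · rw [show n + 2 - 1 = n + 1 by omega, mul_add, mul_one]
      · intro a ha
        have := List.count_pos_iff.2 ha
        rw [count_blockWord] at this
        split_ifs at this with h'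
        · simp; omega
        · omega

namespace StutPerm

variable {m : ℕ}

theorem length_word (σ : StutPerm m) : ∃ n, σ.word.Perm (blockWord m n) ∧ σ.word.length = m * n := by
  obtain ⟨w, n, h⟩ := σ
  exact ⟨n, h, h.length_eq.trans (length_blockWord m n)⟩

theorem perm_size (hm : 1 ≤ m) (σ : StutPerm m) : σ.word.Perm (blockWord m σ.size) := by
  obtain ⟨n, h, hl⟩ := σ.length_word
  rwa [size, hl, Nat.mul_div_cancel_left _ hm]

theorem length_eq (hm : 1 ≤ m) (σ : StutPerm m) : σ.word.length = m * σ.size := by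
  rw [(σ.perm_size hm).length_eq, length_blockWord]

theorem count_word (hm : 1 ≤ m) (σ : StutPerm m) (a : ℕ) :
    σ.word.count a = if 1 ≤ a ∧ a ≤ σ.size then m else 0 :=
  perm_blockWord_iff.1 (σ.perm_size hm) a

theorem mem_word (hm : 1 ≤ m) (σ : StutPerm m) (a : ℕ) :
    a ∈ σ.word ↔ 1 ≤ a ∧ a ≤ σ.size := by
  rw [← List.count_pos_iff, count_word hm]
  split_ifs with h
  · simp [h]; omega
  · simp [h]

theorem count_of_mem (hm : 1 ≤ m) (σ : StutPerm m) : ∀ a ∈ σ.word, σ.word.count a = m :=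
  fun a ha => by rw [count_word hm, if_pos ((σ.mem_word hm a).1 ha)]

theorem isStutWord (σ : StutPerm m) : IsStutWord m σ.word := fun a => by
  obtain ⟨n, h, -⟩ := σ.length_word
  rw [perm_blockWord_iff.1 h]
  split_ifs <;> simp

theorem ext {σ τ : StutPerm m} (h : σ.word = τ.word) : σ = τ := Subtype.ext h

/-- The empty permutation. -/
def empty (m : ℕ) : StutPerm m := ⟨[], 0, by simp [blockWord]⟩

@[simp] theorem word_empty : (empty m).word = [] := rfl

theorem eq_empty_of_size (hm : 1 ≤ m) {σ : StutPerm m} (h : σ.size = 0) : σ = empty m := by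
  refine ext (List.eq_nil_of_length_eq_zero ?_)
  rw [σ.length_eq hm, h, mul_zero]

@[simp] theorem size_empty : (empty m).size = 0 := by simp [size]

theorem finite_size (hm : 1 ≤ m) (n : ℕ) : {σ : StutPerm m | σ.size = n}.Finite := by
  have hs : {w : List ℕ | w.Perm (blockWord m n)}.Finite := by
    refine ((blockWord m n).permutations.toFinset.finite_toSet).subset fun w hw => ?_
    simpa using hw
  refine Set.Finite.of_finite_image (f := word) (hs.subset ?_) fun σ _ τ _ h => ext h
  rintro _ ⟨σ, rfl, rfl⟩
  exact σ.perm_size hm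

theorem perm_filter_le (hm : 1 ≤ m) (σ : StutPerm m) (k : ℕ) :
    (σ.word.filter fun a => a ≤ k).Perm (blockWord m (min k σ.size)) := by
  rw [perm_blockWord_iff]
  intro a
  by_cases h : a ≤ k
  · rw [List.count_filter (by simpa using h), σ.count_word hm]
    congr 1
    simp only [eq_iff_iff]
    omega
  · rw [if_neg (by omega)]
    refine List.count_eq_zero_of_not_mem fun hmem => h ?_
    simpa using (List.mem_filter.1 hmem).2

/-- The subword of the letters `≤ k`. -/
def low (hm : 1 ≤ m) (σ : StutPerm m) (k : ℕ) : StutPerm m :=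
  ⟨σ.word.filter fun a => a ≤ k, min k σ.size, σ.perm_filter_le hm k⟩

/-- The subword of the letters `> k`, renumbered. -/
def high (hm : 1 ≤ m) (σ : StutPerm m) (k : ℕ) : StutPerm m :=
  ⟨(σ.word.filter fun a => k < a).map (· - k), σ.size - k, by
    rw [perm_blockWord_iff]
    intro a
    rw [List.count, List.countP_map, List.countP_filter]
    -- Subtraction is truncated: for `a ≥ 1`, `x - k = a` means `x = a + k`, while the value 0 would
    -- need `x ≤ k`, which the filter excludes.
    by_cases h : 1 ≤ a
    · trans σ.word.count (a + k)
      · refine List.countP_congr fun x _ => ?_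
        simp only [Function.comp_apply, Bool.and_eq_true, beq_iff_eq, decide_eq_true_eq]
        omega
      · rw [σ.count_word hm]
        congr 1
        simp only [eq_iff_iff]
        omega
    · rw [if_neg (by omega), List.countP_eq_zero]
      intro x _
      simp only [Function.comp_apply, Bool.and_eq_true, beq_iff_eq, decide_eq_true_eq]
      omega⟩

theorem word_low (hm : 1 ≤ m) (σ : StutPerm m) (k : ℕ) :
    (σ.low hm k).word = σ.word.filter fun a => a ≤ k := rfl

theorem word_high (hm : 1 ≤ m) (σ : StutPerm m) (k : ℕ) :
    (σ.high hm k).word = (σ.word.filter fun a => k < a).map (· - k) := rfl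

theorem size_eq_of_perm (hm : 1 ≤ m) (σ : StutPerm m) {n : ℕ} (h : σ.word.Perm (blockWord m n)) :
    σ.size = n := by
  rw [size, h.length_eq, length_blockWord, Nat.mul_div_cancel_left _ hm]

theorem size_low (hm : 1 ≤ m) (σ : StutPerm m) (k : ℕ) (hk : k ≤ σ.size) :
    (σ.low hm k).size = k := by
  rw [size_eq_of_perm hm (σ.low hm k) (σ.perm_filter_le hm k), min_eq_left hk]

theorem size_low_add_size_high (hm : 1 ≤ m) (σ : StutPerm m) (k : ℕ) :
    (σ.low hm k).size + (σ.high hm k).size = σ.size := by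
  have h : (σ.low hm k).word.length + (σ.high hm k).word.length = σ.word.length := by
    rw [word_low, word_high, List.length_map,
      List.length_eq_length_filter_add (l := σ.word) fun a => a ≤ k]
    congr 2
    refine List.filter_congr fun a _ => ?_
    by_cases hak : a ≤ k
    · simp [hak, hak.not_gt]
    · simp [hak, not_le.1 hak]
  rw [length_eq hm, length_eq hm, length_eq hm, ← mul_add] at h
  exact Nat.eq_of_mul_eq_mul_left hm h

theorem size_high (hm : 1 ≤ m) (σ : StutPerm m) (k : ℕ) (hk : k ≤ σ.size) :
    (σ.high hm k).size = σ.size - k := by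
  have h1 := σ.size_low hm k hk
  have h2 := σ.size_low_add_size_high hm k
  omega

theorem sameStd_high (hm : 1 ≤ m) (σ : StutPerm m) (k : ℕ) :
    SameStd (σ.word.filter fun a => k < a) (σ.high hm k).word := by
  refine sameStd_map _ _ fun a ha b hb => ?_
  have h1 : k < a := by simpa using (List.mem_filter.1 ha).2
  have h2 : k < b := by simpa using (List.mem_filter.1 hb).2
  omega

end StutPerm

theorem hasMStd_iff {A : Type*} [LinearOrder A] {m : ℕ} {u : List A} {σ : StutPerm m} :
    HasMStd u σ ↔ SameStd u σ.word := std_eq_iff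

theorem HasMStd.length_eq {A : Type*} [LinearOrder A] {m : ℕ} {u : List A} {σ : StutPerm m}
    (h : HasMStd u σ) : u.length = σ.word.length := (hasMStd_iff.1 h).1

/-- The letters of `σ` are determined by the numbers of the smaller letters. -/
theorem StutPerm.countP_lt {m : ℕ} (hm : 1 ≤ m) (σ : StutPerm m) {c : ℕ} (hc : c ∈ σ.word) :
    σ.word.countP (fun b => decide (b < c)) = m * (c - 1) := by
  rw [(σ.perm_size hm).countP_eq]
  have := (σ.mem_word hm c).1 hc
  exact countP_lt_blockWord _ _ _ this.1 (by omega)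

/-- Strict comparisons agree in both directions by `lt_of_lt_of_count`, so corresponding letters
have equally many smaller letters; a letter `c` is recovered from this number `m * (c - 1)`. -/
theorem eq_of_sameStd {m : ℕ} (hm : 1 ≤ m) {σ τ : StutPerm m} (h : SameStd σ.word τ.word) :
    σ = τ := by
  have h1 := lt_of_lt_of_count h σ.isStutWord (τ.count_of_mem hm)
  have h2 := lt_of_lt_of_count h.symm τ.isStutWord (σ.count_of_mem hm)
  have hfst : (σ.word.zip τ.word).map Prod.fst = σ.word := List.map_fst_zip h.1.le
  have hsnd : (σ.word.zip τ.word).map Prod.snd = τ.word := List.map_snd_zip h.1.ge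
  have key : ∀ p ∈ σ.word.zip τ.word, p.1 = p.2 := by
    intro p hp
    have hp1 : p.1 ∈ σ.word := hfst ▸ List.mem_map_of_mem hp
    have hp2 : p.2 ∈ τ.word := hsnd ▸ List.mem_map_of_mem hp
    have e1 := σ.countP_lt hm hp1
    have e2 := τ.countP_lt hm hp2
    have e3 : σ.word.countP (fun b => decide (b < p.1)) =
        τ.word.countP fun b => decide (b < p.2) := by
      conv_lhs => rw [← hfst]
      conv_rhs => rw [← hsnd]
      rw [List.countP_map, List.countP_map]
      refine List.countP_congr fun q hq => ?_
      simp only [Function.comp_apply, decide_eq_true_eq]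
      refine ⟨h1 q hq p hp, fun hlt => h2 q.swap ?_ p.swap ?_ hlt⟩
      · rw [← List.zip_swap]; exact List.mem_map_of_mem hq
      · rw [← List.zip_swap]; exact List.mem_map_of_mem hp
    rw [e1, e2] at e3
    have e4 := Nat.eq_of_mul_eq_mul_left hm e3
    have := (σ.mem_word hm _).1 hp1
    have := (τ.mem_word hm _).1 hp2
    omega
  refine StutPerm.ext ?_
  rw [← hfst]
  conv_rhs => rw [← hsnd]
  exact List.map_congr_left key

theorem card_filter_get {A : Type*} [LinearOrder A] (u : List A) (p : A → Prop) [DecidablePred p] :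
    (Finset.univ.filter fun k : Fin u.length => p (u.get k)).card =
      u.countP fun a => decide (p a) := by
  conv_rhs => rw [← List.ofFn_get u]
  rw [← Multiset.coe_countP, ← Fin.univ_val_map, Multiset.countP_map]
  rfl

theorem exists_hasMStd {A : Type*} [LinearOrder A] {m : ℕ} (hm : 1 ≤ m) {u : List A}
    (hu : IsStutWord m u) : ∃ σ : StutPerm m, HasMStd u σ := by
  obtain ⟨n, hn⟩ := hu.dvd_length
  refine ⟨⟨(std u).map fun r => (r - 1) / m + 1, n, ?_⟩, ?_⟩
  · refine ((std_perm u).map _).trans ?_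
    rw [List.map_map, hn, ← map_div_range m n hm]
    simp [Function.comp_def]
  · refine hasMStd_iff.2 (sameStd_iff_get.2 ?_)
    refine ⟨by simp [StutPerm.word], fun i j hi hj hi' hj' hij => ?_⟩
    simp only [StutPerm.word, std_eq_ofFn, List.getElem_map, List.getElem_ofFn]
    have h1 := stdRank_le_iff u (i := ⟨i, hi⟩) (j := ⟨j, hj⟩) hij
    simp only [List.get_eq_getElem] at h1
    constructor
    · intro h
      gcongr
      exact h1.2 h
    · intro h
      by_contra hlt
      push Not at hlt
      refine absurd h (not_le.2 ?_)
      -- The letters `≤ u[j]` are `m * t` in number, so the ranks at `j` and `i` lie on the two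
      -- sides of the block boundary `m * t` and get different letters.
      obtain ⟨t, ht⟩ := hu.dvd_countP fun a => decide (a ≤ u[j])
      rw [← card_filter_get u fun a => a ≤ u[j]] at ht
      have e1 : stdRank u ⟨j, hj⟩ ≤ m * t := by
        rw [← ht]
        refine Finset.card_le_card fun k => ?_
        simp only [stdKey, Prod.Lex.toLex_le_toLex, Finset.mem_filter, Finset.mem_univ, true_and]
        rintro (h | h)
        · exact h.le
        · exact h.1.le
      have e2 : m * t < stdRank u ⟨i, hi⟩ := by
        rw [← ht]
        refine Finset.card_lt_card ?_
        rw [Finset.ssubset_iff_of_subset]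
        · exact ⟨⟨i, hi⟩, by simp, by simpa using hlt⟩
        · intro k
          simp only [stdKey, Prod.Lex.toLex_le_toLex, Finset.mem_filter, Finset.mem_univ, true_and]
          exact fun hk => Or.inl (hk.trans_lt hlt)
      have e0 : 0 < stdRank u ⟨j, hj⟩ := Finset.card_pos.2 ⟨⟨j, hj⟩, by simp⟩
      have e3 : (stdRank u ⟨j, hj⟩ - 1) / m < t := by
        rw [Nat.div_lt_iff_lt_mul hm, mul_comm]; omega
      have e4 : t ≤ (stdRank u ⟨i, hi⟩ - 1) / m := by
        rw [Nat.le_div_iff_mul_le hm, mul_comm]; omega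
      omega

theorem existsUnique_hasMStd {A : Type*} [LinearOrder A] {m : ℕ} (hm : 1 ≤ m) {u : List A}
    (hu : IsStutWord m u) : ∃! σ : StutPerm m, HasMStd u σ := by
  obtain ⟨σ, hσ⟩ := exists_hasMStd hm hu
  exact ⟨σ, hσ, fun τ hτ => eq_of_sameStd hm (std_eq_iff.1 ((show _ = _ from hτ).symm.trans hσ))⟩

theorem HasMStd.unique {A : Type*} [LinearOrder A] {m : ℕ} (hm : 1 ≤ m) {u : List A}
    {σ τ : StutPerm m} (hσ : HasMStd u σ) (hτ : HasMStd u τ) : σ = τ :=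
  eq_of_sameStd hm (std_eq_iff.1 ((show _ = _ from hσ).symm.trans hτ))

theorem exists_map_of_zip {A B : Type*} [Nonempty A] {u : List A} {v : List B}
    (hl : u.length = v.length) (h : ∀ p ∈ u.zip v, ∀ q ∈ u.zip v, p.2 = q.2 → p.1 = q.1) :
    ∃ f : B → A, u = v.map f := by
  classical
  have hex : ∀ b : B, ∃ a : A, ∀ p ∈ u.zip v, p.2 = b → p.1 = a := by
    intro b
    by_cases hb : ∃ p ∈ u.zip v, p.2 = b
    · obtain ⟨p, hp, rfl⟩ := hb
      exact ⟨p.1, fun q hq hqp => h q hq p hp hqp⟩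
    · push Not at hb
      exact ⟨Classical.arbitrary A, fun p hp hpb => absurd hpb (hb p hp)⟩
  choose f hf using hex
  refine ⟨f, ?_⟩
  have hfst : (u.zip v).map Prod.fst = u := List.map_fst_zip hl.le
  have hsnd : (u.zip v).map Prod.snd = v := List.map_snd_zip hl.ge
  rw [← hfst]
  conv_rhs => rw [← hsnd, List.map_map]
  exact List.map_congr_left fun p hp => hf _ p hp rfl

/-- A stuttering word is a weakly increasing relabelling of its `m`-standardisation. -/
theorem HasMStd.exists_map {A : Type*} [LinearOrder A] [Nonempty A] {m : ℕ} (hm : 1 ≤ m)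
    {w : List A} {ν : StutPerm m} (hw : IsStutWord m w) (h : HasMStd w ν) :
    ∃ f : ℕ → A, w = ν.word.map f ∧ ∀ a ∈ ν.word, ∀ b ∈ ν.word, f a < f b → a < b := by
  rw [hasMStd_iff] at h
  have key := lt_of_lt_of_count h hw (ν.count_of_mem hm)
  obtain ⟨f, hf⟩ := exists_map_of_zip h.1 fun p hp q hq hpq => le_antisymm
    (not_lt.1 fun hlt => (key q hq p hp hlt).ne' hpq) (not_lt.1 fun hlt => (key p hp q hq hlt).ne hpq)
  refine ⟨f, hf, fun a ha b hb hab => ?_⟩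
  have hmem : ∀ c ∈ ν.word, (f c, c) ∈ w.zip ν.word := fun c hc => by
    rw [hf, List.zip_map_left]
    exact List.mem_map.2 ⟨(c, c), by
      obtain ⟨i, hi, rfl⟩ := List.getElem_of_mem hc
      exact List.mem_iff_getElem.2 ⟨i, by simpa using hi, by simp⟩, rfl⟩
  exact key _ (hmem a ha) _ (hmem b hb) hab

theorem exists_word (A : Type*) [LinearOrder A] [Infinite A] {m : ℕ} (hm : 1 ≤ m)
    (σ : StutPerm m) : ∃ w : List A, IsStutWord m w ∧ HasMStd w σ := by
  -- One letter more than needed: the letters `1, …, n` of `σ` are then unchanged by the reduction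
  -- modulo `n + 1` in `Fin.ofNat`.
  obtain ⟨s, hs⟩ := Infinite.exists_subset_card_eq A (σ.size + 1)
  let f := s.orderEmbOfFin hs
  let g : ℕ → A := fun a => f (Fin.ofNat _ a)
  refine ⟨σ.word.map g, σ.isStutWord.map g, hasMStd_iff.2 (sameStd_map _ _ fun a ha b hb => ?_).symm⟩
  have h1 := (σ.mem_word hm a).1 ha
  have h2 := (σ.mem_word hm b).1 hb
  simp only [g, OrderEmbedding.le_iff_le, Fin.le_def, Fin.ofNat]
  rw [Nat.mod_eq_of_lt (by omega), Nat.mod_eq_of_lt (by omega)]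

/-! ### Factors of stuttering words -/

theorem isStutWord_drop_of_take {A : Type*} [LinearOrder A] {m : ℕ} {w : List A} {i : ℕ}
    (hw : IsStutWord m w) (h : IsStutWord m (w.take i)) : IsStutWord m (w.drop i) := fun a => by
  have := hw a
  rw [← List.take_append_drop i w, List.count_append] at this
  exact (Nat.dvd_add_right (h a)).1 this

/-- Relabelling gives one direction. For the other, only a letter `c` of `ν` on both sides of the
cut matters. Letters of `ν` with the same image in `w` increase weakly across the cut, so those
below `c` lie entirely in the prefix and those above `c` entirely outside it. The occurrences of `f
c` in the prefix are therefore a multiple of `m` plus the occurrences of `c`. -/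
theorem isStutWord_take_iff {A : Type*} [LinearOrder A] [Nonempty A] {m : ℕ} (hm : 1 ≤ m)
    {w : List A} {ν : StutPerm m} (hw : IsStutWord m w) (h : HasMStd w ν) (i : ℕ) :
    IsStutWord m (w.take i) ↔ IsStutWord m (ν.word.take i) := by
  obtain ⟨f, hf, hlt⟩ := h.exists_map hm hw
  have hS := (hasMStd_iff.1 h).2
  have htake : w.take i = (ν.word.take i).map f := by rw [hf, List.map_take]
  refine ⟨fun hst c => ?_, fun hst => htake ▸ hst.map f⟩
  have hcount : ν.word.count c = (ν.word.take i).count c + (ν.word.drop i).count c := by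
    conv_lhs => rw [← List.take_append_drop i ν.word, List.count_append]
  by_cases hc1 : c ∈ ν.word.take i
  swap
  · rw [List.count_eq_zero_of_not_mem hc1]; exact dvd_zero m
  by_cases hc2 : c ∈ ν.word.drop i
  swap
  · rw [List.count_eq_zero_of_not_mem hc2, add_zero] at hcount
    rw [← hcount]; exact ν.isStutWord c
  have hcross : ∀ a ∈ ν.word.take i, ∀ b ∈ ν.word.drop i, f a = f b → a ≤ b := by
    intro a ha b hb hab
    rw [hf, List.zip_map_left, List.pairwise_map, List.pairwise_iff_getElem] at hS
    obtain ⟨p, hp, rfl⟩ := List.getElem_of_mem ha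
    obtain ⟨q, hq, rfl⟩ := List.getElem_of_mem hb
    simp only [List.length_take, List.length_drop] at hp hq
    have := hS p (i + q) (by simp; omega) (by simp; omega) (by omega)
    simp only [List.getElem_zip, Prod.map_fst, Prod.map_snd, id] at this
    simp only [List.getElem_take, List.getElem_drop] at hab ⊢
    exact this.1 hab.le
  have e1 : m ∣ (ν.word.take i).countP fun d => decide (f d = f c) := by
    have := hst (f c)
    rw [htake, List.count, List.countP_map] at this
    refine this.trans (dvd_of_eq (List.countP_congr fun d _ => ?_))
    simp
  have e2 : m ∣ (ν.word.take i).countP fun d => decide (f d = f c ∧ d < c) := by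
    have := ν.isStutWord.dvd_countP fun d => decide (f d = f c ∧ d < c)
    rw [← List.take_append_drop i ν.word, List.countP_append] at this
    have h0 : (ν.word.drop i).countP (fun d => decide (f d = f c ∧ d < c)) = 0 := by
      refine List.countP_eq_zero.2 fun d hd => ?_
      simp only [decide_eq_true_eq, not_and, not_lt]
      exact fun hdc => hcross c hc1 d hd hdc.symm
    rwa [h0, add_zero] at this
  have e3 : (ν.word.take i).countP (fun d => decide (f d = f c)) =
      (ν.word.take i).countP (fun d => decide (f d = f c ∧ d < c)) + (ν.word.take i).count c := by
    have hle : ∀ d ∈ ν.word.take i, f d = f c → d ≤ c := fun d hd hdc => hcross d hd c hc2 hdc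
    generalize ν.word.take i = l at hle
    clear * - hle
    induction l with
    | nil => simp
    | cons x l ih =>
      simp only [List.countP_cons, List.count_cons, decide_eq_true_eq, beq_iff_eq]
      rw [ih fun d hd => hle d (by simp [hd])]
      by_cases hx : f x = f c
      · rcases (hle x (by simp) hx).lt_or_eq with h | h
        · simp [hx, h, h.ne]; omega
        · simp [h]; omega
      · have : x ≠ c := fun h => hx (h ▸ rfl)
        simp [hx, this]
  rw [e3] at e1
  exact (Nat.dvd_add_right e2).1 e1

theorem mem_prodSet {m : ℕ} {σ μ ν : StutPerm m} : ν ∈ prodSet σ μ ↔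
    IsStutWord m (ν.word.take σ.word.length) ∧ IsStutWord m (ν.word.drop σ.word.length) ∧
      HasMStd (ν.word.take σ.word.length) σ ∧ HasMStd (ν.word.drop σ.word.length) μ := by
  constructor
  · rintro ⟨u, v, h, hu, hv, hσ, hμ⟩
    rw [h, List.take_left' hσ.length_eq, List.drop_left' hσ.length_eq]
    exact ⟨hu, hv, hσ, hμ⟩
  · rintro ⟨hu, hv, hσ, hμ⟩
    exact ⟨_, _, (List.take_append_drop _ _).symm, hu, hv, hσ, hμ⟩

theorem length_of_mem_prodSet {m : ℕ} {σ μ ν : StutPerm m} (h : ν ∈ prodSet σ μ) :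
    ν.word.length = σ.word.length + μ.word.length := by
  obtain ⟨u, v, h, -, -, hσ, hμ⟩ := h
  rw [h, List.length_append, hσ.length_eq, hμ.length_eq]

theorem size_of_mem_prodSet {m : ℕ} (hm : 1 ≤ m) {σ μ ν : StutPerm m} (h : ν ∈ prodSet σ μ) :
    ν.size = σ.size + μ.size := by
  have := length_of_mem_prodSet h
  rw [ν.length_eq hm, σ.length_eq hm, μ.length_eq hm, ← mul_add] at this
  exact Nat.eq_of_mul_eq_mul_left hm this

theorem finite_prodSet {m : ℕ} (hm : 1 ≤ m) (σ μ : StutPerm m) : (prodSet σ μ).Finite :=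
  (StutPerm.finite_size hm (σ.size + μ.size)).subset fun _ h => size_of_mem_prodSet hm h

/-- This is the product formula at the level of a single word; `isStutWord_take_iff` carries the
stuttering of the factors between `w` and `ν`, and `SameStd` restricts to factors. -/
theorem exists_mem_prodSet_iff {A : Type*} [LinearOrder A] [Nonempty A] {m : ℕ} (hm : 1 ≤ m)
    (σ μ : StutPerm m) (w : List A) :
    (∃ ν ∈ prodSet σ μ, IsStutWord m w ∧ HasMStd w ν) ↔
      (IsStutWord m (w.take σ.word.length) ∧ HasMStd (w.take σ.word.length) σ) ∧
      (IsStutWord m (w.drop σ.word.length) ∧ HasMStd (w.drop σ.word.length) μ) := by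
  constructor
  · rintro ⟨ν, hν, hw, hwν⟩
    obtain ⟨h1, h2, h3, h4⟩ := mem_prodSet.1 hν
    have ht := (isStutWord_take_iff hm hw hwν σ.word.length).2 h1
    rw [hasMStd_iff] at h3 h4 hwν
    exact ⟨⟨ht, hasMStd_iff.2 ((sameStd_take hwν _).trans h3)⟩,
      isStutWord_drop_of_take hw ht, hasMStd_iff.2 ((sameStd_drop hwν _).trans h4)⟩
  · rintro ⟨⟨h1, h2⟩, h3, h4⟩
    have hw : IsStutWord m w := by
      rw [← List.take_append_drop σ.word.length w]; exact h1.append h3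
    obtain ⟨ν, hν⟩ := exists_hasMStd hm hw
    refine ⟨ν, mem_prodSet.2 ?_, hw, hν⟩
    have ht := (isStutWord_take_iff hm hw hν σ.word.length).1 h1
    rw [hasMStd_iff] at h2 h4 hν
    exact ⟨ht, isStutWord_drop_of_take ν.isStutWord ht,
      hasMStd_iff.2 ((sameStd_take hν _).symm.trans h2),
      hasMStd_iff.2 ((sameStd_drop hν _).symm.trans h4)⟩

/-- Coefficients on both sides of the formulas are sums with at most one nonzero term; comparing
them becomes an equivalence of existence statements. -/
theorem sum_eq_indicator {ι K : Type*} [Field K] (s : Finset ι) (p : ι → Prop) [DecidablePred p]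
    [Decidable (∃ i ∈ s, p i)] (f : ι → K)
    (hf : ∀ i ∈ s, f i = if p i then 1 else 0) (h : ∀ i ∈ s, ∀ j ∈ s, p i → p j → i = j) :
    ∑ i ∈ s, f i = if ∃ i ∈ s, p i then 1 else 0 := by
  split_ifs with hex
  · obtain ⟨i, hi, hp⟩ := hex
    rw [Finset.sum_eq_single_of_mem i hi fun j hj hji =>
      (hf j hj).trans (if_neg fun hpj => hji (h j hj i hi hpj hp)), hf i hi, if_pos hp]
  · push Not at hex
    exact Finset.sum_eq_zero fun i hi => (hf i hi).trans (if_neg (hex i hi))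

/-! ### The product formula -/

open Classical in
theorem G_apply (K A : Type*) [Field K] [LinearOrder A] {m : ℕ} (σ : StutPerm m) (w : List A) :
    G K A σ w = if IsStutWord m w ∧ HasMStd w σ then 1 else 0 := rfl

theorem NCSeries.sum_apply {K A ι : Type*} [Field K] (s : Finset ι) (f : ι → NCSeries K A)
    (w : List A) : (∑ i ∈ s, f i) w = ∑ i ∈ s, f i w := by
  classical
  induction s using Finset.induction_on with
  | empty => rfl
  | insert i s hi ih => rw [Finset.sum_insert hi, Finset.sum_insert hi, NCSeries.add_apply, ih]

open Classical in
theorem G_apply_mul_G_apply (K A B : Type*) [Field K] [LinearOrder A] [LinearOrder B] {m : ℕ}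
    (σ μ : StutPerm m) (u : List A) (v : List B) : G K A σ u * G K B μ v =
      if (IsStutWord m u ∧ HasMStd u σ) ∧ (IsStutWord m v ∧ HasMStd v μ) then 1 else 0 := by
  by_cases h : IsStutWord m u ∧ HasMStd u σ <;> by_cases h' : IsStutWord m v ∧ HasMStd v μ <;>
    simp only [G, h, h', and_self, and_true, and_false, if_true, if_false, mul_one, mul_zero]

theorem G_mul_G (K A : Type*) [Field K] [LinearOrder A] [Nonempty A] {m : ℕ} (hm : 1 ≤ m)
    (σ μ : StutPerm m) :
    G K A σ * G K A μ = ∑ ν ∈ (finite_prodSet hm σ μ).toFinset, G K A ν := by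
  classical
  funext w
  refine Eq.trans ?_ ((NCSeries.sum_apply _ (G K A) w).trans (sum_eq_indicator _
    (fun ν => IsStutWord m w ∧ HasMStd w ν) _ (fun _ _ => rfl)
    fun ν _ ν' _ h h' => h.2.unique hm h'.2)).symm
  simp only [Set.Finite.mem_toFinset, exists_mem_prodSet_iff hm]
  -- Only the cut after `σ.word.length` letters contributes, since a word and its
  -- `m`-standardisation have the same length.
  refine (NCSeries.mul_apply _ _ _).trans
    ((Finset.sum_eq_single σ.word.length ?_ ?_).trans (G_apply_mul_G_apply K A A _ _ _ _))
  · intro i hi hne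
    refine (G_apply_mul_G_apply K A A _ _ _ _).trans (if_neg ?_)
    rintro ⟨⟨-, h⟩, -⟩
    have := h.length_eq
    simp only [Finset.mem_range, List.length_take] at hi this
    omega
  · intro hi
    refine (G_apply_mul_G_apply K A A _ _ _ _).trans (if_neg ?_)
    rintro ⟨⟨-, h⟩, -⟩
    have := h.length_eq
    simp only [Finset.mem_range, List.length_take] at hi this
    omega

theorem G_empty (K A : Type*) [Field K] [LinearOrder A] (m : ℕ) :
    G K A (StutPerm.empty m) = 1 := by
  funext w
  rw [G_apply]
  split_ifs with h
  · have := h.2.length_eq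
    rw [StutPerm.word_empty, List.length_nil, List.length_eq_zero_iff] at this
    rw [this, NCSeries.one_apply_nil]
  · rw [NCSeries.one_apply_of_ne]
    rintro rfl
    exact h ⟨fun a => by simp, by simp [HasMStd, std]⟩

/-! ### Words over the doubled alphabet -/

section Double

variable {A B : Type*}

@[simp] theorem leftPart_nil : leftPart ([] : List (A ⊕ₗ B)) = [] := rfl
@[simp] theorem rightPart_nil : rightPart ([] : List (A ⊕ₗ B)) = [] := rfl
@[simp] theorem leftPart_inl (a : A) (w : List (A ⊕ₗ B)) :
    leftPart (Sum.inlₗ a :: w) = a :: leftPart w := rfl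
@[simp] theorem leftPart_inr (b : B) (w : List (A ⊕ₗ B)) :
    leftPart (Sum.inrₗ b :: w) = leftPart w := rfl
@[simp] theorem rightPart_inl (a : A) (w : List (A ⊕ₗ B)) :
    rightPart (Sum.inlₗ a :: w) = rightPart w := rfl
@[simp] theorem rightPart_inr (b : B) (w : List (A ⊕ₗ B)) :
    rightPart (Sum.inrₗ b :: w) = b :: rightPart w := rfl

theorem leftPart_append (w w' : List (A ⊕ₗ B)) :
    leftPart (w ++ w') = leftPart w ++ leftPart w' := List.filterMap_append

theorem rightPart_append (w w' : List (A ⊕ₗ B)) :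
    rightPart (w ++ w') = rightPart w ++ rightPart w' := List.filterMap_append

theorem exists_inl_or_inr (x : A ⊕ₗ B) : (∃ a, x = Sum.inlₗ a) ∨ ∃ b, x = Sum.inrₗ b := by
  rcases h : ofLex x with a | b
  · exact Or.inl ⟨a, by rw [← toLex_ofLex x, h]⟩
  · exact Or.inr ⟨b, by rw [← toLex_ofLex x, h]⟩

/-- The pattern of the letters from `A`. -/
def sides (w : List (A ⊕ₗ B)) : List Bool := w.map fun x => (ofLex x).isLeft

@[simp] theorem sides_inl (a : A) (w : List (A ⊕ₗ B)) :
    sides (Sum.inlₗ a :: w) = true :: sides w := rfl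
@[simp] theorem sides_inr (b : B) (w : List (A ⊕ₗ B)) :
    sides (Sum.inrₗ b :: w) = false :: sides w := rfl

/-- A shuffle is determined by the two words and the pattern of sides; finiteness of the fibres and
uniqueness in the coproduct formula rest on this. -/
theorem eq_of_sides_eq {w w' : List (A ⊕ₗ B)} (h : sides w = sides w')
    (hl : leftPart w = leftPart w') (hr : rightPart w = rightPart w') : w = w' := by
  induction w generalizing w' with
  | nil => exact (List.map_eq_nil_iff.1 h.symm).symm
  | cons x w ih =>
    cases w' with
    | nil => exact absurd h (by simp [sides])
    | cons x' w' =>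
      rcases exists_inl_or_inr x with ⟨a, rfl⟩ | ⟨b, rfl⟩ <;>
      rcases exists_inl_or_inr x' with ⟨a', rfl⟩ | ⟨b', rfl⟩ <;>
      simp only [sides_inl, sides_inr, leftPart_inl, leftPart_inr, rightPart_inl, rightPart_inr,
        List.cons.injEq, true_and, Bool.true_eq_false, Bool.false_eq_true, false_and] at h hl hr
      · rw [hl.1, ih h hl.2 hr]
      · rw [hr.1, ih h hl hr.2]

theorem length_eq_add (w : List (A ⊕ₗ B)) :
    w.length = (leftPart w).length + (rightPart w).length := by
  induction w with
  | nil => rfl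
  | cons x w ih =>
    rcases exists_inl_or_inr x with ⟨a, rfl⟩ | ⟨b, rfl⟩ <;> simp [ih, add_assoc, add_comm 1]

theorem finite_parts (u : List A) (v : List B) :
    {w : List (A ⊕ₗ B) | leftPart w = u ∧ rightPart w = v}.Finite := by
  refine Set.Finite.of_finite_image (f := sides)
    ((List.finite_length_eq Bool (u.length + v.length)).subset ?_) ?_
  · rintro _ ⟨w, ⟨rfl, rfl⟩, rfl⟩
    simpa [sides] using length_eq_add w
  · rintro w ⟨h1, h2⟩ w' ⟨h1', h2'⟩ h
    exact eq_of_sides_eq h (h1.trans h1'.symm) (h2.trans h2'.symm)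

/-- The letters from `A` are at the places of the letters `≤ k`. -/
def SplitsAt (k : ℕ) (w : List (A ⊕ₗ B)) (s : List ℕ) : Prop :=
  List.Forall₂ (fun x a => (ofLex x).isLeft = true ↔ a ≤ k) w s

theorem SplitsAt.sides_eq {k : ℕ} {w : List (A ⊕ₗ B)} {s : List ℕ} (h : SplitsAt k w s) :
    sides w = s.map fun a => decide (a ≤ k) := by
  induction h with
  | nil => rfl
  | @cons x a w s hx _ ih =>
    simp only [sides, List.map_cons] at ih ⊢
    rw [ih, Bool.eq_iff_iff.2 (hx.trans decide_eq_true_iff.symm)]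

theorem SplitsAt.induction {k : ℕ} {P : List (A ⊕ₗ B) → List ℕ → Prop} (nil : P [] [])
    (inl : ∀ x a w s, a ≤ k → SplitsAt k w s → P w s → P (Sum.inlₗ x :: w) (a :: s))
    (inr : ∀ x a w s, k < a → SplitsAt k w s → P w s → P (Sum.inrₗ x :: w) (a :: s))
    {w : List (A ⊕ₗ B)} {s : List ℕ} (h : SplitsAt k w s) : P w s := by
  induction h with
  | nil => exact nil
  | @cons x a w s hx hw ih =>
    rcases exists_inl_or_inr x with ⟨a', rfl⟩ | ⟨b', rfl⟩
    · exact inl _ _ _ _ (hx.1 rfl) hw ih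
    · exact inr _ _ _ _ (not_le.1 fun hle => Bool.false_ne_true (hx.2 hle)) hw ih

theorem SplitsAt.length_left {k : ℕ} {w : List (A ⊕ₗ B)} {s : List ℕ} (h : SplitsAt k w s) :
    (leftPart w).length = (s.filter fun a => a ≤ k).length := by
  refine h.induction (P := fun (w : List (A ⊕ₗ B)) s => (leftPart w).length = (s.filter fun a => a ≤ k).length)
    rfl ?_ ?_
  · intro x a w s ha _ ih
    simp [ha, ih]
  · intro x a w s ha _ ih
    simp [ha.not_ge, ih]

theorem exists_splitsAt (k : ℕ) (s : List ℕ) (u : List A) (v : List B)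
    (hu : u.length = (s.filter fun a => a ≤ k).length)
    (hv : v.length = (s.filter fun a => k < a).length) :
    ∃ w : List (A ⊕ₗ B), SplitsAt k w s ∧ leftPart w = u ∧ rightPart w = v := by
  induction s generalizing u v with
  | nil =>
    obtain rfl := List.eq_nil_of_length_eq_zero hu
    obtain rfl := List.eq_nil_of_length_eq_zero hv
    exact ⟨[], List.Forall₂.nil, rfl, rfl⟩
  | cons a s ih =>
    by_cases ha : a ≤ k
    · cases u with
      | nil => simp [ha] at hu
      | cons x u =>
        obtain ⟨w, h1, rfl, rfl⟩ := ih u v (by simpa [ha] using hu) (by simpa [ha.not_gt] using hv)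
        exact ⟨Sum.inlₗ x :: w, List.Forall₂.cons (iff_of_true rfl ha) h1, rfl, rfl⟩
    · cases v with
      | nil => simp [not_le.1 ha] at hv
      | cons x v =>
        obtain ⟨w, h1, rfl, rfl⟩ := ih u v (by simpa [ha] using hu)
          (by simpa [not_le.1 ha] using hv)
        exact ⟨Sum.inrₗ x :: w, List.Forall₂.cons (iff_of_false Bool.false_ne_true ha) h1, rfl, rfl⟩

theorem sameStd_cons {A B : Type*} [LE A] [LE B] {a : A} {b : B} {u : List A} {v : List B} :
    SameStd (a :: u) (b :: v) ↔ (∀ p ∈ u.zip v, (a ≤ p.1 ↔ b ≤ p.2)) ∧ SameStd u v := by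
  simp only [SameStd, List.length_cons, List.zip_cons_cons, List.pairwise_cons, add_left_inj]
  tauto

theorem SplitsAt.forall_zip {k : ℕ} {w : List (A ⊕ₗ B)} {s : List ℕ} (h : SplitsAt k w s)
    (Q : (A ⊕ₗ B) × ℕ → Prop) : (∀ p ∈ w.zip s, Q p) ↔
      (∀ p ∈ (leftPart w).zip (s.filter fun a => a ≤ k), Q (Sum.inlₗ p.1, p.2)) ∧
      (∀ p ∈ (rightPart w).zip (s.filter fun a => k < a), Q (Sum.inrₗ p.1, p.2)) := by
  refine h.induction (P := fun (w : List (A ⊕ₗ B)) s => (∀ p ∈ w.zip s, Q p) ↔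
      (∀ p ∈ (leftPart w).zip (s.filter fun a => a ≤ k), Q (Sum.inlₗ p.1, p.2)) ∧
      (∀ p ∈ (rightPart w).zip (s.filter fun a => k < a), Q (Sum.inrₗ p.1, p.2)))
    (by simp) ?_ ?_
  · intro x a w s ha _ ih
    simp only [List.zip_cons_cons, List.forall_mem_cons, ih, leftPart_inl, rightPart_inl,
      List.filter_cons, ha, ha.not_gt, decide_true, decide_false, if_true]
    simp only [Bool.false_eq_true, if_false, and_assoc]
  · intro x a w s ha _ ih
    simp only [List.zip_cons_cons, List.forall_mem_cons, ih, leftPart_inr, rightPart_inr,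
      List.filter_cons, ha, ha.not_ge, decide_true, decide_false, if_true]
    simp only [Bool.false_eq_true, if_false]
    tauto

/-- Only pairs on the same side impose a condition: letters of `A` are below those of `B` exactly as
letters `≤ k` are below letters `> k`, so mixed pairs always agree. -/
theorem SplitsAt.sameStd_iff [LinearOrder A] [LinearOrder B] {k : ℕ} {w : List (A ⊕ₗ B)}
    {s : List ℕ} (h : SplitsAt k w s) : SameStd w s ↔
      SameStd (leftPart w) (s.filter fun a => a ≤ k) ∧
      SameStd (rightPart w) (s.filter fun a => k < a) := by
  refine h.induction (P := fun (w : List (A ⊕ₗ B)) s => SameStd w s ↔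
      SameStd (leftPart w) (s.filter fun a => a ≤ k) ∧
      SameStd (rightPart w) (s.filter fun a => k < a)) (by simp [SameStd]) ?_ ?_
  · intro x a w s ha hw ih
    rw [sameStd_cons, hw.forall_zip, ih, leftPart_inl, rightPart_inl, List.filter_cons_of_pos
      (by simpa using ha), List.filter_cons_of_neg (by simpa using ha), sameStd_cons]
    have : ∀ p ∈ (rightPart w).zip (s.filter fun a => k < a),
        (Sum.inlₗ x ≤ Sum.inrₗ p.1 ↔ a ≤ p.2) := fun p hp => by
      have h2 := (List.mem_filter.1 (List.of_mem_zip hp).2).2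
      simp only [decide_eq_true_eq] at h2
      exact iff_of_true (Sum.Lex.inl_le_inr _ _) (ha.trans h2.le)
    simp only [Sum.Lex.inl_le_inl_iff]
    tauto
  · intro x a w s ha hw ih
    rw [sameStd_cons, hw.forall_zip, ih, leftPart_inr, rightPart_inr, List.filter_cons_of_neg
      (by simpa using ha), List.filter_cons_of_pos (by simpa using ha), sameStd_cons]
    have : ∀ p ∈ (leftPart w).zip (s.filter fun a => a ≤ k),
        (Sum.inrₗ x ≤ Sum.inlₗ p.1 ↔ a ≤ p.2) := fun p hp => by
      have h2 := (List.mem_filter.1 (List.of_mem_zip hp).2).2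
      simp only [decide_eq_true_eq] at h2
      exact iff_of_false Sum.Lex.not_inr_le_inl (h2.trans_lt ha).not_ge
    simp only [Sum.Lex.inr_le_inr_iff]
    tauto

theorem count_inl {_ : BEq A} [LawfulBEq A] {_ : BEq (A ⊕ₗ B)} [LawfulBEq (A ⊕ₗ B)]
    (w : List (A ⊕ₗ B)) (a : A) : w.count (Sum.inlₗ a) = (leftPart w).count a := by
  classical
  induction w with
  | nil => rfl
  | cons x w ih =>
    rcases exists_inl_or_inr x with ⟨a', rfl⟩ | ⟨b, rfl⟩
    · simp only [List.count_cons, ih, leftPart_inl, beq_iff_eq, Sum.inlₗ, toLex_inj,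
        Sum.inl.injEq]
    · simp only [List.count_cons, ih, leftPart_inr, beq_iff_eq, Sum.inlₗ, Sum.inrₗ, toLex_inj,
        reduceCtorEq, if_false, add_zero]

theorem count_inr {_ : BEq B} [LawfulBEq B] {_ : BEq (A ⊕ₗ B)} [LawfulBEq (A ⊕ₗ B)]
    (w : List (A ⊕ₗ B)) (b : B) : w.count (Sum.inrₗ b) = (rightPart w).count b := by
  classical
  induction w with
  | nil => rfl
  | cons x w ih =>
    rcases exists_inl_or_inr x with ⟨a, rfl⟩ | ⟨b', rfl⟩
    · simp only [List.count_cons, ih, rightPart_inl, beq_iff_eq, Sum.inlₗ, Sum.inrₗ, toLex_inj,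
        reduceCtorEq, if_false, add_zero]
    · simp only [List.count_cons, ih, rightPart_inr, beq_iff_eq, Sum.inrₗ, toLex_inj,
        Sum.inr.injEq]

theorem isStutWord_double [LinearOrder A] [LinearOrder B] {m : ℕ} {w : List (A ⊕ₗ B)} :
    IsStutWord m w ↔ IsStutWord m (leftPart w) ∧ IsStutWord m (rightPart w) := by
  constructor
  · refine fun h => ⟨fun a => ?_, fun b => ?_⟩
    · have := h (Sum.inlₗ a)
      rwa [count_inl] at this
    · have := h (Sum.inrₗ b)
      rwa [count_inr] at this
  · rintro ⟨h1, h2⟩ x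
    rcases exists_inl_or_inr x with ⟨a, rfl⟩ | ⟨b, rfl⟩
    · rw [count_inl]
      exact h1 a
    · rw [count_inr]
      exact h2 b

/-- Letters from `A` are smaller than letters from `B`, so by `lt_of_lt_of_count` the letters of `σ`
at their places are strictly smaller too. -/
theorem exists_splitsAt_of_hasMStd [LinearOrder A] [LinearOrder B] {m : ℕ} (hm : 1 ≤ m)
    {w : List (A ⊕ₗ B)} {σ : StutPerm m} (hw : IsStutWord m w) (h : HasMStd w σ) :
    ∃ k ≤ σ.size, SplitsAt k w σ.word := by
  rw [hasMStd_iff] at h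
  have key := lt_of_lt_of_count h hw (σ.count_of_mem hm)
  let S := ((w.zip σ.word).filter fun p => (ofLex p.1).isLeft).toFinset
  -- The cut `k` is the largest letter of `σ` at the place of a letter from `A`, and 0 when there is
  -- none; the letters of `σ` are positive, so the default is harmless.
  refine ⟨S.sup Prod.snd, Finset.sup_le fun p hp => ?_, List.forall₂_iff_zip.2 ⟨h.1, ?_⟩⟩
  · have := (List.mem_filter.1 (List.mem_toFinset.1 hp)).1
    exact ((σ.mem_word hm _).1 (List.of_mem_zip this).2).2
  · intro x a hxa
    constructor
    · exact fun hx => Finset.le_sup (f := Prod.snd) (b := (x, a))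
        (List.mem_toFinset.2 (List.mem_filter.2 ⟨hxa, hx⟩))
    · intro ha
      by_contra hx
      refine absurd ha (not_le.2 ((Finset.sup_lt_iff ?_).2 fun p hp => ?_))
      · exact ((σ.mem_word hm _).1 (List.of_mem_zip hxa).2).1
      · have hp' := List.mem_filter.1 (List.mem_toFinset.1 hp)
        refine key p hp'.1 _ hxa ?_
        rcases exists_inl_or_inr p.1 with ⟨y, hy⟩ | ⟨y, hy⟩
        · rcases exists_inl_or_inr x with ⟨z, rfl⟩ | ⟨z, rfl⟩
          · exact absurd rfl hx
          · rw [hy]; exact Sum.Lex.inl_lt_inr _ _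
        · rw [hy] at hp'
          exact absurd hp'.2 Bool.false_ne_true

end Double

/-! ### The coproduct formula -/

theorem mem_coprodSet {m : ℕ} (hm : 1 ≤ m) {σ : StutPerm m} {p : StutPerm m × StutPerm m} :
    p ∈ coprodSet σ ↔ ∃ k ∈ Finset.range (σ.size + 1), (σ.low hm k, σ.high hm k) = p := by
  simp only [Finset.mem_range, Nat.lt_succ_iff]
  constructor
  · rintro ⟨k, hk, h1, h2⟩
    refine ⟨k, hk, Prod.ext (StutPerm.ext h1.symm) (eq_of_sameStd hm ?_)⟩
    exact (σ.sameStd_high hm k).symm.trans (hasMStd_iff.1 h2)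
  · rintro ⟨k, hk, rfl⟩
    exact ⟨k, hk, rfl, hasMStd_iff.2 (σ.sameStd_high hm k)⟩

theorem coprodSet_eq {m : ℕ} (hm : 1 ≤ m) (σ : StutPerm m) : coprodSet σ =
    (fun k => (σ.low hm k, σ.high hm k)) '' (Finset.range (σ.size + 1) : Set ℕ) := by
  ext p
  rw [mem_coprodSet hm]
  rfl

theorem finite_coprodSet {m : ℕ} (hm : 1 ≤ m) (σ : StutPerm m) : (coprodSet σ).Finite := by
  rw [coprodSet_eq hm]
  exact (Finset.finite_toSet _).image _

/-- Distinct `k` give distinct pairs, since the first component has size `k`; the sum over the set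
of pairs thus loses no multiplicity. -/
theorem finsum_coprodSet {m : ℕ} (hm : 1 ≤ m) (σ : StutPerm m) {M : Type*} [AddCommMonoid M]
    (f : StutPerm m × StutPerm m → M) :
    ∑ᶠ p ∈ coprodSet σ, f p =
      ∑ k ∈ Finset.range (σ.size + 1), f (σ.low hm k, σ.high hm k) := by
  rw [coprodSet_eq hm, finsum_mem_image, finsum_mem_coe_finset]
  intro k hk l hl h
  rw [Finset.mem_coe, Finset.mem_range, Nat.lt_succ_iff] at hk hl
  rw [← σ.size_low hm k hk, ← σ.size_low hm l hl]
  exact congrArg (fun p => p.1.size) h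

theorem separate_eq_sum {K A B : Type*} [Field K] (f : NCSeries K (A ⊕ₗ B)) (u : List A)
    (v : List B) : separate f u v = ∑ w ∈ (finite_parts u v).toFinset, f w :=
  finsum_mem_eq_finite_toFinset_sum _ _

theorem exists_splitsAt_iff {A B : Type*} [LinearOrder A] [LinearOrder B] {m : ℕ} (hm : 1 ≤ m)
    (σ : StutPerm m) (u : List A) (v : List B) :
    (∃ w ∈ (finite_parts u v).toFinset, IsStutWord m w ∧ HasMStd w σ) ↔
      ∃ k ∈ Finset.range (σ.size + 1), (IsStutWord m u ∧ HasMStd u (σ.low hm k)) ∧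
        (IsStutWord m v ∧ HasMStd v (σ.high hm k)) := by
  simp only [Set.Finite.mem_toFinset, Finset.mem_range, Nat.lt_succ_iff, hasMStd_iff]
  constructor
  · rintro ⟨w, ⟨rfl, rfl⟩, hw, h⟩
    obtain ⟨k, hk, hs⟩ := exists_splitsAt_of_hasMStd hm hw (hasMStd_iff.2 h)
    obtain ⟨h1, h2⟩ := isStutWord_double.1 hw
    obtain ⟨h3, h4⟩ := hs.sameStd_iff.1 h
    exact ⟨k, hk, ⟨h1, h3⟩, h2, h4.trans (σ.sameStd_high hm k)⟩
  · rintro ⟨k, hk, ⟨h1, h2⟩, h3, h4⟩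
    replace h4 := h4.trans (σ.sameStd_high hm k).symm
    obtain ⟨w, hs, rfl, rfl⟩ := exists_splitsAt k σ.word u v h2.1 h4.1
    exact ⟨w, ⟨rfl, rfl⟩, isStutWord_double.2 ⟨h1, h3⟩, hs.sameStd_iff.2 ⟨h2, h4⟩⟩

theorem StutPerm.eq_of_length_low {m : ℕ} (hm : 1 ≤ m) (σ : StutPerm m) {k l : ℕ}
    (hk : k ≤ σ.size) (hl : l ≤ σ.size)
    (h : (σ.low hm k).word.length = (σ.low hm l).word.length) : k = l := by
  rw [StutPerm.length_eq hm, StutPerm.length_eq hm, σ.size_low hm k hk, σ.size_low hm l hl] at h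
  exact Nat.eq_of_mul_eq_mul_left hm h

theorem separate_G (K A B : Type*) [Field K] [LinearOrder A] [LinearOrder B] {m : ℕ} (hm : 1 ≤ m)
    (σ : StutPerm m) : separate (G K (A ⊕ₗ B) σ) = ∑ k ∈ Finset.range (σ.size + 1),
      seriesTensor K A B (G K A (σ.low hm k)) (G K B (σ.high hm k)) := by
  classical
  funext u v
  have hR : (∑ k ∈ Finset.range (σ.size + 1),
      seriesTensor K A B (G K A (σ.low hm k)) (G K B (σ.high hm k))) u v =
      ∑ k ∈ Finset.range (σ.size + 1), G K A (σ.low hm k) u * G K B (σ.high hm k) v := by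
    simp only [Finset.sum_apply]
    rfl
  refine (separate_eq_sum _ u v).trans (Eq.trans ?_ hR.symm)
  refine (sum_eq_indicator _ (fun w => IsStutWord m w ∧ HasMStd w σ) _ (fun _ _ => rfl) ?_).trans
    ((if_congr (exists_splitsAt_iff hm σ u v) rfl rfl).trans
      (sum_eq_indicator _ _ _ (fun k _ => G_apply_mul_G_apply K A B _ _ u v) ?_).symm)
  -- The length of the part over `A` fixes `k`, then `k` fixes the pattern of sides, and the pattern
  -- with the two parts fixes the word.
  · intro w hw w' hw' h h'
    rw [Set.Finite.mem_toFinset] at hw hw'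
    obtain ⟨k, hk, hs⟩ := exists_splitsAt_of_hasMStd hm h.1 h.2
    obtain ⟨l, hl, hs'⟩ := exists_splitsAt_of_hasMStd hm h'.1 h'.2
    obtain rfl : k = l := σ.eq_of_length_low hm hk hl <| by
      rw [σ.word_low, σ.word_low, ← hs.length_left, ← hs'.length_left, hw.1, hw'.1]
    exact eq_of_sides_eq (hs.sides_eq.trans hs'.sides_eq.symm) (hw.1.trans hw'.1.symm)
      (hw.2.trans hw'.2.symm)
  · intro k hk l hl h h'
    rw [Finset.mem_range, Nat.lt_succ_iff] at hk hl
    exact σ.eq_of_length_low hm hk hl (h.1.2.length_eq.symm.trans h'.1.2.length_eq)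

/-! ### Multiplicativity of the separation of the alphabets -/

/-- The product of series in two mutually commuting alphabets. -/
def pairMul {K A B : Type*} [Field K] (f g : List A → List B → K) : List A → List B → K :=
  fun u v => ∑ i ∈ Finset.range (u.length + 1), ∑ j ∈ Finset.range (v.length + 1),
    f (u.take i) (v.take j) * g (u.drop i) (v.drop j)

/-- Cutting a word with parts `u` and `v` amounts to cutting `u` and `v` separately and choosing a
word over each of the two resulting pairs of factors. -/
theorem sum_factorisations {K A B : Type*} [Field K] (f g : List (A ⊕ₗ B) → K) (u : List A)
    (v : List B) : ∑ w ∈ (finite_parts u v).toFinset, ∑ l ∈ Finset.range (w.length + 1),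
        f (w.take l) * g (w.drop l) =
      ∑ i ∈ Finset.range (u.length + 1), ∑ j ∈ Finset.range (v.length + 1),
        (∑ w ∈ (finite_parts (u.take i) (v.take j)).toFinset, f w) *
          ∑ w ∈ (finite_parts (u.drop i) (v.drop j)).toFinset, g w := by
  simp only [Finset.sum_mul_sum]
  rw [← Finset.sum_product', Finset.sum_sigma']
  simp only [← Finset.sum_product']
  rw [Finset.sum_sigma']
  refine Finset.sum_bij'
    (fun p _ => ⟨((leftPart (p.1.take p.2)).length, (rightPart (p.1.take p.2)).length),
      (p.1.take p.2, p.1.drop p.2)⟩)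
    (fun q _ => ⟨q.2.1 ++ q.2.2, q.2.1.length⟩) ?_ ?_ ?_ ?_ ?_
  · rintro ⟨w, l⟩ h
    simp only [Finset.mem_sigma, Set.Finite.mem_toFinset, Set.mem_ofPred_eq, Finset.mem_range,
      Finset.mem_product] at h ⊢
    obtain ⟨⟨rfl, rfl⟩, -⟩ := h
    have e1 := leftPart_append (w.take l) (w.drop l)
    have e2 := rightPart_append (w.take l) (w.drop l)
    rw [List.take_append_drop] at e1 e2
    rw [e1, e2]
    simp
  · rintro ⟨⟨i, j⟩, w1, w2⟩ h
    simp only [Finset.mem_sigma, Set.Finite.mem_toFinset, Set.mem_ofPred_eq, Finset.mem_range,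
      Finset.mem_product] at h ⊢
    rw [leftPart_append, rightPart_append, h.2.1.1, h.2.1.2, h.2.2.1, h.2.2.2]
    simp
  · rintro ⟨w, l⟩ h
    simp only [Finset.mem_sigma, Finset.mem_range] at h
    simp only [List.take_append_drop, Sigma.mk.injEq, heq_eq_eq, true_and, List.length_take]
    omega
  · rintro ⟨⟨i, j⟩, w1, w2⟩ h
    simp only [Finset.mem_sigma, Set.Finite.mem_toFinset, Set.mem_ofPred_eq, Finset.mem_range,
      Finset.mem_product] at h
    simp only [List.take_left, List.drop_left, h.2.1.1, h.2.1.2, List.length_take]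
    congr 2 <;> omega
  · rintro ⟨w, l⟩ _
    rfl

theorem separate_mul {K A B : Type*} [Field K] (f g : NCSeries K (A ⊕ₗ B)) :
    separate (f * g) = pairMul (separate f) (separate g) := by
  funext u v
  refine (separate_eq_sum _ u v).trans ((sum_factorisations f g u v).trans ?_)
  exact Finset.sum_congr rfl fun i _ => Finset.sum_congr rfl fun j _ =>
    congrArg₂ (· * ·) (separate_eq_sum _ _ _).symm (separate_eq_sum _ _ _).symm

theorem sum_mul_sum_factorisations {K A B : Type*} [Field K] (f f' : List A → K)
    (g g' : List B → K) (u : List A) (v : List B) :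
    (∑ i ∈ Finset.range (u.length + 1), f (u.take i) * f' (u.drop i)) *
      (∑ j ∈ Finset.range (v.length + 1), g (v.take j) * g' (v.drop j)) =
    ∑ i ∈ Finset.range (u.length + 1), ∑ j ∈ Finset.range (v.length + 1),
      f (u.take i) * g (v.take j) * (f' (u.drop i) * g' (v.drop j)) := by
  rw [Finset.sum_mul_sum]
  exact Finset.sum_congr rfl fun i _ => Finset.sum_congr rfl fun j _ => by ring

theorem seriesTensor_mul {K A B : Type*} [Field K] (f f' : NCSeries K A) (g g' : NCSeries K B) :
    seriesTensor K A B (f * f') (g * g') =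
      pairMul (seriesTensor K A B f g) (seriesTensor K A B f' g') := by
  funext u v
  exact sum_mul_sum_factorisations f f' g g' u v

theorem pairMul_add_left {K A B : Type*} [Field K] (f f' g : List A → List B → K) :
    pairMul (f + f') g = pairMul f g + pairMul f' g := by
  funext u v
  simp only [pairMul, Pi.add_apply, add_mul, Finset.sum_add_distrib]

theorem pairMul_add_right {K A B : Type*} [Field K] (f g g' : List A → List B → K) :
    pairMul f (g + g') = pairMul f g + pairMul f g' := by
  funext u v
  simp only [pairMul, Pi.add_apply, mul_add, Finset.sum_add_distrib]

theorem zero_pairMul {K A B : Type*} [Field K] (g : List A → List B → K) : pairMul 0 g = 0 := by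
  funext u v
  simp [pairMul]

theorem pairMul_zero {K A B : Type*} [Field K] (f : List A → List B → K) : pairMul f 0 = 0 := by
  funext u v
  simp [pairMul]

/-! ### Grafting and splitting binary trees -/

theorem mirror_mirror (T : BTree) : mirror (mirror T) = T := by
  induction T with
  | nil => rfl
  | node _ l r hl hr => simp only [mirror, hl, hr]

theorem mirror_graftLeft (S T : BTree) :
    mirror (graftLeft S T) = graftRight (mirror S) (mirror T) := by
  induction T with
  | nil => rfl
  | node _ l r hl _ => simp only [mirror, graftLeft, graftRight, hl]

theorem mirror_graftRight (S T : BTree) :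
    mirror (graftRight S T) = graftLeft (mirror S) (mirror T) := by
  rw [← mirror_mirror (graftLeft _ _), mirror_graftLeft, mirror_mirror, mirror_mirror]

theorem numNodes_mirror (T : BTree) : (mirror T).numNodes = T.numNodes := by
  induction T with
  | nil => rfl
  | node _ l r hl hr => simp only [mirror, BinaryTree.numNodes, hl, hr]; omega

/-- `U` consists of the first nodes of `T` in infix order and `V` of the other ones, with the
induced tree structures. -/
inductive Splits : BTree → BTree → BTree → Prop
  | nil : Splits .nil .nil .nil
  | left {l a b : BTree} (r : BTree) (h : Splits l a b) : Splits (bnode l r) a (bnode b r)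
  | right (l : BTree) {r a b : BTree} (h : Splits r a b) : Splits (bnode l r) (bnode l a) b

theorem Splits.numNodes {T U V : BTree} (h : Splits T U V) :
    T.numNodes = U.numNodes + V.numNodes := by
  induction h with
  | nil => rfl
  | left r _ ih => simp only [BinaryTree.numNodes, ih]; omega
  | right l _ ih => simp only [BinaryTree.numNodes, ih]; omega

/-- The number of nodes of the first part tells on which side of the root the cut falls: at most the
size of the left subtree before the root, more than that after it. -/
theorem Splits.unique {T U V : BTree} (h : Splits T U V) {U' V' : BTree} (h' : Splits T U' V')
    (hn : U.numNodes = U'.numNodes) : U = U' ∧ V = V' := by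
  induction h generalizing U' V' with
  | nil => cases h'; exact ⟨rfl, rfl⟩
  | left r hs ih =>
    cases h' with
    | left _ h' =>
      obtain ⟨rfl, rfl⟩ := ih h' hn
      exact ⟨rfl, rfl⟩
    | right _ h' =>
      have := hs.numNodes
      simp only [BinaryTree.numNodes] at hn
      omega
  | right l hs ih =>
    cases h' with
    | left _ h' =>
      have := h'.numNodes
      simp only [BinaryTree.numNodes] at hn
      omega
    | right _ h' =>
      obtain ⟨rfl, rfl⟩ := ih h' (by simpa using hn)
      exact ⟨rfl, rfl⟩

theorem splits_nil_right (T : BTree) : Splits T T .nil := by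
  induction T with
  | nil => exact .nil
  | node _ l r _ hr => exact .right l hr

theorem splits_nil_left (T : BTree) : Splits T .nil T := by
  induction T with
  | nil => exact .nil
  | node _ l r hl _ => exact .left r hl

theorem splits_graftLeft (U V : BTree) : Splits (graftLeft U V) U V := by
  induction V with
  | nil => exact splits_nil_right U
  | node _ l r hl _ => exact .left r hl

theorem splits_graftRight (U V : BTree) : Splits (graftRight V U) U V := by
  induction U with
  | nil => exact splits_nil_left V
  | node _ l r _ hr => exact .right l hr

/-! ### The Tamari order -/

theorem TamariLE.refl (T : BTree) : TamariLE T T := Relation.ReflTransGen.refl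

theorem TamariLE.trans {T T' T'' : BTree} (h : TamariLE T T') (h' : TamariLE T' T'') :
    TamariLE T T'' := Relation.ReflTransGen.trans h h'

theorem TamariLE.node {l l' r r' : BTree} (hl : TamariLE l l') (hr : TamariLE r r') :
    TamariLE (bnode l r) (bnode l' r') :=
  (Relation.ReflTransGen.lift (fun x => bnode x r) (fun _ _ h => Rotation.left r h) _ _ hl).trans
    (Relation.ReflTransGen.lift (bnode l') (fun _ _ h => Rotation.right l' h) _ _ hr)

theorem Rotation.tamariLE {T T' : BTree} (h : Rotation T T') : TamariLE T T' :=
  Relation.ReflTransGen.single h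

theorem Rotation.numNodes {T T' : BTree} (h : Rotation T T') : T.numNodes = T'.numNodes := by
  induction h with
  | root A B C => simp only [BinaryTree.numNodes]; omega
  | left R _ ih => simp only [BinaryTree.numNodes, ih]
  | right L _ ih => simp only [BinaryTree.numNodes, ih]

theorem TamariLE.numNodes {T T' : BTree} (h : TamariLE T T') : T.numNodes = T'.numNodes := by
  induction h with
  | refl => rfl
  | tail _ h ih => exact ih.trans h.numNodes

/-- The sum of the sizes of the right subtrees of the nodes. -/
def rightWeight : BTree → ℕ
  | .nil => 0
  | .node _ l r => rightWeight l + rightWeight r + r.numNodes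

/-- The right subtree of `x` gains `y` and `C`, and no other right subtree changes size. This strict
growth gives the antisymmetry of the Tamari order. -/
theorem Rotation.rightWeight_lt {T T' : BTree} (h : Rotation T T') :
    rightWeight T < rightWeight T' := by
  induction h with
  | root A B C => simp only [rightWeight, BinaryTree.numNodes]; omega
  | left R _ ih => simp only [rightWeight]; omega
  | right L h ih => simp only [rightWeight, h.numNodes]; omega

theorem TamariLE.eq_or_lt {T T' : BTree} (h : TamariLE T T') :
    T = T' ∨ rightWeight T < rightWeight T' := by
  induction h with
  | refl => exact Or.inl rfl
  | tail _ h ih =>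
    have := h.rightWeight_lt
    rcases ih with rfl | ih
    · exact Or.inr this
    · exact Or.inr (ih.trans this)

theorem TamariLE.antisymm {T T' : BTree} (h : TamariLE T T') (h' : TamariLE T' T) : T = T' := by
  rcases h.eq_or_lt with h | h
  · exact h
  · rcases h'.eq_or_lt with h' | h'
    · exact h'.symm
    · omega

theorem node_graftRight_le (b r a : BTree) :
    TamariLE (bnode (graftRight b a) r) (graftRight (bnode b r) a) := by
  induction a with
  | nil => exact .refl _
  | node _ a₁ a₂ _ ih => exact (Rotation.root _ _ _).tamariLE.trans ((TamariLE.refl _).node ih)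

theorem graftLeft_node_le (l a b : BTree) :
    TamariLE (graftLeft (bnode l a) b) (bnode l (graftLeft a b)) := by
  induction b with
  | nil => exact .refl _
  | node _ b₁ b₂ ih _ => exact (ih.node (.refl _)).trans (Rotation.root _ _ _).tamariLE

theorem Splits.graftLeft_le {T U V : BTree} (h : Splits T U V) : TamariLE (graftLeft U V) T := by
  induction h with
  | nil => exact .refl _
  | left r _ ih => exact ih.node (.refl _)
  | right l _ ih => exact (graftLeft_node_le _ _ _).trans ((TamariLE.refl _).node ih)

theorem Splits.le_graftRight {T U V : BTree} (h : Splits T U V) : TamariLE T (graftRight V U) := by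
  induction h with
  | nil => exact .refl _
  | left r _ ih => exact (ih.node (.refl _)).trans (node_graftRight_le _ _ _)
  | right l _ ih => exact (TamariLE.refl _).node ih

/-- A rotation keeps the infix order, so the same cut applies before and after it. If the cut falls
between `x` and `y`, the rotation disappears from both parts; otherwise it survives in at most one
of them. -/
theorem Rotation.splits {T T' : BTree} (h : Rotation T T') {U V : BTree} (hs : Splits T U V) :
    ∃ U' V', Splits T' U' V' ∧ TamariLE U U' ∧ TamariLE V V' := by
  induction h generalizing U V with
  | root A B C =>
    cases hs with
    | left _ hs =>
      cases hs with
      | left _ hs => exact ⟨_, _, .left _ hs, .refl _, (Rotation.root _ _ _).tamariLE⟩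
      | right _ hs => exact ⟨_, _, .right _ (.left _ hs), .refl _, .refl _⟩
    | right _ hs => exact ⟨_, _, .right _ (.right _ hs), (Rotation.root _ _ _).tamariLE, .refl _⟩
  | left R h ih =>
    cases hs with
    | left _ hs =>
      obtain ⟨U', V', h1, h2, h3⟩ := ih hs
      exact ⟨_, _, .left _ h1, h2, h3.node (.refl _)⟩
    | right _ hs => exact ⟨_, _, .right _ hs, h.tamariLE.node (.refl _), .refl _⟩
  | right L h ih =>
    cases hs with
    | left _ hs => exact ⟨_, _, .left _ hs, .refl _, (TamariLE.refl _).node h.tamariLE⟩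
    | right _ hs =>
      obtain ⟨U', V', h1, h2, h3⟩ := ih hs
      exact ⟨_, _, .right _ h1, (TamariLE.refl _).node h2, h3⟩

theorem TamariLE.splits {T T' : BTree} (h : TamariLE T T') {U V : BTree} (hs : Splits T U V) :
    ∃ U' V', Splits T' U' V' ∧ TamariLE U U' ∧ TamariLE V V' := by
  induction h with
  | refl => exact ⟨U, V, hs, .refl _, .refl _⟩
  | tail _ h ih =>
    obtain ⟨U', V', h1, h2, h3⟩ := ih
    obtain ⟨U'', V'', h1', h2', h3'⟩ := h.splits h1
    exact ⟨U'', V'', h1', h2.trans h2', h3.trans h3'⟩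

/-- For the converse, follow the cut `U`, `V` of `graftLeft U V` along the rotations up to `T` and
on to `graftRight V U`. The parts only go up, and by `Splits.unique` they end as `U` and `V` again;
antisymmetry shows that they were `U` and `V` at `T`. -/
theorem splits_iff {T U V : BTree} :
    Splits T U V ↔ TamariLE (graftLeft U V) T ∧ TamariLE T (graftRight V U) := by
  refine ⟨fun h => ⟨h.graftLeft_le, h.le_graftRight⟩, fun ⟨h, h'⟩ => ?_⟩
  obtain ⟨U₁, V₁, hs₁, hU₁, hV₁⟩ := h.splits (splits_graftLeft U V)
  obtain ⟨U₂, V₂, hs₂, hU₂, hV₂⟩ := h'.splits hs₁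
  obtain ⟨rfl, rfl⟩ := hs₂.unique (splits_graftRight U V)
    (hU₁.trans hU₂).numNodes.symm
  rw [hU₁.antisymm hU₂, hV₁.antisymm hV₂]
  exact hs₁

/-! ### Binary search trees -/

/-- The labels of a tree in infix order. -/
def inorder : BinaryTree ℕ → List ℕ
  | .nil => []
  | .node x l r => inorder l ++ x :: inorder r

/-- Binary search trees. -/
def IsBST : BinaryTree ℕ → Prop
  | .nil => True
  | .node x l r => (∀ a ∈ inorder l, a ≤ x) ∧ (∀ a ∈ inorder r, x < a) ∧ IsBST l ∧ IsBST r

@[simp] theorem shape_nil : shape .nil = .nil := rfl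
@[simp] theorem shape_node (x : ℕ) (l r : BinaryTree ℕ) :
    shape (.node x l r) = bnode (shape l) (shape r) := rfl

theorem length_inorder (t : BinaryTree ℕ) : (inorder t).length = (shape t).numNodes := by
  induction t with
  | nil => rfl
  | node x l r hl hr => simp [inorder, hl, hr]; omega

theorem inorder_bstInsert_perm (a : ℕ) (t : BinaryTree ℕ) :
    (inorder (bstInsert a t)).Perm (a :: inorder t) := by
  induction t with
  | nil => exact .refl _
  | node x l r hl hr =>
    rw [bstInsert]
    split_ifs
    · exact hl.append_right _
    · refine List.Perm.trans (((hr.cons x).trans (.swap _ _ _)).append_left _) ?_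
      exact List.perm_middle

theorem inorder_bst_perm (w : List ℕ) : (inorder (bst w)).Perm w := by
  induction w with
  | nil => exact .refl _
  | cons a w ih => exact (inorder_bstInsert_perm a (bst w)).trans (ih.cons a)

theorem IsBST.bstInsert {t : BinaryTree ℕ} (h : IsBST t) (a : ℕ) : IsBST (bstInsert a t) := by
  induction t with
  | nil => exact ⟨by simp [inorder], by simp [inorder], trivial, trivial⟩
  | node x l r hl hr =>
    obtain ⟨h1, h2, h3, h4⟩ := h
    rw [MStut.bstInsert]
    split_ifs with hax
    · refine ⟨fun b hb => ?_, h2, hl h3, h4⟩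
      rcases List.mem_cons.1 ((inorder_bstInsert_perm a l).mem_iff.1 hb) with rfl | hb
      · exact hax
      · exact h1 b hb
    · refine ⟨h1, fun b hb => ?_, h3, hr h4⟩
      rcases List.mem_cons.1 ((inorder_bstInsert_perm a r).mem_iff.1 hb) with rfl | hb
      · exact not_le.1 hax
      · exact h2 b hb

theorem isBST_bst (w : List ℕ) : IsBST (bst w) := by
  induction w with
  | nil => trivial
  | cons a w ih => exact ih.bstInsert a

theorem IsBST.pairwise {t : BinaryTree ℕ} (h : IsBST t) : (inorder t).Pairwise (· ≤ ·) := by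
  induction t with
  | nil => exact .nil
  | node x l r hl hr =>
    obtain ⟨h1, h2, h3, h4⟩ := h
    refine List.pairwise_append.2 ⟨hl h3, List.pairwise_cons.2 ⟨fun b hb => (h2 b hb).le, hr h4⟩, ?_⟩
    intro a ha b hb
    rcases List.mem_cons.1 hb with rfl | hb
    · exact h1 a ha
    · exact (h1 a ha).trans (h2 b hb).le

theorem eq_of_shape_of_inorder {t t' : BinaryTree ℕ} (hs : shape t = shape t')
    (hi : inorder t = inorder t') : t = t' := by
  induction t generalizing t' with
  | nil =>
    cases t' with
    | nil => rfl
    | node => simp at hs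
  | node x l r hl hr =>
    cases t' with
    | nil => simp at hs
    | node x' l' r' =>
      simp only [shape_node, BinaryTree.node.injEq, true_and] at hs
      have hlen : (inorder l).length = (inorder l').length := by
        rw [length_inorder, length_inorder, hs.1]
      obtain ⟨h1, h2⟩ := List.append_inj hi hlen
      obtain ⟨rfl, h3⟩ := List.cons.inj h2
      rw [hl hs.1 h1, hr hs.2 h3]

/-- The infix reading of a search tree is the sorted rearrangement of its word, so the shape leaves
no freedom for the labels. -/
theorem bst_eq_of_shape_eq {w w' : List ℕ} (hp : w.Perm w') (h : shape (bst w) = shape (bst w')) :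
    bst w = bst w' := by
  refine eq_of_shape_of_inorder h (List.Perm.eq_of_pairwise (le := (· ≤ ·))
    (fun a b _ _ h h' => le_antisymm h h') (isBST_bst w).pairwise (isBST_bst w').pairwise ?_)
  exact (inorder_bst_perm w).trans (hp.trans (inorder_bst_perm w').symm)

/-- The part of a binary search tree with labels `≤ k`. -/
def lowTree (k : ℕ) : BinaryTree ℕ → BinaryTree ℕ
  | .nil => .nil
  | .node x l r => if x ≤ k then .node x l (lowTree k r) else lowTree k l

/-- The part of a binary search tree with labels `> k`. -/
def highTree (k : ℕ) : BinaryTree ℕ → BinaryTree ℕ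
  | .nil => .nil
  | .node x l r => if x ≤ k then highTree k r else .node x (highTree k l) r

theorem lowTree_bstInsert (k a : ℕ) (t : BinaryTree ℕ) :
    lowTree k (bstInsert a t) = if a ≤ k then bstInsert a (lowTree k t) else lowTree k t := by
  induction t with
  | nil => rfl
  | node x l r hl hr =>
    by_cases h1 : a ≤ x <;> by_cases h2 : x ≤ k <;> by_cases h3 : a ≤ k <;>
      first
      | omega
      | simp [bstInsert, lowTree, h1, h2, h3, hl, hr]

theorem highTree_bstInsert (k a : ℕ) (t : BinaryTree ℕ) :
    highTree k (bstInsert a t) = if k < a then bstInsert a (highTree k t) else highTree k t := by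
  induction t with
  | nil => by_cases h : a ≤ k <;> simp [bstInsert, highTree, h, not_lt.2, not_le.1]
  | node x l r hl hr =>
    by_cases h1 : a ≤ x <;> by_cases h2 : x ≤ k <;> by_cases h3 : k < a <;>
      first
      | omega
      | simp [bstInsert, highTree, h1, h2, h3, hl, hr]

theorem bst_filter_le (k : ℕ) (w : List ℕ) : bst (w.filter fun a => a ≤ k) = lowTree k (bst w) := by
  induction w with
  | nil => rfl
  | cons a w ih =>
    rw [List.filter_cons, show bst (a :: w) = bstInsert a (bst w) from rfl, lowTree_bstInsert, ← ih]
    by_cases h : a ≤ k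
    · simp only [h, decide_true, if_true]; rfl
    · simp only [h, decide_false, Bool.false_eq_true, if_false]

theorem bst_filter_lt (k : ℕ) (w : List ℕ) :
    bst (w.filter fun a => k < a) = highTree k (bst w) := by
  induction w with
  | nil => rfl
  | cons a w ih =>
    rw [List.filter_cons, show bst (a :: w) = bstInsert a (bst w) from rfl, highTree_bstInsert, ← ih]
    by_cases h : k < a
    · simp only [h, decide_true, if_true]; rfl
    · simp only [h, decide_false, Bool.false_eq_true, if_false]

/-- The mirror image reads the labels in decreasing order, so the part with labels `> k` comes
first. -/
theorem splits_mirror_shape (k : ℕ) (t : BinaryTree ℕ) : Splits (mirror (shape t))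
    (mirror (shape (highTree k t))) (mirror (shape (lowTree k t))) := by
  induction t with
  | nil => exact .nil
  | node x l r hl hr =>
    rw [highTree, lowTree]
    split_ifs
    · exact .left _ hr
    · exact .right _ hl

theorem foldr_bstInsert_node (x : ℕ) (l r : BinaryTree ℕ) (u : List ℕ) :
    u.foldr bstInsert (.node x l r) = .node x ((u.filter fun a => a ≤ x).foldr bstInsert l)
      ((u.filter fun a => x < a).foldr bstInsert r) := by
  induction u with
  | nil => rfl
  | cons a u ih =>
    rw [List.foldr_cons, ih, bstInsert]
    by_cases h : a ≤ x
    · simp [h, h.not_gt]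
    · simp [h, not_le.1 h]

/-- The root of `t` sorts the letters of `u` into two subwords, whose search trees are the two parts
of `bst u` cut at that root; hence the induction on `t`. -/
theorem foldr_bstInsert_congr {u u' : List ℕ} (h : bst u = bst u') (t : BinaryTree ℕ) :
    u.foldr bstInsert t = u'.foldr bstInsert t := by
  induction t generalizing u u' with
  | nil => exact h
  | node x l r hl hr =>
    rw [foldr_bstInsert_node, foldr_bstInsert_node,
      hl (u := u.filter fun a => a ≤ x) (u' := u'.filter fun a => a ≤ x)
        (by rw [bst_filter_le, bst_filter_le, h]),
      hr (u := u.filter fun a => x < a) (u' := u'.filter fun a => x < a)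
        (by rw [bst_filter_lt, bst_filter_lt, h])]

/-- The sylvester congruence is compatible with concatenation. -/
theorem bst_append_congr {u u' v v' : List ℕ} (hu : bst u = bst u') (hv : bst v = bst v') :
    bst (u ++ v) = bst (u' ++ v') := by
  rw [bst, bst, List.foldr_append, List.foldr_append, foldr_bstInsert_congr hu]
  exact congrArg (fun t => u'.foldr bstInsert t) hv

theorem map_bstInsert (f : ℕ → ℕ) (a : ℕ) (t : BinaryTree ℕ)
    (h : ∀ x ∈ inorder t, (a ≤ x ↔ f a ≤ f x)) :
    bstInsert (f a) (t.map f) = (bstInsert a t).map f := by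
  induction t with
  | nil => rfl
  | node x l r hl hr =>
    simp only [inorder, List.mem_append, List.mem_cons] at h
    simp only [BinaryTree.map, bstInsert, h x (by simp)]
    split_ifs
    · rw [hl fun y hy => h y (Or.inl hy)]; rfl
    · rw [hr fun y hy => h y (Or.inr (Or.inr hy))]; rfl

theorem bst_map (f : ℕ → ℕ) (w : List ℕ) (h : ∀ a ∈ w, ∀ b ∈ w, (a ≤ b ↔ f a ≤ f b)) :
    bst (w.map f) = (bst w).map f := by
  induction w with
  | nil => rfl
  | cons a w ih =>
    rw [List.map_cons, show bst (f a :: w.map f) = bstInsert (f a) (bst (w.map f)) from rfl,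
      ih fun b hb c hc => h b (by simp [hb]) c (by simp [hc])]
    refine map_bstInsert f a (bst w) fun x hx => h a (by simp) x ?_
    exact List.mem_cons_of_mem _ ((inorder_bst_perm w).mem_iff.1 hx)

theorem shape_map (f : ℕ → ℕ) (t : BinaryTree ℕ) : shape (t.map f) = shape t := by
  induction t with
  | nil => rfl
  | node x l r hl hr => exact congrArg₂ bnode hl hr

/-- A word whose binary search tree is `t`. -/
def reading : BinaryTree ℕ → List ℕ
  | .nil => []
  | .node x l r => (reading l ++ reading r) ++ [x]

theorem reading_perm (t : BinaryTree ℕ) : (reading t).Perm (inorder t) := by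
  induction t with
  | nil => exact .refl _
  | node x l r hl hr =>
    rw [reading, inorder, List.append_assoc]
    exact hl.append ((List.perm_append_singleton _ _).trans (hr.cons x))

theorem bst_reading {t : BinaryTree ℕ} (h : IsBST t) : bst (reading t) = t := by
  induction t with
  | nil => rfl
  | node x l r hl hr =>
    obtain ⟨h1, h2, h3, h4⟩ := h
    have k1 : ∀ a ∈ reading l, a ≤ x := fun a ha => h1 a ((reading_perm l).mem_iff.1 ha)
    have k2 : ∀ a ∈ reading r, x < a := fun a ha => h2 a ((reading_perm r).mem_iff.1 ha)
    have e1 : ((reading l).filter fun a => a ≤ x) = reading l :=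
      List.filter_eq_self.2 fun a ha => by simpa using k1 a ha
    have e2 : ((reading r).filter fun a => a ≤ x) = [] :=
      List.filter_eq_nil_iff.2 fun a ha => by simpa using k2 a ha
    have e3 : ((reading l).filter fun a => x < a) = [] :=
      List.filter_eq_nil_iff.2 fun a ha => by simpa using k1 a ha
    have e4 : ((reading r).filter fun a => x < a) = reading r :=
      List.filter_eq_self.2 fun a ha => by simpa using k2 a ha
    rw [reading, bst, List.foldr_append, show [x].foldr bstInsert .nil = .node x .nil .nil from rfl,
      foldr_bstInsert_node, List.filter_append, List.filter_append,
      e1, e2, e3, e4, List.append_nil, List.nil_append]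
    exact congrArg₂ (BinaryTree.node x) (hl h3) (hr h4)

/-! ### The trees of `m`-stuttering permutations are the `m`-binary trees -/

/-- `t` with `s` grafted as right child of its rightmost node. -/
def graftMax (s : BinaryTree ℕ) : BinaryTree ℕ → BinaryTree ℕ
  | .nil => s
  | .node x l r => .node x l (graftMax s r)

theorem inorder_graftMax (s t : BinaryTree ℕ) :
    inorder (graftMax s t) = inorder t ++ inorder s := by
  induction t with
  | nil => rfl
  | node x l r _ hr => simp only [graftMax, inorder, hr, List.append_assoc, List.cons_append]

theorem shape_graftMax (s t : BinaryTree ℕ) :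
    shape (graftMax s t) = graftRight (shape s) (shape t) := by
  induction t with
  | nil => rfl
  | node x l r _ hr => simp only [graftMax, shape_node, hr, graftRight]

theorem IsBST.graftMax {s t : BinaryTree ℕ} (hs : IsBST s) (ht : IsBST t)
    (h : ∀ a ∈ inorder t, ∀ b ∈ inorder s, a < b) : IsBST (graftMax s t) := by
  induction t with
  | nil => exact hs
  | node x l r _ hr =>
    obtain ⟨h1, h2, h3, h4⟩ := ht
    simp only [inorder, List.mem_append, List.mem_cons] at h
    refine ⟨h1, fun b hb => ?_, h3, hr h4 fun a ha => h a (Or.inr (Or.inr ha))⟩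
    rw [inorder_graftMax, List.mem_append] at hb
    rcases hb with hb | hb
    · exact h2 b hb
    · exact h x (Or.inr (Or.inl rfl)) b hb

/-- Follow the right spine to the first node labelled by the maximum `x`. Its right subtree would
have larger labels and is empty; `s` is its left subtree, and `t'` is what lies above. -/
theorem IsBST.exists_eq_graftMax {t : BinaryTree ℕ} (ht : IsBST t) {x : ℕ}
    (hle : ∀ a ∈ inorder t, a ≤ x) (hx : x ∈ inorder t) :
    ∃ t' s, t = MStut.graftMax (.node x s .nil) t' ∧ IsBST t' ∧ IsBST s ∧
      (∀ a ∈ inorder t', a < x) ∧ (∀ a ∈ inorder t', ∀ b ∈ inorder s, a < b) ∧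
      ∀ b ∈ inorder s, b ≤ x := by
  induction t with
  | nil => simp [inorder] at hx
  | node y l r _ hr =>
    obtain ⟨h1, h2, h3, h4⟩ := ht
    simp only [inorder, List.mem_append, List.mem_cons] at hle hx
    rcases (hle y (Or.inr (Or.inl rfl))).eq_or_lt with rfl | hy
    · have hrn : r = .nil := by
        cases r with
        | nil => rfl
        | node z l' r' =>
          have hz : z ∈ inorder (.node z l' r') := by simp [inorder]
          exact absurd (h2 z hz) (hle z (Or.inr (Or.inr hz))).not_gt
      subst hrn
      exact ⟨.nil, l, rfl, trivial, h3, by simp [inorder], by simp [inorder], h1⟩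
    · have hxr : x ∈ inorder r := by
        rcases hx with hx | rfl | hx
        · exact absurd (h1 x hx) hy.not_ge
        · exact absurd hy (lt_irrefl _)
        · exact hx
      obtain ⟨r', s, rfl, k1, k2, k3, k4, k5⟩ :=
        hr h4 (fun a ha => hle a (Or.inr (Or.inr ha))) hxr
      simp only [inorder_graftMax, inorder, List.mem_append, List.mem_cons] at h2
      refine ⟨.node y l r', s, rfl, ⟨h1, fun a ha => h2 a (Or.inl ha), h3, k1⟩, k2, ?_, ?_, k5⟩
      · simp only [inorder, List.mem_append, List.mem_cons]
        rintro a (ha | rfl | ha)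
        · exact (h1 a ha).trans_lt hy
        · exact hy
        · exact k3 a ha
      · simp only [inorder, List.mem_append, List.mem_cons]
        rintro a (ha | rfl | ha) b hb
        · exact (h1 a ha).trans_lt (h2 b (Or.inr (Or.inl hb)))
        · exact h2 b (Or.inr (Or.inl hb))
        · exact k4 a ha b hb

/-- In the mirror image, the `m` root nodes are `m` nodes with one label `x`, each being the first
node labelled `x` on the right spine of the left subtree of the preceding one. The second claim
concerns the left subtree `t` of the `i`-th of them: `i` copies of `x` are used and `j` remain to be
found. Counts matter only modulo `m`, so copies of `x` beyond the first `m` go into the last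
subtree. The induction is on a bound for the number of labels because `IsBST.exists_eq_graftMax`
does not split `t` at its root. -/
theorem isMBinary_and_exists_chain {m : ℕ} (hm : 1 ≤ m) (N : ℕ) : ∀ t : BinaryTree ℕ,
    (inorder t).length ≤ N → IsBST t →
    ((∀ a, m ∣ (inorder t).count a) → IsMBinary m (mirror (shape t))) ∧
    ∀ x i j, 1 ≤ i → i + j = m → (∀ a ∈ inorder t, a ≤ x) →
      (∀ a, a ≠ x → m ∣ (inorder t).count a) → m ∣ (inorder t).count x + i →
      ∃ R Rs, mirror (shape t) = graftLeft (rootChain .nil Rs) R ∧ Rs.length = j ∧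
        IsMBinary m R ∧ ∀ S ∈ Rs, IsMBinary m S := by
  induction N with
  | zero =>
    intro t hN ht
    obtain rfl : t = .nil := by
      cases t with
      | nil => rfl
      | node => simp [inorder] at hN
    refine ⟨fun _ => .nil, fun x i j hi hij _ _ hd => ⟨.nil, [], rfl, ?_, .nil, by simp⟩⟩
    simp only [inorder, List.count_nil, zero_add] at hd
    have := Nat.le_of_dvd hi hd
    rw [List.length_nil]
    omega
  | succ N ih =>
    intro t hN ht
    have hP : (∀ a, m ∣ (inorder t).count a) → IsMBinary m (mirror (shape t)) := by
      intro hc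
      cases t with
      | nil => exact .nil
      | node x l r =>
        obtain ⟨h1, h2, h3, h4⟩ := ht
        simp only [inorder, List.length_append, List.length_cons] at hN
        simp only [inorder, List.count_append, List.count_cons, beq_iff_eq] at hc
        have hr : IsMBinary m (mirror (shape r)) := by
          refine (ih r (by omega) h4).1 fun a => ?_
          by_cases ha : a ∈ inorder r
          · have := hc a
            rwa [List.count_eq_zero_of_not_mem (l := inorder l)
              fun hl => absurd (h1 a hl) (h2 a ha).not_ge, if_neg (h2 a ha).ne, zero_add,
              add_zero] at this
          · rw [List.count_eq_zero_of_not_mem ha]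
            exact dvd_zero m
        -- The root is the first of the `m` root nodes, so `i = 1` for its left subtree.
        obtain ⟨R, Rs, e, hlen, hR, hRs⟩ := (ih l (by omega) h3).2 x 1 (m - 1) le_rfl (by omega) h1
          (fun a hax => by
            by_cases ha : a ∈ inorder l
            · have := hc a
              rwa [List.count_eq_zero_of_not_mem (l := inorder r)
                fun hr => absurd (h1 a ha) (h2 a hr).not_ge, if_neg (Ne.symm hax), add_zero,
                add_zero] at this
            · rw [List.count_eq_zero_of_not_mem ha]
              exact dvd_zero m)
          (by
            have := hc x
            rwa [List.count_eq_zero_of_not_mem (l := inorder r)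
              fun hr => absurd (h2 x hr) (lt_irrefl x), if_pos rfl, zero_add] at this)
        have := IsMBinary.chain (m := m) (mirror (shape r)) (R :: Rs) (by simp [hlen]; omega) hr
          (List.forall_mem_cons.2 ⟨hR, hRs⟩)
        rw [rootChain, ← e] at this
        exact this
    refine ⟨hP, fun x i j hi hij hle hc hcx => ?_⟩
    cases j with
    | zero =>
      refine ⟨mirror (shape t), [], ?_, rfl, hP fun a => ?_, by simp⟩
      · simp only [rootChain]
        generalize mirror (shape t) = S
        induction S with
        | nil => rfl
        | node _ l r hl _ => rw [graftLeft, ← hl]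
      · by_cases hax : a = x
        · subst hax
          obtain rfl : i = m := by omega
          exact (Nat.dvd_add_left dvd_rfl).1 hcx
        · exact hc a hax
    | succ j =>
      -- Otherwise `m` would divide `i`, although `1 ≤ i < m`.
      have hx : x ∈ inorder t := by
        by_contra hx
        rw [List.count_eq_zero_of_not_mem hx, zero_add] at hcx
        have := Nat.le_of_dvd hi hcx
        omega
      obtain ⟨t', s, rfl, k1, k2, k3, k4, k5⟩ := ht.exists_eq_graftMax hle hx
      simp only [inorder_graftMax, inorder, List.count_append, List.count_cons, List.count_nil,
        zero_add, beq_iff_eq] at hc hcx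
      simp only [inorder_graftMax, inorder, List.length_append, List.length_cons,
        List.length_nil] at hN
      have ht' : IsMBinary m (mirror (shape t')) := by
        refine (ih t' (by omega) k1).1 fun a => ?_
        by_cases ha : a ∈ inorder t'
        · have := hc a (k3 a ha).ne
          rwa [List.count_eq_zero_of_not_mem (l := inorder s)
            fun hs => absurd (k4 a ha a hs) (lt_irrefl a), if_neg (k3 a ha).ne', zero_add,
            add_zero] at this
        · rw [List.count_eq_zero_of_not_mem ha]
          exact dvd_zero m
      obtain ⟨R, Rs, e, hlen, hR, hRs⟩ := (ih s (by omega) k2).2 x (i + 1) j (by omega) (by omega)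
        k5 (fun a hax => by
          by_cases ha : a ∈ inorder s
          · have := hc a hax
            rwa [List.count_eq_zero_of_not_mem (l := inorder t')
              fun ht => absurd (k4 a ht a ha) (lt_irrefl a), if_neg (Ne.symm hax), zero_add,
              add_zero] at this
          · rw [List.count_eq_zero_of_not_mem ha]
            exact dvd_zero m)
        (by
          rwa [List.count_eq_zero_of_not_mem (l := inorder t')
            fun ht => absurd (k3 x ht) (lt_irrefl x), if_pos trivial, zero_add, add_assoc,
            add_comm 1] at hcx)
      refine ⟨mirror (shape t'), R :: Rs, ?_, by simp [hlen], ht', List.forall_mem_cons.2 ⟨hR, hRs⟩⟩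
      rw [shape_graftMax, mirror_graftRight, rootChain, ← e]
      rfl

theorem isMBinary_of_isStutWord {m : ℕ} (hm : 1 ≤ m) {w : List ℕ} (hw : IsStutWord m w) :
    IsMBinary m (mirror (shape (bst w))) :=
  (isMBinary_and_exists_chain hm _ (bst w) le_rfl (isBST_bst w)).1 fun a =>
    (inorder_bst_perm w).count_eq a ▸ hw a

/-- The word `(k+1)^m (k+2)^m ⋯ (k+n)^m`. -/
def shiftedBlock (m k n : ℕ) : List ℕ :=
  (List.range n).flatMap fun i => List.replicate m (k + (i + 1))

theorem shiftedBlock_zero_left (m n : ℕ) : shiftedBlock m 0 n = blockWord m n := by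
  simp [shiftedBlock, blockWord]

theorem shiftedBlock_add (m k n n' : ℕ) :
    shiftedBlock m k (n + n') = shiftedBlock m k n ++ shiftedBlock m (k + n) n' := by
  simp [shiftedBlock, List.range_add, List.flatMap_map, add_assoc]

theorem shiftedBlock_one (m k : ℕ) : shiftedBlock m k 1 = List.replicate m (k + 1) := by
  simp [shiftedBlock]

theorem mem_shiftedBlock {m k n a : ℕ} (h : a ∈ shiftedBlock m k n) : k < a ∧ a ≤ k + n := by
  simp only [shiftedBlock, List.mem_flatMap, List.mem_range, List.mem_replicate] at h
  obtain ⟨i, hi, -, rfl⟩ := h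
  omega

/-- `T` is the mirror image of the shape of a binary search tree whose labels are `n` consecutive
integers from `k + 1`, each one `m` times. -/
def HasLabelling (m : ℕ) (T : BTree) : Prop :=
  ∀ k, ∃ n t, IsBST t ∧ shape t = mirror T ∧ inorder t = shiftedBlock m k n

/-- A tail of a chain of root nodes has fewer than `m` copies of its common label. That label is put
above all labels of the subtrees `R`, so the missing copies can be added by the nodes above. -/
theorem exists_chain_labelling {m : ℕ} (Rs : List BTree) (hRs : ∀ R ∈ Rs, HasLabelling m R)
    (k : ℕ) : ∃ n t, IsBST t ∧ shape t = mirror (rootChain .nil Rs) ∧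
      inorder t = shiftedBlock m k n ++ List.replicate Rs.length (k + n + 1) := by
  induction Rs generalizing k with
  | nil => exact ⟨0, .nil, trivial, rfl, by simp [inorder, shiftedBlock]⟩
  | cons R Rs ih =>
    obtain ⟨n₁, t₁, h1, h2, h3⟩ := hRs R (by simp) k
    obtain ⟨n₂, t₂, k1, k2, k3⟩ := ih (fun S hS => hRs S (by simp [hS])) (k + n₁)
    refine ⟨n₁ + n₂, .node (k + (n₁ + n₂) + 1) (graftMax t₂ t₁) .nil, ⟨?_, by simp [inorder], ?_,
      trivial⟩, ?_, ?_⟩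
    · intro a ha
      rw [inorder_graftMax, h3, k3, List.mem_append, List.mem_append, List.mem_replicate] at ha
      rcases ha with ha | ha | ha
      · have := mem_shiftedBlock ha; omega
      · have := mem_shiftedBlock ha; omega
      · omega
    · refine k1.graftMax h1 fun a ha b hb => ?_
      rw [h3] at ha
      rw [k3, List.mem_append, List.mem_replicate] at hb
      have := mem_shiftedBlock ha
      rcases hb with hb | hb
      · have := mem_shiftedBlock hb; omega
      · omega
    · rw [shape_node, shape_graftMax, h2, k2, rootChain, mirror, mirror_graftLeft]
      rfl
    · rw [inorder, inorder_graftMax, h3, k3, shiftedBlock_add, inorder, List.length_cons,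
        List.replicate_succ', ← add_assoc]
      simp

theorem IsMBinary.hasLabelling {m : ℕ} {T : BTree} (h : IsMBinary m T) : HasLabelling m T := by
  induction h with
  | nil => exact fun k => ⟨0, .nil, trivial, rfl, by simp [inorder, shiftedBlock]⟩
  | chain L Rs hlen _ _ hL hRs =>
    cases Rs with
    | nil => exact hL
    | cons R Rs =>
      intro k
      obtain ⟨n₁, t₁, h1, h2, h3⟩ := hRs R (by simp) k
      obtain ⟨n₂, t₂, k1, k2, k3⟩ :=
        exists_chain_labelling Rs (fun S hS => hRs S (by simp [hS])) (k + n₁)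
      obtain ⟨n₃, t₃, l1, l2, l3⟩ := hL (k + (n₁ + n₂) + 1)
      refine ⟨n₁ + n₂ + 1 + n₃, .node (k + (n₁ + n₂) + 1) (graftMax t₂ t₁) t₃, ⟨?_, ?_, ?_,
        l1⟩, ?_, ?_⟩
      · intro a ha
        rw [inorder_graftMax, h3, k3, List.mem_append, List.mem_append, List.mem_replicate] at ha
        rcases ha with ha | ha | ha
        · have := mem_shiftedBlock ha; omega
        · have := mem_shiftedBlock ha; omega
        · omega
      · intro a ha
        rw [l3] at ha
        have := mem_shiftedBlock ha
        omega
      · refine k1.graftMax h1 fun a ha b hb => ?_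
        rw [h3] at ha
        rw [k3, List.mem_append, List.mem_replicate] at hb
        have := mem_shiftedBlock ha
        rcases hb with hb | hb
        · have := mem_shiftedBlock hb; omega
        · omega
      · rw [shape_node, shape_graftMax, h2, k2, l2, rootChain, mirror, mirror_graftLeft]
      · rw [inorder, inorder_graftMax, h3, k3, l3, shiftedBlock_add, shiftedBlock_add,
          shiftedBlock_add, shiftedBlock_one, ← hlen, List.length_cons, List.replicate_succ']
        simp [add_assoc]

/-! ### Stability of `m`-binary trees under grafting. -/

theorem IsMBinary.graftLeft {m : ℕ} (hm : 1 ≤ m) {S T : BTree} (hS : IsMBinary m S)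
    (hT : IsMBinary m T) : IsMBinary m (graftLeft S T) := by
  induction hT with
  | nil => exact hS
  | chain L Rs hlen _ hRs hL _ =>
    cases Rs with
    | nil => simp at hlen; omega
    | cons R Rs => exact .chain (MStut.graftLeft S L) (R :: Rs) hlen hL hRs

/-- The graft lands in the first nonempty `R` of the list, whose rightmost branch is untouched by
the root node grafted on its left. If all are empty, the last root node is the rightmost node and
`S` becomes its right subtree. -/
theorem exists_graftRight_rootChain {m : ℕ} {S : BTree} (hS : IsMBinary m S) (Rs : List BTree)
    (hne : Rs ≠ []) (hRs : ∀ R ∈ Rs, IsMBinary m R)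
    (hRs' : ∀ R ∈ Rs, IsMBinary m (graftRight S R)) (L : BTree) :
    ∃ Rs', Rs'.length = Rs.length ∧ (∀ R ∈ Rs', IsMBinary m R) ∧
      graftRight S (rootChain L Rs) = rootChain L Rs' := by
  induction Rs generalizing L with
  | nil => exact absurd rfl hne
  | cons R Rs ih =>
    rw [List.forall_mem_cons] at hRs hRs'
    rw [rootChain]
    cases R with
    | node x l r =>
      exact ⟨graftRight S (.node x l r) :: Rs, rfl, List.forall_mem_cons.2 ⟨hRs'.1, hRs.2⟩, rfl⟩
    | nil =>
      by_cases h : Rs = []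
      · subst h
        refine ⟨[S], rfl, by simpa using hS, ?_⟩
        have : MStut.graftLeft .nil S = S := by
          generalize S = T
          induction T with
          | nil => rfl
          | node _ l r hl _ => rw [MStut.graftLeft, hl]
        simp [rootChain, MStut.graftLeft, graftRight, this]
      · obtain ⟨Rs', h1, h2, h3⟩ := ih h hRs.2 hRs'.2 .nil
        refine ⟨.nil :: Rs', by simp [h1], List.forall_mem_cons.2 ⟨.nil, h2⟩, ?_⟩
        rw [rootChain, ← h3]
        rfl

theorem IsMBinary.graftRight {m : ℕ} (hm : 1 ≤ m) {S T : BTree} (hS : IsMBinary m S)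
    (hT : IsMBinary m T) : IsMBinary m (graftRight S T) := by
  induction hT with
  | nil => exact hS
  | chain L Rs hlen hL hRs _ hRs' =>
    obtain ⟨Rs', h1, h2, h3⟩ := exists_graftRight_rootChain hS Rs
      (by rintro rfl; simp at hlen; omega) hRs hRs' L
    rw [h3]
    exact .chain L Rs' (h1.trans hlen) hL h2

/-! ### The tree of an `m`-stuttering permutation and its cuts. -/

namespace StutPerm

variable {m : ℕ}

/-- The `m`-binary tree of an `m`-stuttering permutation. -/
def toTree (hm : 1 ≤ m) (σ : StutPerm m) : MBinTree m :=
  ⟨mirror (shape (bst σ.word)), isMBinary_of_isStutWord hm σ.isStutWord⟩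

theorem tree_toTree (hm : 1 ≤ m) (σ : StutPerm m) :
    (σ.toTree hm).tree = mirror (shape (bst σ.word)) := rfl

theorem toTree_surjective (hm : 1 ≤ m) : Function.Surjective (toTree (m := m) hm) := by
  rintro ⟨T, hT⟩
  obtain ⟨n, t, h1, h2, h3⟩ := hT.hasLabelling 0
  refine ⟨⟨reading t, n, ?_⟩, Subtype.ext ?_⟩
  · rw [← shiftedBlock_zero_left, ← h3]
    exact reading_perm t
  · change mirror (shape (bst (reading t))) = T
    rw [bst_reading h1, h2, mirror_mirror]

theorem numNodes_toTree (hm : 1 ≤ m) (σ : StutPerm m) :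
    (σ.toTree hm).tree.numNodes = m * σ.size := by
  rw [tree_toTree, numNodes_mirror, ← length_inorder, (inorder_bst_perm _).length_eq,
    σ.length_eq hm]

theorem mem_sylvesterClass (hm : 1 ≤ m) (σ : StutPerm m) (T : MBinTree m) :
    σ ∈ sylvesterClass T ↔ σ.toTree hm = T := by
  constructor
  · intro h
    refine Subtype.ext ?_
    change mirror (shape (bst σ.word)) = T.tree
    rw [show shape (bst σ.word) = mirror T.tree from h, mirror_mirror]
  · rintro rfl
    exact (mirror_mirror _).symm

theorem size_eq_of_toTree_eq (hm : 1 ≤ m) {σ τ : StutPerm m} (h : σ.toTree hm = τ.toTree hm) :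
    σ.size = τ.size := by
  have := congrArg (fun T => T.tree.numNodes) h
  simp only [numNodes_toTree] at this
  exact Nat.eq_of_mul_eq_mul_left hm this

theorem bst_eq_of_toTree_eq (hm : 1 ≤ m) {σ τ : StutPerm m} (h : σ.toTree hm = τ.toTree hm) :
    σ.word.Perm τ.word ∧ bst σ.word = bst τ.word := by
  have hp : σ.word.Perm τ.word :=
    (σ.perm_size hm).trans (size_eq_of_toTree_eq hm h ▸ (τ.perm_size hm).symm)
  refine ⟨hp, bst_eq_of_shape_eq hp ?_⟩
  rw [← mirror_mirror (shape (bst σ.word)), ← mirror_mirror (shape (bst τ.word))]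
  exact congrArg (fun T => mirror T.tree) h

theorem splits_toTree (hm : 1 ≤ m) (σ : StutPerm m) (k : ℕ) :
    Splits (σ.toTree hm).tree ((σ.high hm k).toTree hm).tree ((σ.low hm k).toTree hm).tree := by
  have h := splits_mirror_shape k (bst σ.word)
  rw [← bst_filter_le, ← bst_filter_lt] at h
  rw [tree_toTree, tree_toTree, tree_toTree, word_low, word_high, bst_map, shape_map]
  · exact h
  · intro a ha b hb
    have h1 : k < a := by simpa using (List.mem_filter.1 ha).2
    have h2 : k < b := by simpa using (List.mem_filter.1 hb).2
    omega

/-- Cutting the letters of `ν` at `k` cuts its tree. Conversely, both trees come from permutations,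
so the parts of any such cut have sizes divisible by `m`, and the cut of that size is the one at `k
= σ.size`. -/
theorem exists_low_high_iff (hm : 1 ≤ m) (ν : StutPerm m) (T₁ T₂ : MBinTree m) :
    (∃ k ∈ Finset.range (ν.size + 1), (ν.low hm k).toTree hm = T₁ ∧ (ν.high hm k).toTree hm = T₂) ↔
      TamariLE (graftLeft T₂.tree T₁.tree) (ν.toTree hm).tree ∧
        TamariLE (ν.toTree hm).tree (graftRight T₁.tree T₂.tree) := by
  rw [← splits_iff]
  constructor
  · rintro ⟨k, -, rfl, rfl⟩
    exact ν.splits_toTree hm k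
  · intro h
    obtain ⟨σ, rfl⟩ := toTree_surjective hm T₁
    obtain ⟨τ, rfl⟩ := toTree_surjective hm T₂
    have hn := h.numNodes
    rw [numNodes_toTree, numNodes_toTree, numNodes_toTree, ← mul_add] at hn
    replace hn := Nat.eq_of_mul_eq_mul_left hm hn
    have hk : σ.size ≤ ν.size := by omega
    obtain ⟨h1, h2⟩ := (ν.splits_toTree hm σ.size).unique h <| by
      rw [numNodes_toTree, numNodes_toTree, ν.size_high hm _ hk, hn, Nat.add_sub_cancel]
    exact ⟨σ.size, Finset.mem_range.2 (by omega), Subtype.ext h2, Subtype.ext h1⟩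

end StutPerm

theorem finite_mBinTree {m : ℕ} (hm : 1 ≤ m) (N : ℕ) :
    {T : MBinTree m | T.tree.numNodes = N}.Finite := by
  refine Set.Finite.subset ((StutPerm.finite_size hm (N / m)).image (StutPerm.toTree hm)) ?_
  rintro T rfl
  obtain ⟨σ, rfl⟩ := StutPerm.toTree_surjective hm T
  refine ⟨σ, ?_, rfl⟩
  rw [Set.mem_ofPred_eq, σ.numNodes_toTree hm, Nat.mul_div_cancel_left _ hm]

theorem finite_sylvesterClass {m : ℕ} (hm : 1 ≤ m) (T : MBinTree m) : (sylvesterClass T).Finite := by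
  obtain ⟨τ, rfl⟩ := StutPerm.toTree_surjective hm T
  refine (StutPerm.finite_size hm τ.size).subset fun σ hσ => ?_
  exact StutPerm.size_eq_of_toTree_eq hm ((σ.mem_sylvesterClass hm _).1 hσ)

theorem finite_Icc {m : ℕ} (hm : 1 ≤ m) (T T' : MBinTree m) : (Set.Icc T T').Finite :=
  (finite_mBinTree hm T'.tree.numNodes).subset fun _ hS => TamariLE.numNodes hS.2

/-! ### Bases of generated subalgebras -/

theorem linearIndependent_of_dual {K M ι : Type*} [Field K] [AddCommMonoid M] [Module K M]
    (v : ι → M) (f : ι → M →ₗ[K] K) (h0 : ∀ i j, i ≠ j → f i (v j) = 0) (h1 : ∀ i, f i (v i) = 1) :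
    LinearIndependent K v :=
  letI : AddCommGroup M := Module.addCommMonoidToAddCommGroup K
  LinearIndependent.of_pairwise_dual_eq_zero_one v f (fun i j h => h0 i j h) h1

/-- The span contains 1 and is closed under products, so it is already the generated subalgebra.
This serves for the `G`, for the dual forms and for the sums over sylvester classes. -/
theorem exists_basis_adjoin {K Y ι : Type*} [Field K] [Semiring Y] [Algebra K Y] (v : ι → Y)
    (hv : LinearIndependent K v) (h1 : 1 ∈ Submodule.span K (Set.range v))
    (hmul : ∀ i j, v i * v j ∈ Submodule.span K (Set.range v)) :
    ∃ b : Module.Basis ι K (Algebra.adjoin K (Set.range v)), ∀ i, (b i : Y) = v i := by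
  have hle : Submodule.span K (Set.range v) * Submodule.span K (Set.range v) ≤
      Submodule.span K (Set.range v) := by
    rw [Submodule.span_mul_span, Submodule.span_le]
    rintro _ ⟨_, ⟨i, rfl⟩, _, ⟨j, rfl⟩, rfl⟩
    exact hmul i j
  have hspan : ∀ y ∈ Algebra.adjoin K (Set.range v), y ∈ Submodule.span K (Set.range v) := by
    intro y hy
    induction hy using Algebra.adjoin_induction with
    | mem y hy => exact Submodule.subset_span hy
    | algebraMap r =>
      rw [Algebra.algebraMap_eq_smul_one]
      exact Submodule.smul_mem _ r h1
    | add y z _ _ hy hz => exact add_mem hy hz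
    | mul y z _ _ hy hz => exact hle (Submodule.mul_mem_mul hy hz)
  let v' : ι → Algebra.adjoin K (Set.range v) := fun i => ⟨v i, Algebra.subset_adjoin ⟨i, rfl⟩⟩
  have hv' : LinearIndependent K v' :=
    LinearIndependent.of_comp (Algebra.adjoin K (Set.range v)).val.toLinearMap hv
  refine ⟨Module.Basis.mk hv' ?_, fun i => by rw [Module.Basis.mk_apply]⟩
  rintro ⟨y, hy⟩ -
  have h := hspan y hy
  have hrange : Set.range v = (Algebra.adjoin K (Set.range v)).val.toLinearMap '' Set.range v' := by
    rw [← Set.range_comp]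
    rfl
  rw [hrange, Submodule.span_image] at h
  obtain ⟨z, hz, hzy⟩ := h
  rwa [show (⟨y, hy⟩ : Algebra.adjoin K (Set.range v)) = z from Subtype.ext hzy.symm]

theorem mul_eq_sum_of_coe {K Y ι : Type*} [Field K] [Semiring Y] [Algebra K Y]
    {Q : Subalgebra K Y} {P : ι → Q} {v : ι → Y} (hP : ∀ i, (P i : Y) = v i) {i j : ι}
    {s : Finset ι} (h : v i * v j = ∑ k ∈ s, v k) : P i * P j = ∑ k ∈ s, P k := by
  refine Subtype.ext ?_
  rw [Subalgebra.coe_mul, AddSubmonoidClass.coe_finsetSum, hP, hP, h]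
  exact Finset.sum_congr rfl fun k _ => (hP k).symm

/-! ### Antipodes of connected bialgebras -/

section Antipode

open WithConv

variable {K X S : Type*} [Field K] [Ring X] [Algebra K X] [Coalgebra K X]

theorem isAntipode_iff (T : X →ₗ[K] X) : IsAntipode K T ↔
    toConv T * toConv LinearMap.id = 1 ∧ toConv LinearMap.id * toConv T = 1 := by
  rw [LinearMap.convMul_def, LinearMap.convMul_def, LinearMap.convOne_def,
    toConv_injective.eq_iff, toConv_injective.eq_iff]
  rfl

variable (b : Module.Basis S K X) {deg : S → ℕ} {C : S → Finset (S × S)}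
  (hC : ∀ σ, CoalgebraStruct.comul (R := K) (b σ) = ∑ p ∈ C σ, b p.1 ⊗ₜ[K] b p.2)
  (hdeg : ∀ σ, ∀ p ∈ C σ, deg p.1 + deg p.2 = deg σ)
  (h0 : ∀ σ, deg σ = 0 → b σ = algebraMap K X (CoalgebraStruct.counit (R := K) (b σ)))

include hC in
theorem convMul_basis (f g : WithConv (X →ₗ[K] X)) (σ : S) :
    (f * g).ofConv (b σ) = ∑ p ∈ C σ, f.ofConv (b p.1) * g.ofConv (b p.2) := by
  simp [hC]

variable (K X) in
/-- The difference between the unit of the convolution algebra and the identity. -/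
def convDefect : WithConv (X →ₗ[K] X) := 1 - toConv LinearMap.id

include hC hdeg h0 in
-- The defect vanishes in degree 0, so each convolution factor consumes at least one degree.
theorem convDefect_pow_basis (k : ℕ) (σ : S) (hk : deg σ < k) :
    (convDefect K X ^ k).ofConv (b σ) = 0 := by
  induction k generalizing σ with
  | zero => omega
  | succ k ih =>
    rw [pow_succ', convMul_basis b hC]
    refine Finset.sum_eq_zero fun p hp => ?_
    have := hdeg σ p hp
    by_cases hp0 : deg p.1 = 0
    · have : (convDefect K X).ofConv (b p.1) = 0 := by
        rw [convDefect, ofConv_sub, LinearMap.sub_apply, LinearMap.convOne_apply, ← h0 _ hp0]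
        exact sub_self _
      rw [this, zero_mul]
    · rw [ih p.2 (by omega), mul_zero]

variable (K X) in
/-- The truncated geometric series, which converges to the antipode. -/
def convGeom (N : ℕ) : WithConv (X →ₗ[K] X) := ∑ k ∈ Finset.range N, convDefect K X ^ k

theorem convGeom_apply (N : ℕ) (x : X) : (convGeom K X N).ofConv x =
    ∑ k ∈ Finset.range N, (convDefect K X ^ k).ofConv x := by
  induction N with
  | zero => rfl
  | succ N ih =>
    rw [Finset.sum_range_succ, ← ih, convGeom, Finset.sum_range_succ]
    rfl

include hC hdeg h0 in
theorem convGeom_basis {N : ℕ} (σ : S) (hN : deg σ < N) :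
    (convGeom K X N).ofConv (b σ) = (convGeom K X (deg σ + 1)).ofConv (b σ) := by
  rw [convGeom_apply, convGeom_apply]
  refine (Finset.sum_subset (Finset.range_mono hN) fun k _ hk => ?_).symm
  exact convDefect_pow_basis b hC hdeg h0 k σ (by simpa using hk)

theorem toConv_id_eq : toConv (LinearMap.id : X →ₗ[K] X) = 1 - convDefect K X := by
  rw [convDefect, sub_sub_cancel]

include hC hdeg h0 in
-- The identity is 1 minus the defect, so its convolution inverse is the geometric series in the
-- defect, a finite sum on each basis element.
theorem exists_isAntipode_basis : ∃ T : X →ₗ[K] X, IsAntipode K T ∧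
    ∀ σ, T (b σ) = (convGeom K X (deg σ + 1)).ofConv (b σ) := by
  let T : X →ₗ[K] X := b.constr K fun σ => (convGeom K X (deg σ + 1)).ofConv (b σ)
  have hT : ∀ σ, T (b σ) = (convGeom K X (deg σ + 1)).ofConv (b σ) := fun σ => b.constr_basis _ _ _
  -- Longer truncations give the same value, so one order of truncation serves all terms of a
  -- coproduct.
  have hT' : ∀ σ N, deg σ < N → T (b σ) = (convGeom K X N).ofConv (b σ) := fun σ N hN => by
    rw [hT, convGeom_basis b hC hdeg h0 σ hN]
  have hone : ∀ σ, ((1 : WithConv (X →ₗ[K] X)) - convDefect K X ^ (deg σ + 1)).ofConv (b σ) =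
      (1 : WithConv (X →ₗ[K] X)).ofConv (b σ) := fun σ => by
    rw [ofConv_sub, LinearMap.sub_apply,
      convDefect_pow_basis b hC hdeg h0 _ σ (Nat.lt_succ_self _), sub_zero]
  refine ⟨T, (isAntipode_iff T).2 ⟨?_, ?_⟩, hT⟩
  · refine ofConv_injective (b.ext fun σ => ?_)
    rw [← hone σ, ← geom_sum_mul_neg, ← toConv_id_eq, convMul_basis b hC, convMul_basis b hC]
    refine Finset.sum_congr rfl fun p hp => ?_
    have := hdeg σ p hp
    exact congrArg (· * _) (hT' p.1 _ (by omega))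
  · refine ofConv_injective (b.ext fun σ => ?_)
    rw [← hone σ, ← mul_neg_geom_sum, ← toConv_id_eq, convMul_basis b hC, convMul_basis b hC]
    refine Finset.sum_congr rfl fun p hp => ?_
    have := hdeg σ p hp
    exact congrArg (_ * ·) (hT' p.2 _ (by omega))

theorem convMul_mem {Q : Subalgebra K X}
    (hQ : ∀ z ∈ Q, CoalgebraStruct.comul (R := K) z ∈
      LinearMap.range (TensorProduct.map Q.val.toLinearMap Q.val.toLinearMap))
    {f g : WithConv (X →ₗ[K] X)} (hf : ∀ z ∈ Q, f.ofConv z ∈ Q) (hg : ∀ z ∈ Q, g.ofConv z ∈ Q) :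
    ∀ z ∈ Q, (f * g).ofConv z ∈ Q := by
  intro z hz
  obtain ⟨t, ht⟩ := hQ z hz
  rw [LinearMap.convMul_apply, ← ht]
  clear ht
  induction t using TensorProduct.induction_on with
  | zero => simp
  | tmul x y =>
    simp only [TensorProduct.map_tmul, LinearMap.mul'_apply]
    exact Q.mul_mem (hf _ x.2) (hg _ y.2)
  | add s t hs ht => simpa only [map_add] using Q.add_mem hs ht

include hC hdeg h0 in
-- The antipode is unique, hence on each element a finite sum of convolution powers of the defect.
-- The defect preserves `Q`, and convolution preserves this property when `Q` is stable under the
-- coproduct.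
theorem isHopfSubalgebra_of_ring {Q : Subalgebra K X}
    (hQ : ∀ z ∈ Q, CoalgebraStruct.comul (R := K) z ∈
      LinearMap.range (TensorProduct.map Q.val.toLinearMap Q.val.toLinearMap)) :
    IsHopfSubalgebra K Q := by
  refine ⟨hQ, fun T hT z hz => ?_⟩
  obtain ⟨T', hT', hTb⟩ := exists_isAntipode_basis b hC hdeg h0
  obtain rfl : T = T' := toConv_injective
    (left_inv_eq_right_inv ((isAntipode_iff T).1 hT).1 ((isAntipode_iff T').1 hT').2)
  have hJ : ∀ z ∈ Q, (convDefect K X).ofConv z ∈ Q := fun z hz =>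
    Q.sub_mem (Q.algebraMap_mem _) hz
  have hpow : ∀ k, ∀ z ∈ Q, (convDefect K X ^ k).ofConv z ∈ Q := by
    intro k
    induction k with
    | zero => exact fun z _ => Q.algebraMap_mem _
    | succ k ih =>
      rw [pow_succ']
      exact convMul_mem hQ hJ ih
  -- An element is a finite combination of basis elements, so a common order of truncation exists.
  have hlim : ∀ x : X, ∃ N, ∀ M, N ≤ M → T x = (convGeom K X M).ofConv x := by
    intro x
    have hx : x ∈ Submodule.span K (Set.range b) := b.mem_span x
    induction hx using Submodule.span_induction with
    | mem x hx =>
      obtain ⟨σ, rfl⟩ := hx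
      exact ⟨deg σ + 1, fun M hM => by rw [hTb, convGeom_basis b hC hdeg h0 σ hM]⟩
    | zero => exact ⟨0, fun M _ => by rw [map_zero, map_zero]⟩
    | add x y _ _ hx hy =>
      obtain ⟨N, hN⟩ := hx
      obtain ⟨N', hN'⟩ := hy
      refine ⟨max N N', fun M hM => ?_⟩
      rw [map_add, map_add, hN M (le_trans (le_max_left _ _) hM),
        hN' M (le_trans (le_max_right _ _) hM)]
    | smul c x _ hx =>
      obtain ⟨N, hN⟩ := hx
      exact ⟨N, fun M hM => by rw [map_smul, map_smul, hN M hM]⟩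
  obtain ⟨N, hN⟩ := hlim z
  rw [hN N le_rfl, convGeom_apply]
  exact Q.sum_mem fun k _ => hpow k z hz

end Antipode

section SemiringAntipode

variable {K X S : Type*} [Field K] [Semiring X] [Algebra K X] [Coalgebra K X]
  (b : Module.Basis S K X) {deg : S → ℕ} {C : S → Finset (S × S)}
  (hC : ∀ σ, CoalgebraStruct.comul (R := K) (b σ) = ∑ p ∈ C σ, b p.1 ⊗ₜ[K] b p.2)
  (hdeg : ∀ σ, ∀ p ∈ C σ, deg p.1 + deg p.2 = deg σ)
  (h0 : ∀ σ, deg σ = 0 → b σ = algebraMap K X (CoalgebraStruct.counit (R := K) (b σ)))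

include hC hdeg h0 in
-- The scalar `-1` supplies the subtraction that the defect requires.
theorem exists_isAntipode_of_comul : ∃ T : X →ₗ[K] X, IsAntipode K T := by
  let : Ring X := Algebra.semiringToRing K
  exact (exists_isAntipode_basis b hC hdeg h0).imp fun _ h => h.1

include hC hdeg h0 in
theorem isHopfSubalgebra_of_comul {Q : Subalgebra K X}
    (hQ : ∀ z ∈ Q, CoalgebraStruct.comul (R := K) z ∈
      LinearMap.range (TensorProduct.map Q.val.toLinearMap Q.val.toLinearMap)) :
    IsHopfSubalgebra K Q := by
  let : Ring X := Algebra.semiringToRing K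
  exact isHopfSubalgebra_of_ring b hC hdeg h0 hQ

end SemiringAntipode

/-! ### Products of linear forms -/

section TensorEval

variable {K M N P : Type*} [Field K] [AddCommMonoid M] [Module K M] [AddCommMonoid N]
  [Module K N] [AddCommMonoid P] [Module K P]

/-- The linear form `x ⊗ y ↦ f(x) g(y)`. -/
def tensorEval (f : M →ₗ[K] K) (g : N →ₗ[K] K) : M ⊗[K] N →ₗ[K] K :=
  LinearMap.mul' K K ∘ₗ TensorProduct.map f g

@[simp] theorem tensorEval_tmul (f : M →ₗ[K] K) (g : N →ₗ[K] K) (x : M) (y : N) :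
    tensorEval f g (x ⊗ₜ y) = f x * g y := rfl

theorem coord_tensorProduct {S S' : Type*} (F : Module.Basis S K M) (F' : Module.Basis S' K N)
    (i : S) (j : S') :
    (F.tensorProduct F').coord (i, j) = tensorEval (F.coord i) (F'.coord j) := by
  refine TensorProduct.ext' fun x y => ?_
  rw [Module.Basis.coord_apply, Module.Basis.tensorProduct_repr_tmul_apply, tensorEval_tmul]
  simp [mul_comm]

theorem tensorEval_assoc (f : M →ₗ[K] K) (g : N →ₗ[K] K) (h : P →ₗ[K] K)
    (t : (M ⊗[K] N) ⊗[K] P) : tensorEval f (tensorEval g h) (TensorProduct.assoc K M N P t) =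
      tensorEval (tensorEval f g) h t := by
  have : tensorEval f (tensorEval g h) ∘ₗ (TensorProduct.assoc K M N P).toLinearMap =
      tensorEval (tensorEval f g) h :=
    TensorProduct.ext_threefold fun x y z => by simp [mul_assoc]
  exact LinearMap.congr_fun this t

theorem tensorEval_rTensor (δ : M →ₗ[K] P) (f : P →ₗ[K] K) (g : N →ₗ[K] K) (t : M ⊗[K] N) :
    tensorEval f g (δ.rTensor N t) = tensorEval (f ∘ₗ δ) g t := by
  have : tensorEval f g ∘ₗ δ.rTensor N = tensorEval (f ∘ₗ δ) g :=
    TensorProduct.ext' fun x y => rfl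
  exact LinearMap.congr_fun this t

theorem tensorEval_lTensor (δ : N →ₗ[K] P) (f : M →ₗ[K] K) (g : P →ₗ[K] K) (t : M ⊗[K] N) :
    tensorEval f g (δ.lTensor M t) = tensorEval f (g ∘ₗ δ) t := by
  have : tensorEval f g ∘ₗ δ.lTensor M = tensorEval f (g ∘ₗ δ) :=
    TensorProduct.ext' fun x y => rfl
  exact LinearMap.congr_fun this t

theorem apply_lid_rTensor (e : M →ₗ[K] K) (f : N →ₗ[K] K) (t : M ⊗[K] N) :
    f (TensorProduct.lid K N (e.rTensor N t)) = tensorEval e f t := by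
  have : f ∘ₗ (TensorProduct.lid K N).toLinearMap ∘ₗ e.rTensor N = tensorEval e f :=
    TensorProduct.ext' fun x y => by simp
  exact LinearMap.congr_fun this t

theorem apply_rid_lTensor (e : N →ₗ[K] K) (f : M →ₗ[K] K) (t : M ⊗[K] N) :
    f (TensorProduct.rid K M (e.lTensor M t)) = tensorEval f e t := by
  have : f ∘ₗ (TensorProduct.rid K M).toLinearMap ∘ₗ e.lTensor M = tensorEval f e :=
    TensorProduct.ext' fun x y => by simp [mul_comm]
  exact LinearMap.congr_fun this t

end TensorEval

/-! ### Coalgebra structures on duals -/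

section Dual

variable {K X S : Type*} [Field K] [Ring X] [Algebra K X] [Coalgebra K X]
  (D : Subalgebra K (WithConv (X →ₗ[K] K)))

/-- The value at `x` of the elements of `D`. -/
def evalAt (x : X) : D →ₗ[K] K := (toDual D).flip x

/-- The value at `x ⊗ y` of the elements of `D ⊗ D`. -/
def evalAt₂ (x y : X) : D ⊗[K] D →ₗ[K] K := tensorEval (evalAt D x) (evalAt D y)

variable {D}

theorem evalAt_apply (x : X) (z : D) : evalAt D x z = toDual D z x := rfl

theorem evalAt_eq (x : X) (z : D) : evalAt D x z = z.1.ofConv x := rfl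

@[simp] theorem evalAt₂_tmul (x y : X) (z z' : D) :
    evalAt₂ D x y (z ⊗ₜ z') = evalAt D x z * evalAt D y z' := rfl

theorem dualPairing_tmul (t : D ⊗[K] D) (x y : X) :
    dualPairing D t (x ⊗ₜ[K] y) = evalAt₂ D x y t := by
  induction t using TensorProduct.induction_on with
  | zero => simp
  | tmul z z' => simp [dualPairing, evalAt_apply]
  | add s t hs ht => rw [map_add, map_add, LinearMap.add_apply, hs, ht]

theorem evalAt_one (x : X) : evalAt D x 1 = CoalgebraStruct.counit (R := K) x := by
  rw [evalAt_eq]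
  rfl

theorem evalAt_mul {ι : Type*} {x : X} (r : Coalgebra.Repr K x ι) (z z' : D) : evalAt D x (z * z') =
    ∑ i ∈ r.index, evalAt D (r.left i) z * evalAt D (r.right i) z' :=
  r.convMul_apply z.1 z'.1

theorem evalAt₂_mul {ι κ : Type*} {x y : X} (r : Coalgebra.Repr K x ι) (r' : Coalgebra.Repr K y κ)
    (s t : D ⊗[K] D) : evalAt₂ D x y (s * t) = ∑ i ∈ r.index, ∑ j ∈ r'.index,
      evalAt₂ D (r.left i) (r'.left j) s * evalAt₂ D (r.right i) (r'.right j) t := by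
  induction s using TensorProduct.induction_on with
  | zero => simp
  | add s s' hs hs' => simp only [add_mul, map_add, hs, hs', Finset.sum_add_distrib]
  | tmul a c =>
    induction t using TensorProduct.induction_on with
    | zero => simp
    | add s s' hs hs' => simp only [mul_add, map_add, hs, hs', Finset.sum_add_distrib]
    | tmul a' c' =>
      simp only [Algebra.TensorProduct.tmul_mul_tmul, evalAt₂_tmul, evalAt_mul r, evalAt_mul r',
        Finset.sum_mul_sum]
      exact Finset.sum_congr rfl fun i _ => Finset.sum_congr rfl fun j _ => by ring

variable (b : Module.Basis S K X) (F : Module.Basis S K D)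
  (hF : ∀ σ, toDual D (F σ) = b.coord σ)

include hF in
theorem evalAt_basis (σ : S) : evalAt D (b σ) = F.coord σ := by
  classical
  refine F.ext fun τ => ?_
  rw [evalAt_apply, hF, Module.Basis.coord_apply, Module.Basis.coord_apply, b.repr_self, F.repr_self,
    Finsupp.single_apply, Finsupp.single_apply]
  exact if_congr eq_comm rfl rfl

include hF in
theorem evalAt_basis_basis [DecidableEq S] (σ τ : S) :
    evalAt D (b σ) (F τ) = if σ = τ then 1 else 0 := by
  rw [evalAt_apply, hF, Module.Basis.coord_apply, b.repr_self, Finsupp.single_apply]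

include b F hF in
theorem eq_of_evalAt {z z' : D} (h : ∀ σ, evalAt D (b σ) z = evalAt D (b σ) z') : z = z' := by
  refine F.ext_elem fun σ => ?_
  simpa [evalAt_basis b F hF] using h σ

include b F hF in
-- The values at `b σ ⊗ b τ` are the coordinates in the basis `F ⊗ F`.
theorem eq_of_evalAt₂ {t t' : D ⊗[K] D}
    (h : ∀ σ τ, evalAt₂ D (b σ) (b τ) t = evalAt₂ D (b σ) (b τ) t') : t = t' := by
  refine (F.tensorProduct F).ext_elem fun ⟨σ, τ⟩ => ?_
  rw [← Module.Basis.coord_apply, ← Module.Basis.coord_apply, coord_tensorProduct,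
    ← evalAt_basis b F hF, ← evalAt_basis b F hF]
  exact h σ τ

include b F hF in
theorem eq_of_evalAt₃ {t t' : D ⊗[K] (D ⊗[K] D)}
    (h : ∀ x y w, tensorEval (evalAt D x) (evalAt₂ D y w) t =
      tensorEval (evalAt D x) (evalAt₂ D y w) t') : t = t' := by
  refine (F.tensorProduct (F.tensorProduct F)).ext_elem fun ⟨σ, τ, υ⟩ => ?_
  rw [← Module.Basis.coord_apply, ← Module.Basis.coord_apply, coord_tensorProduct,
    coord_tensorProduct, ← evalAt_basis b F hF, ← evalAt_basis b F hF, ← evalAt_basis b F hF]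
  exact h _ _ _

section Comul

variable (δ : D →ₗ[K] D ⊗[K] D) (hδ : ∀ x y, evalAt₂ D x y ∘ₗ δ = evalAt D (x * y))

/-- The coalgebra structure on `D` transposed from the product of `X`. -/
abbrev dualCoalgebra : Coalgebra K D where
  comul := δ
  counit := evalAt D 1
  coassoc := by
    -- Against `x ⊗ y ⊗ w` the two sides are the values of `z` at `(x * y) * w` and `x * (y * w)`.
    refine LinearMap.ext fun z => eq_of_evalAt₃ b F hF fun x y w => ?_
    rw [evalAt₂]
    simp only [LinearMap.comp_apply, LinearEquiv.coe_coe]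
    rw [tensorEval_assoc, tensorEval_rTensor, tensorEval_lTensor, ← evalAt₂, ← evalAt₂, hδ, hδ,
      ← evalAt₂, ← evalAt₂, ← LinearMap.comp_apply, ← LinearMap.comp_apply, hδ, hδ, mul_assoc]
  rTensor_counit_comp_comul := by
    refine LinearMap.ext fun z => (TensorProduct.lid K D).injective ?_
    refine eq_of_evalAt b F hF fun σ => ?_
    rw [LinearMap.comp_apply, apply_lid_rTensor, ← evalAt₂, ← LinearMap.comp_apply, hδ, one_mul,
      TensorProduct.mk_apply, TensorProduct.lid_tmul, one_smul]
  lTensor_counit_comp_comul := by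
    refine LinearMap.ext fun z => (TensorProduct.rid K D).injective ?_
    refine eq_of_evalAt b F hF fun σ => ?_
    rw [LinearMap.comp_apply, apply_rid_lTensor, ← evalAt₂, ← LinearMap.comp_apply, hδ, mul_one,
      LinearMap.flip_apply, TensorProduct.mk_apply, TensorProduct.rid_tmul, one_smul]

include b F hF hδ in
-- At `b σ ⊗ b τ` both sides are the value of `z ⊗ z'` at the coproduct of `b σ * b τ`, expanded
-- through multiplicativity of the coproduct of `X`.
theorem dual_comul_mul (hX : ∀ x y : X, CoalgebraStruct.comul (R := K) (x * y) =
    CoalgebraStruct.comul (R := K) x * CoalgebraStruct.comul (R := K) y) (z z' : D) :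
    δ (z * z') = δ z * δ z' := by
  refine eq_of_evalAt₂ b F hF fun σ τ => ?_
  let r := Coalgebra.Repr.arbitrary K (b σ)
  let r' := Coalgebra.Repr.arbitrary K (b τ)
  have hδ' : ∀ x y z, evalAt₂ D x y (δ z) = evalAt D (x * y) z := fun x y z =>
    LinearMap.congr_fun (hδ x y) z
  rw [hδ', evalAt₂_mul r r']
  simp only [hδ']
  rw [evalAt_eq, Subalgebra.coe_mul, LinearMap.convMul_apply, hX, ← r.eq, ← r'.eq, Finset.sum_mul_sum]
  simp only [map_sum, Algebra.TensorProduct.tmul_mul_tmul, TensorProduct.map_tmul,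
    LinearMap.mul'_apply]
  rfl

include b F hF hδ in
theorem dual_comul_one (hX : ∀ x y : X, CoalgebraStruct.counit (R := K) (x * y) =
      CoalgebraStruct.counit (R := K) x * CoalgebraStruct.counit (R := K) y) :
    δ 1 = 1 := by
  refine eq_of_evalAt₂ b F hF fun σ τ => ?_
  rw [← LinearMap.comp_apply, hδ, evalAt_one, hX, Algebra.TensorProduct.one_def, evalAt₂_tmul, evalAt_one, evalAt_one]

theorem dual_counit_mul (hX : CoalgebraStruct.comul (R := K) (1 : X) = 1) (z z' : D) :
    evalAt D 1 (z * z') = evalAt D 1 z * evalAt D 1 z' := by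
  rw [evalAt_eq, Subalgebra.coe_mul, LinearMap.convMul_apply, hX, Algebra.TensorProduct.one_def,
    TensorProduct.map_tmul, LinearMap.mul'_apply]
  rfl

end Comul

end Dual

/-! ### Sylvester classes and the product of the `G` -/

/-- Letters occur at most `m` times and in multiples of `m`, so exactly `m` times;
`lt_of_lt_of_count` then applies in both directions and the relabelling is strictly increasing. -/
theorem exists_strictMono_map {m : ℕ} (hm : 1 ≤ m) {u : List ℕ} {α : StutPerm m}
    (hu : IsStutWord m u) (hle : ∀ a, u.count a ≤ m) (h : HasMStd u α) :
    ∃ f : ℕ → ℕ, u = α.word.map f ∧ ∀ a ∈ α.word, ∀ b ∈ α.word, (a ≤ b ↔ f a ≤ f b) := by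
  obtain ⟨f, rfl, hf⟩ := h.exists_map hm hu
  refine ⟨f, rfl, fun a ha b hb => ?_⟩
  have key := lt_of_lt_of_count (hasMStd_iff.1 h).symm α.isStutWord fun c hc =>
    le_antisymm (hle c) (Nat.le_of_dvd (List.count_pos_iff.2 hc) (hu c))
  have hmem : ∀ c ∈ α.word, (c, f c) ∈ α.word.zip (α.word.map f) := fun c hc => by
    rw [List.zip_map_right]
    refine List.mem_map.2 ⟨(c, c), ?_, rfl⟩
    obtain ⟨i, hi, rfl⟩ := List.getElem_of_mem hc
    exact List.mem_iff_getElem.2 ⟨i, by simpa using hi, by simp⟩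
  rw [← not_lt, ← not_lt]
  exact not_congr ⟨fun h => key _ (hmem b hb) _ (hmem a ha) h, fun h => hf b hb a ha h⟩

theorem exists_maps_of_mem_prodSet {m : ℕ} (hm : 1 ≤ m) {α β ν : StutPerm m}
    (h : ν ∈ prodSet α β) : ∃ f g : ℕ → ℕ, ν.word = α.word.map f ++ β.word.map g ∧
      (∀ a ∈ α.word, ∀ b ∈ α.word, (a ≤ b ↔ f a ≤ f b)) ∧
      (∀ a ∈ β.word, ∀ b ∈ β.word, (a ≤ b ↔ g a ≤ g b)) := by
  obtain ⟨u, v, huv, hu, hv, hα, hβ⟩ := h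
  have hcount : ∀ a, u.count a + v.count a ≤ m := fun a => by
    rw [← List.count_append, ← huv, ν.count_word hm]
    split_ifs <;> omega
  obtain ⟨f, rfl, hf⟩ := exists_strictMono_map hm hu
    (fun a => (Nat.le_add_right _ _).trans (hcount a)) hα
  obtain ⟨g, rfl, hg⟩ := exists_strictMono_map hm hv
    (fun a => (Nat.le_add_left _ _).trans (hcount a)) hβ
  exact ⟨f, g, huv, hf, hg⟩

/-- The relabellings `f`, `g` of the two factors are kept and `α`, `β` replaced by permutations with
the same search trees. Search trees follow increasing relabellings and are compatible with
concatenation. -/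
theorem exists_mem_prodSet_of_toTree_eq {m : ℕ} (hm : 1 ≤ m) {α α' β β' ν : StutPerm m}
    (hα : α.toTree hm = α'.toTree hm) (hβ : β.toTree hm = β'.toTree hm) (h : ν ∈ prodSet α β) :
    ∃ ν' ∈ prodSet α' β', ν'.toTree hm = ν.toTree hm ∧ ∃ f g : ℕ → ℕ,
      ν.word = α.word.map f ++ β.word.map g ∧ ν'.word = α'.word.map f ++ β'.word.map g := by
  obtain ⟨f, g, hν, hf, hg⟩ := exists_maps_of_mem_prodSet hm h
  obtain ⟨hpα, hbα⟩ := StutPerm.bst_eq_of_toTree_eq hm hα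
  obtain ⟨hpβ, hbβ⟩ := StutPerm.bst_eq_of_toTree_eq hm hβ
  have hf' : ∀ a ∈ α'.word, ∀ b ∈ α'.word, (a ≤ b ↔ f a ≤ f b) := fun a ha b hb =>
    hf a (hpα.mem_iff.2 ha) b (hpα.mem_iff.2 hb)
  have hg' : ∀ a ∈ β'.word, ∀ b ∈ β'.word, (a ≤ b ↔ g a ≤ g b) := fun a ha b hb =>
    hg a (hpβ.mem_iff.2 ha) b (hpβ.mem_iff.2 hb)
  let ν' : StutPerm m := ⟨α'.word.map f ++ β'.word.map g, ν.size,
    ((hpα.map f).symm.append (hpβ.map g).symm).trans (hν ▸ ν.perm_size hm)⟩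
  refine ⟨ν', ⟨_, _, rfl, α'.isStutWord.map f, β'.isStutWord.map g,
    hasMStd_iff.2 (sameStd_map _ _ hf').symm, hasMStd_iff.2 (sameStd_map _ _ hg').symm⟩, ?_,
    f, g, hν, rfl⟩
  refine Subtype.ext (congrArg (fun t => mirror (shape t)) ?_)
  change bst (α'.word.map f ++ β'.word.map g) = bst ν.word
  rw [hν]
  refine bst_append_congr ?_ ?_
  · rw [bst_map f _ hf', bst_map f _ hf, hbα]
  · rw [bst_map g _ hg', bst_map g _ hg, hbβ]

open Classical in
theorem card_prodSet_le {m : ℕ} (hm : 1 ≤ m) {α α' β β' : StutPerm m}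
    (hα : α.toTree hm = α'.toTree hm) (hβ : β.toTree hm = β'.toTree hm) (T : MBinTree m) :
    ((finite_prodSet hm α β).toFinset.filter fun ν => ν.toTree hm = T).card ≤
      ((finite_prodSet hm α' β').toFinset.filter fun ν => ν.toTree hm = T).card := by
  have hpα := (StutPerm.bst_eq_of_toTree_eq hm hα).1
  have hpβ := (StutPerm.bst_eq_of_toTree_eq hm hβ).1
  refine Finset.card_le_card_of_forall_subsingleton
    (fun ν ν' => ∃ f g : ℕ → ℕ, ν.word = α.word.map f ++ β.word.map g ∧
      ν'.word = α'.word.map f ++ β'.word.map g) ?_ ?_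
  · intro ν hν
    simp only [Finset.mem_filter, Set.Finite.mem_toFinset] at hν
    obtain ⟨ν', h1, h2, h3⟩ := exists_mem_prodSet_of_toTree_eq hm hα hβ hν.1
    refine ⟨ν', ?_, h3⟩
    simp only [Finset.mem_filter, Set.Finite.mem_toFinset]
    exact ⟨h1, h2.trans hν.2⟩
  · rintro ν' - ν₁ ⟨-, f₁, g₁, h1, h1'⟩ ν₂ ⟨-, f₂, g₂, h2, h2'⟩
    -- The values of `f` and `g` on the letters are read off from `ν'`, so `ν'` determines `ν`.
    obtain ⟨ef, eg⟩ := List.append_inj (h1'.symm.trans h2') (by simp)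
    refine StutPerm.ext ?_
    rw [h1, h2]
    congr 1
    · exact List.map_congr_left fun a ha => List.map_inj_left.1 ef a (hpα.mem_iff.1 ha)
    · exact List.map_congr_left fun a ha => List.map_inj_left.1 eg a (hpβ.mem_iff.1 ha)

/-! ### Iterated cuts of a permutation. -/

namespace StutPerm

variable {m : ℕ}

theorem low_low (hm : 1 ≤ m) (σ : StutPerm m) {j k : ℕ} (h : j ≤ k) :
    (σ.low hm k).low hm j = σ.low hm j := by
  refine ext ?_
  simp only [word_low, List.filter_filter]
  refine List.filter_congr fun a _ => ?_
  simp only [← Bool.decide_and, decide_eq_decide]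
  omega

theorem high_low (hm : 1 ≤ m) (σ : StutPerm m) (j k : ℕ) :
    (σ.low hm k).high hm j = (σ.high hm j).low hm (k - j) := by
  refine ext ?_
  simp only [word_low, word_high, List.filter_map, List.filter_filter]
  congr 1
  refine List.filter_congr fun a _ => ?_
  simp only [Function.comp_apply, ← Bool.decide_and, decide_eq_decide]
  omega

theorem high_high (hm : 1 ≤ m) (σ : StutPerm m) (j i : ℕ) :
    (σ.high hm j).high hm i = σ.high hm (j + i) := by
  refine ext ?_
  simp only [word_high, List.filter_map, List.filter_filter, List.map_map]
  refine Eq.trans (List.map_congr_left fun a _ => ?_) (congrArg _ (List.filter_congr fun a _ => ?_))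
  · simp only [Function.comp_apply]
    omega
  · simp only [Function.comp_apply, ← Bool.decide_and, decide_eq_decide]
    omega

theorem low_size (hm : 1 ≤ m) (σ : StutPerm m) : σ.low hm σ.size = σ := by
  refine ext (List.filter_eq_self.2 fun a ha => ?_)
  simpa using ((σ.mem_word hm a).1 ha).2

theorem high_zero (hm : 1 ≤ m) (σ : StutPerm m) : σ.high hm 0 = σ := by
  refine ext ?_
  rw [word_high, (List.filter_eq_self (p := fun a => decide (0 < a))).2 fun a ha =>
    decide_eq_true ((σ.mem_word hm a).1 ha).1]
  simp

theorem eq_empty_iff (hm : 1 ≤ m) (σ : StutPerm m) : σ = empty m ↔ σ.size = 0 :=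
  ⟨fun h => by rw [h, size_empty], eq_empty_of_size hm⟩

theorem finite_size_le (hm : 1 ≤ m) (n : ℕ) : {σ : StutPerm m | σ.size ≤ n}.Finite := by
  refine ((Set.finite_Iic n).biUnion fun k _ => finite_size hm k).subset fun σ hσ => ?_
  exact Set.mem_biUnion (show σ.size ∈ Set.Iic n from hσ) rfl

end StutPerm

theorem finite_factorisations {m : ℕ} (hm : 1 ≤ m) (ν : StutPerm m) :
    {p : StutPerm m × StutPerm m | ν ∈ prodSet p.1 p.2}.Finite := by
  refine ((StutPerm.finite_size_le hm ν.size).prod (StutPerm.finite_size_le hm ν.size)).subset ?_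
  intro p hp
  have := size_of_mem_prodSet hm hp
  exact ⟨show p.1.size ≤ ν.size by omega, show p.2.size ≤ ν.size by omega⟩

theorem size_add_of_mem_coprodSet {m : ℕ} (hm : 1 ≤ m) {σ : StutPerm m}
    {p : StutPerm m × StutPerm m} (hp : p ∈ coprodSet σ) : p.1.size + p.2.size = σ.size := by
  obtain ⟨k, -, rfl⟩ := (mem_coprodSet hm).1 hp
  exact σ.size_low_add_size_high hm k

theorem finite_coprodSet_fibre {m : ℕ} (hm : 1 ≤ m) (p : StutPerm m × StutPerm m) :
    {ν : StutPerm m | p ∈ coprodSet ν}.Finite :=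
  (StutPerm.finite_size hm (p.1.size + p.2.size)).subset fun _ hν =>
    (size_add_of_mem_coprodSet hm hν).symm

theorem eq_of_mem_coprodSet {m : ℕ} (hm : 1 ≤ m) {σ : StutPerm m} {p q : StutPerm m × StutPerm m}
    (hp : p ∈ coprodSet σ) (hq : q ∈ coprodSet σ) (h : p.1.size = q.1.size) : p = q := by
  obtain ⟨k, hk, rfl⟩ := (mem_coprodSet hm).1 hp
  obtain ⟨l, hl, rfl⟩ := (mem_coprodSet hm).1 hq
  rw [Finset.mem_range, Nat.lt_succ_iff] at hk hl
  rw [σ.size_low hm k hk, σ.size_low hm l hl] at h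
  rw [h]

/-! ### The bialgebra `FQSym^{(m)}` -/

section FQSym

variable {K A : Type*} [Field K] [LinearOrder A] [Infinite A] {m : ℕ} (hm : 1 ≤ m)

/-- The coefficient of a word. -/
def coeffAt (w : List A) : NCSeries K A →ₗ[K] K where
  toFun f := f w
  map_add' _ _ := rfl
  map_smul' _ _ := rfl

omit [LinearOrder A] [Infinite A] in
theorem coeffAt_apply (w : List A) (f : NCSeries K A) : coeffAt w f = f w := rfl

/-- A word with `m`-standardisation `σ`. -/
def wordOf (A : Type*) [LinearOrder A] [Infinite A] (σ : StutPerm m) : List A :=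
  (exists_word A hm σ).choose

open Classical in
-- One word per permutation gives forms dual to the `G`: they yield linear independence, and later
-- the injectivity of `realizeTensor`.
theorem coeffAt_wordOf_G (σ τ : StutPerm m) :
    coeffAt (wordOf hm A σ) (G K A τ) = if σ = τ then 1 else 0 := by
  rw [coeffAt_apply, G_apply]
  have h := (exists_word A hm σ).choose_spec
  refine if_congr ⟨fun h' => h.2.unique hm h'.2, ?_⟩ rfl rfl
  rintro rfl
  exact h

include hm in
variable (K A m) in
theorem exists_basis_FQSym : ∃ b : Module.Basis (StutPerm m) K (FQSym K A m),
    ∀ σ, (b σ : NCSeries K A) = G K A σ := by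
  classical
  refine exists_basis_adjoin (fun σ : StutPerm m => G K A σ) ?_ ?_ fun σ μ => ?_
  · refine linearIndependent_of_dual _ (fun σ => coeffAt (wordOf hm A σ)) ?_ ?_
    · exact fun σ τ h => (coeffAt_wordOf_G hm σ τ).trans (if_neg h)
    · exact fun σ => (coeffAt_wordOf_G hm σ σ).trans (if_pos rfl)
  · rw [← G_empty K A m]
    exact Submodule.subset_span ⟨_, rfl⟩
  · rw [G_mul_G K A hm]
    exact sum_mem fun ν _ => Submodule.subset_span ⟨ν, rfl⟩

variable {b : Module.Basis (StutPerm m) K (FQSym K A m)}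
  (hb : ∀ σ, (b σ : NCSeries K A) = G K A σ)

include hb in
theorem basis_mul_basis (σ μ : StutPerm m) :
    b σ * b μ = ∑ ν ∈ (finite_prodSet hm σ μ).toFinset, b ν :=
  mul_eq_sum_of_coe hb (G_mul_G K A hm σ μ)

omit [Infinite A] in
include hb in
theorem basis_empty : b (StutPerm.empty m) = 1 :=
  Subtype.ext ((hb _).trans (G_empty K A m))

end FQSym

/-! ### The coalgebra structure given by cuts. -/

section Coalgebra

variable {K X : Type*} [Field K] [Ring X] [Algebra K X] {m : ℕ} (hm : 1 ≤ m)
  (b : Module.Basis (StutPerm m) K X)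

/-- The coproduct given by the splittings of the set of letters. -/
def splitComul : X →ₗ[K] X ⊗[K] X :=
  b.constr K fun σ => ∑ k ∈ Finset.range (σ.size + 1), b (σ.low hm k) ⊗ₜ[K] b (σ.high hm k)

theorem splitComul_basis (σ : StutPerm m) : splitComul hm b (b σ) =
    ∑ k ∈ Finset.range (σ.size + 1), b (σ.low hm k) ⊗ₜ[K] b (σ.high hm k) :=
  b.constr_basis _ _ _

open Classical in
/-- The coefficient of the empty permutation. -/
def splitCounit : X →ₗ[K] K := b.constr K fun σ => if σ = StutPerm.empty m then 1 else 0

open Classical in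
theorem splitCounit_basis (σ : StutPerm m) :
    splitCounit b (b σ) = if σ = StutPerm.empty m then 1 else 0 :=
  b.constr_basis _ _ _

/-- Two cuts `j ≤ k` are recorded as the first cut `j` and the distance `k - j` to the second. -/
theorem sum_range_sum_range_succ {M : Type*} [AddCommMonoid M] (n : ℕ) (f : ℕ → ℕ → M) :
    ∑ k ∈ Finset.range (n + 1), ∑ j ∈ Finset.range (k + 1), f j (k - j) =
      ∑ j ∈ Finset.range (n + 1), ∑ i ∈ Finset.range (n - j + 1), f j i := by
  rw [Finset.sum_sigma', Finset.sum_sigma']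
  refine Finset.sum_bij' (fun p _ => ⟨p.2, p.1 - p.2⟩) (fun p _ => ⟨p.1 + p.2, p.1⟩) ?_ ?_ ?_ ?_ ?_
  · rintro ⟨i, j⟩ hp
    simp only [Finset.mem_sigma, Finset.mem_range] at hp ⊢
    omega
  · rintro ⟨i, j⟩ hp
    simp only [Finset.mem_sigma, Finset.mem_range] at hp ⊢
    omega
  · rintro ⟨i, j⟩ hp
    simp only [Finset.mem_sigma, Finset.mem_range] at hp
    simp only [Sigma.mk.injEq, heq_eq_eq, and_true]
    omega
  · rintro ⟨i, j⟩ hp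
    simp only [Sigma.mk.injEq, heq_eq_eq, true_and]
    omega
  · rintro ⟨i, j⟩ _
    rfl

/-- The coalgebra structure given by the splittings of the set of letters. -/
abbrev splitCoalgebra : Coalgebra K X where
  comul := splitComul hm b
  counit := splitCounit b
  coassoc := by
    refine b.ext fun σ => ?_
    simp only [LinearMap.comp_apply, LinearEquiv.coe_coe, splitComul_basis, map_sum,
      LinearMap.rTensor_tmul, LinearMap.lTensor_tmul, TensorProduct.sum_tmul,
      TensorProduct.tmul_sum, TensorProduct.assoc_tmul]
    -- Cutting twice in either order gives the same three pieces: letters `≤ j`, letters between `j`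
    -- and `k`, letters `> k`.
    have h1 : ∀ k ∈ Finset.range (σ.size + 1),
        (∑ j ∈ Finset.range ((σ.low hm k).size + 1), b ((σ.low hm k).low hm j) ⊗ₜ[K]
          (b ((σ.low hm k).high hm j) ⊗ₜ[K] b (σ.high hm k))) =
        ∑ j ∈ Finset.range (k + 1), b (σ.low hm j) ⊗ₜ[K]
          (b ((σ.high hm j).low hm (k - j)) ⊗ₜ[K] b ((σ.high hm j).high hm (k - j))) := by
      intro k hk
      rw [Finset.mem_range, Nat.lt_succ_iff] at hk
      rw [σ.size_low hm k hk]
      refine Finset.sum_congr rfl fun j hj => ?_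
      rw [Finset.mem_range, Nat.lt_succ_iff] at hj
      rw [σ.low_low hm hj, σ.high_low, σ.high_high, Nat.add_sub_cancel' hj]
    rw [Finset.sum_congr rfl h1, sum_range_sum_range_succ σ.size fun j i => b (σ.low hm j) ⊗ₜ[K]
          (b ((σ.high hm j).low hm i) ⊗ₜ[K] b ((σ.high hm j).high hm i))]
    refine Finset.sum_congr rfl fun j hj => ?_
    rw [Finset.mem_range, Nat.lt_succ_iff] at hj
    rw [σ.size_high hm j hj]
  rTensor_counit_comp_comul := by
    refine b.ext fun σ => ?_
    rw [LinearMap.comp_apply, splitComul_basis, map_sum, Finset.sum_eq_single 0]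
    · rw [LinearMap.rTensor_tmul, splitCounit_basis, if_pos, σ.high_zero]
      · rfl
      · rw [StutPerm.eq_empty_iff hm, σ.size_low hm 0 (Nat.zero_le _)]
    · intro k hk hk0
      rw [Finset.mem_range, Nat.lt_succ_iff] at hk
      rw [LinearMap.rTensor_tmul, splitCounit_basis, if_neg, TensorProduct.zero_tmul]
      rwa [StutPerm.eq_empty_iff hm, σ.size_low hm k hk]
    · intro h
      simp at h
  lTensor_counit_comp_comul := by
    refine b.ext fun σ => ?_
    rw [LinearMap.comp_apply, splitComul_basis, map_sum, Finset.sum_eq_single σ.size]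
    · rw [LinearMap.lTensor_tmul, splitCounit_basis, if_pos, σ.low_size]
      · rfl
      · rw [StutPerm.eq_empty_iff hm, σ.size_high hm _ le_rfl, Nat.sub_self]
    · intro k hk hk0
      rw [Finset.mem_range, Nat.lt_succ_iff] at hk
      rw [LinearMap.lTensor_tmul, splitCounit_basis, if_neg, TensorProduct.tmul_zero]
      rw [StutPerm.eq_empty_iff hm, σ.size_high hm k hk]
      omega
    · intro h
      simp at h

theorem map_mul_of_basis {Y S : Type*} [Ring Y] [Algebra K Y] (c : Module.Basis S K X)
    (f : X →ₗ[K] Y) (h : ∀ σ μ, f (c σ * c μ) = f (c σ) * f (c μ)) (x y : X) :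
    f (x * y) = f x * f y := by
  have : (LinearMap.mul K X).compr₂ f = (LinearMap.mul K Y).compl₁₂ f f :=
    c.ext fun σ => c.ext fun μ => h σ μ
  exact LinearMap.congr_fun₂ this x y

end Coalgebra

/-! ### The coproduct as an algebra morphism, via the doubled alphabet. -/

section Realization

variable {K A : Type*} [Field K] [LinearOrder A] [Infinite A] {m : ℕ} (hm : 1 ≤ m)
  {b : Module.Basis (StutPerm m) K (FQSym K A m)} (hb : ∀ σ, (b σ : NCSeries K A) = G K A σ)

omit [Infinite A] in
theorem realizeTensor_tmul (x y : FQSym K A m) :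
    realizeTensor K A m (x ⊗ₜ y) = seriesTensor K A A x y := rfl

include hb hm in
-- The coordinates of a tensor are coefficients of its realisation, at the words `wordOf`.
theorem realizeTensor_injective : Function.Injective (realizeTensor K A m) := by
  classical
  have hcoord : ∀ σ, b.coord σ = coeffAt (wordOf hm A σ) ∘ₗ (FQSym K A m).val.toLinearMap := by
    refine fun σ => b.ext fun τ => ?_
    rw [LinearMap.comp_apply, AlgHom.toLinearMap_apply, Subalgebra.coe_val, hb, coeffAt_wordOf_G,
      Module.Basis.coord_apply, b.repr_self, Finsupp.single_apply]
    exact if_congr eq_comm rfl rfl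
  have key : ∀ t σ τ, (b.tensorProduct b).coord (σ, τ) t =
      realizeTensor K A m t (wordOf hm A σ) (wordOf hm A τ) := by
    intro t σ τ
    rw [coord_tensorProduct, hcoord, hcoord]
    induction t using TensorProduct.induction_on with
    | zero => rw [map_zero, map_zero]; rfl
    | tmul x y => rfl
    | add s t hs ht => rw [map_add, map_add, hs, ht]; rfl
  intro s t hst
  refine (b.tensorProduct b).ext_elem fun ⟨σ, τ⟩ => ?_
  rw [← Module.Basis.coord_apply, ← Module.Basis.coord_apply, key, key, hst]

omit [Infinite A] in
theorem realizeTensor_mul (s t : (FQSym K A m) ⊗[K] (FQSym K A m)) :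
    realizeTensor K A m (s * t) = pairMul (realizeTensor K A m s) (realizeTensor K A m t) := by
  induction s using TensorProduct.induction_on with
  | zero => rw [zero_mul, map_zero, zero_pairMul]
  | add s s' hs hs' => rw [add_mul, map_add, map_add, hs, hs', pairMul_add_left]
  | tmul x y =>
    induction t using TensorProduct.induction_on with
    | zero => rw [mul_zero, map_zero, pairMul_zero]
    | add s s' hs hs' => rw [mul_add, map_add, map_add, hs, hs', pairMul_add_right]
    | tmul x' y' =>
      rw [Algebra.TensorProduct.tmul_mul_tmul, realizeTensor_tmul, realizeTensor_tmul,
        realizeTensor_tmul, ← seriesTensor_mul]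
      rfl

omit [Infinite A] in
include hb in
theorem realizeTensor_splitComul (σ : StutPerm m) :
    realizeTensor K A m (splitComul hm b (b σ)) = separate (G K (A ⊕ₗ A) σ) := by
  rw [splitComul_basis, map_sum, separate_G K A A hm]
  exact Finset.sum_congr rfl fun k _ => by rw [realizeTensor_tmul, hb, hb]

omit [LinearOrder A] [Infinite A] in
theorem separate_sum {B ι : Type*} (s : Finset ι) (f : ι → NCSeries K (A ⊕ₗ B)) :
    separate (∑ i ∈ s, f i) = ∑ i ∈ s, separate (f i) := by
  funext u v
  refine (separate_eq_sum _ u v).trans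
    ((Finset.sum_congr rfl fun w _ => NCSeries.sum_apply s f w).trans (Finset.sum_comm.trans ?_))
  rw [Finset.sum_apply, Finset.sum_apply]
  exact Finset.sum_congr rfl fun i _ => (separate_eq_sum (f i) u v).symm

include hb in
-- After the injective realisation this is `separate_mul`, together with the product formula used
-- over both `A` and `A ⊕ₗ A`.
theorem splitComul_mul (x y : FQSym K A m) :
    splitComul hm b (x * y) = splitComul hm b x * splitComul hm b y := by
  refine map_mul_of_basis b _ (fun σ μ => realizeTensor_injective hm hb ?_) x y
  have : Infinite (A ⊕ₗ A) := inferInstanceAs (Infinite (A ⊕ A))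
  rw [realizeTensor_mul, realizeTensor_splitComul hm hb, realizeTensor_splitComul hm hb,
    ← separate_mul, G_mul_G K (A ⊕ₗ A) hm, basis_mul_basis hm hb, map_sum, map_sum, separate_sum]
  exact Finset.sum_congr rfl fun ν _ => realizeTensor_splitComul hm hb ν

include hm hb in
theorem splitCounit_mul (x y : FQSym K A m) :
    splitCounit b (x * y) = splitCounit b x * splitCounit b y := by
  have h1 : splitCounit b 1 = 1 := by
    rw [← basis_empty hb, splitCounit_basis, if_pos rfl]
  refine map_mul_of_basis b _ (fun σ μ => ?_) x y
  by_cases hσ : σ = StutPerm.empty m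
  · rw [hσ, basis_empty hb, one_mul, h1, one_mul]
  · rw [splitCounit_basis b σ, if_neg hσ, zero_mul, basis_mul_basis hm hb, map_sum]
    refine Finset.sum_eq_zero fun ν hν => ?_
    rw [splitCounit_basis, if_neg]
    rw [StutPerm.eq_empty_iff hm] at hσ ⊢
    have := size_of_mem_prodSet hm ((finite_prodSet hm σ μ).mem_toFinset.1 hν)
    omega

omit [Infinite A] in
include hb in
theorem splitComul_one : splitComul hm b 1 = 1 := by
  rw [← basis_empty hb, splitComul_basis, StutPerm.size_empty, zero_add, Finset.sum_range_one,
    StutPerm.high_zero, StutPerm.eq_empty_of_size hm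
      ((StutPerm.empty m).size_low hm 0 (Nat.zero_le _)), basis_empty hb]
  rfl

end Realization

theorem splitComul_eq_sum {K X : Type*} [Field K] [Ring X] [Algebra K X] {m : ℕ} (hm : 1 ≤ m)
    (b : Module.Basis (StutPerm m) K X) (σ : StutPerm m) : splitComul hm b (b σ) =
      ∑ p ∈ (finite_coprodSet hm σ).toFinset, b p.1 ⊗ₜ[K] b p.2 := by
  rw [splitComul_basis, ← finsum_mem_eq_finite_toFinset_sum, finsum_coprodSet hm]

/-! ### The dual basis -/

section DualBasis

variable {K X : Type*} [Field K] [Ring X] [Algebra K X] [Coalgebra K X] {m : ℕ} (hm : 1 ≤ m)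
  (b : Module.Basis (StutPerm m) K X)

open Classical in
/-- The counit is the coefficient of the empty permutation. -/
def CounitFormula : Prop :=
  ∀ σ, CoalgebraStruct.counit (R := K) (b σ) = if σ = StutPerm.empty m then 1 else 0

/-- The product formula for the basis `b`. -/
def MulFormula : Prop :=
  b (StutPerm.empty m) = 1 ∧
    ∀ σ μ, b σ * b μ = ∑ ν ∈ (finite_prodSet hm σ μ).toFinset, b ν

/-- The coproduct formula for the basis `b`. -/
def ComulFormula : Prop :=
  ∀ σ, CoalgebraStruct.comul (R := K) (b σ) =
    ∑ p ∈ (finite_coprodSet hm σ).toFinset, b p.1 ⊗ₜ[K] b p.2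

variable {b}

theorem MulFormula.basis_eq_algebraMap (hmul : MulFormula hm b) (hcounit : CounitFormula b)
    (σ : StutPerm m) (hσ : σ.size = 0) :
    b σ = algebraMap K X (CoalgebraStruct.counit (R := K) (b σ)) := by
  obtain rfl := StutPerm.eq_empty_of_size hm hσ
  rw [hcounit, if_pos rfl, map_one, hmul.1]

/-- The coproduct of a basis element. -/
abbrev ComulFormula.repr (hcomul : ComulFormula hm b) (σ : StutPerm m) :
    Coalgebra.Repr K (b σ) (StutPerm m × StutPerm m) where
  index := (finite_coprodSet hm σ).toFinset
  left p := b p.1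
  right p := b p.2
  eq := (hcomul σ).symm

omit [Coalgebra K X] in
open Classical in
theorem coord_apply_basis (σ τ : StutPerm m) : b.coord σ (b τ) = if σ = τ then 1 else 0 := by
  rw [Module.Basis.coord_apply, b.repr_self, Finsupp.single_apply]
  exact if_congr eq_comm rfl rfl

/-- The value of the product at `b ν` is the coefficient of `b σ ⊗ b μ` in the coproduct of `b ν`,
which is 0 or 1. Sizes add, so only finitely many `ν` contribute. -/
theorem toConv_coord_mul (hcomul : ComulFormula hm b) (σ μ : StutPerm m) :
    WithConv.toConv (b.coord σ) * WithConv.toConv (b.coord μ) =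
      ∑ ν ∈ (finite_coprodSet_fibre hm (σ, μ)).toFinset, WithConv.toConv (b.coord ν) := by
  classical
  refine WithConv.ofConv_injective (b.ext fun ν => ?_)
  refine ((hcomul.repr hm ν).convMul_apply _ _).trans ?_
  have h1 : ∀ s : Finset (StutPerm m),
      (∑ τ ∈ s, WithConv.toConv (b.coord τ)).ofConv (b ν) = ∑ τ ∈ s, b.coord τ (b ν) := by
    intro s
    induction s using Finset.induction_on with
    | empty => rfl
    | insert a s ha ih => rw [Finset.sum_insert ha, Finset.sum_insert ha, ← ih]; rfl
  have h2 : ∀ p : StutPerm m × StutPerm m,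
      (WithConv.toConv (b.coord σ)).ofConv (b p.1) * (WithConv.toConv (b.coord μ)).ofConv (b p.2) =
        if (σ, μ) = p then 1 else 0 := by
    rintro ⟨α, β⟩
    change b.coord σ (b α) * b.coord μ (b β) = _
    rw [coord_apply_basis, coord_apply_basis, ite_zero_mul_ite_zero, mul_one]
    exact if_congr Prod.mk_inj.symm rfl rfl
  refine (Finset.sum_congr rfl fun p _ => h2 p).trans ?_
  rw [h1, Finset.sum_ite_eq]
  simp only [coord_apply_basis]
  rw [Finset.sum_ite_eq']
  simp only [Set.Finite.mem_toFinset, Set.mem_ofPred_eq]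

theorem toConv_coord_empty (hcounit : CounitFormula b) :
    WithConv.toConv (b.coord (StutPerm.empty m)) = 1 := by
  classical
  refine WithConv.ofConv_injective (b.ext fun ν => ?_)
  change b.coord _ _ = CoalgebraStruct.counit (R := K) (b ν)
  rw [coord_apply_basis, hcounit]
  exact if_congr eq_comm rfl rfl

include hm in
theorem exists_dual_basis (hcomul : ComulFormula hm b) (hcounit : CounitFormula b) :
    ∃ (D : Subalgebra K (WithConv (X →ₗ[K] K))) (F : Module.Basis (StutPerm m) K D),
      ∀ σ, toDual D (F σ) = b.coord σ := by
  classical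
  have hli : LinearIndependent K fun σ => WithConv.toConv (b.coord σ) := by
    refine linearIndependent_of_dual _
      (fun σ => LinearMap.applyₗ (b σ) ∘ₗ (WithConv.linearEquiv K (X →ₗ[K] K)).toLinearMap) ?_ ?_
    · exact fun σ τ h => (coord_apply_basis τ σ).trans (if_neg h.symm)
    · exact fun σ => (coord_apply_basis σ σ).trans (if_pos rfl)
  obtain ⟨F, hF⟩ := exists_basis_adjoin (fun σ => WithConv.toConv (b.coord σ)) hli
    (toConv_coord_empty hcounit ▸ Submodule.subset_span ⟨_, rfl⟩) fun σ μ => by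
      rw [toConv_coord_mul hm hcomul]
      exact sum_mem fun ν _ => Submodule.subset_span ⟨ν, rfl⟩
  exact ⟨_, F, fun σ => congrArg WithConv.ofConv (hF σ)⟩

variable {D : Subalgebra K (WithConv (X →ₗ[K] K))} {F : Module.Basis (StutPerm m) K D}
  (hF : ∀ σ, toDual D (F σ) = b.coord σ)

variable (F) in
/-- The coproduct transposed from the product. -/
def factorComul : D →ₗ[K] D ⊗[K] D :=
  F.constr K fun ν => ∑ p ∈ (finite_factorisations hm ν).toFinset, F p.1 ⊗ₜ[K] F p.2

theorem factorComul_basis (ν : StutPerm m) : factorComul hm F (F ν) =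
    ∑ p ∈ (finite_factorisations hm ν).toFinset, F p.1 ⊗ₜ[K] F p.2 :=
  F.constr_basis _ _ _

include hF in
open Classical in
theorem evalAt_basis_mul_basis (hmul : MulFormula hm b) (σ μ ν : StutPerm m) :
    evalAt D (b σ * b μ) (F ν) = if ν ∈ prodSet σ μ then 1 else 0 := by
  rw [evalAt_apply, hF, hmul.2, map_sum]
  simp only [coord_apply_basis]
  rw [Finset.sum_ite_eq]
  simp only [Set.Finite.mem_toFinset]

include hF in
theorem evalAt₂_comp_factorComul (hmul : MulFormula hm b) (x y : X) :
    evalAt₂ D x y ∘ₗ factorComul hm F = evalAt D (x * y) := by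
  classical
  refine F.ext fun ν => ?_
  rw [LinearMap.comp_apply, factorComul_basis, map_sum]
  simp only [evalAt₂_tmul, evalAt_apply, hF]
  -- Both sides are bilinear in `x` and `y`, and on basis elements both indicate whether `ν ∈
  -- prodSet σ μ`.
  have key : ∑ p ∈ (finite_factorisations hm ν).toFinset,
      (LinearMap.mul K K).compl₁₂ (b.coord p.1) (b.coord p.2) =
        (LinearMap.mul K X).compr₂ (b.coord ν) := by
    refine b.ext fun σ => b.ext fun μ => ?_
    rw [LinearMap.sum_apply, LinearMap.sum_apply]
    have h2 : ∀ p : StutPerm m × StutPerm m,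
        (LinearMap.mul K K).compl₁₂ (b.coord p.1) (b.coord p.2) (b σ) (b μ) =
          if p = (σ, μ) then 1 else 0 := by
      rintro ⟨α, β⟩
      change b.coord α (b σ) * b.coord β (b μ) = _
      rw [coord_apply_basis, coord_apply_basis, ite_zero_mul_ite_zero, mul_one]
      exact if_congr Prod.mk_inj.symm rfl rfl
    refine (Finset.sum_congr rfl fun p _ => h2 p).trans ?_
    rw [Finset.sum_ite_eq']
    refine Eq.trans ?_ ((LinearMap.congr_fun (hF ν) _).symm.trans
      (evalAt_basis_mul_basis hm hF hmul σ μ ν)).symm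
    simp only [Set.Finite.mem_toFinset, Set.mem_ofPred_eq]
  have := LinearMap.congr_fun₂ key x y
  rw [LinearMap.sum_apply, LinearMap.sum_apply] at this
  exact this

end DualBasis

/-! ### The Hopf algebra axioms -/

section IsHopf

variable {K X : Type*} [Field K] [Ring X] [Algebra K X] [Coalgebra K X] {m : ℕ} (hm : 1 ≤ m)
  {b : Module.Basis (StutPerm m) K X}

theorem isHopf_of_basis (hmul : MulFormula hm b) (hcomul : ComulFormula hm b)
    (hcounit : CounitFormula b)
    (h1 : ∀ x y : X, CoalgebraStruct.counit (R := K) (x * y) =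
      CoalgebraStruct.counit (R := K) x * CoalgebraStruct.counit (R := K) y)
    (h2 : CoalgebraStruct.comul (R := K) (1 : X) = 1)
    (h3 : ∀ x y : X, CoalgebraStruct.comul (R := K) (x * y) =
      CoalgebraStruct.comul (R := K) x * CoalgebraStruct.comul (R := K) y) : IsHopf K X where
  counit_one := by rw [← hmul.1, hcounit, if_pos rfl]
  counit_mul := h1
  comul_one := h2
  comul_mul := h3
  exists_antipode := by
    exact exists_isAntipode_of_comul b hcomul (deg := StutPerm.size)
      (fun σ p hp => size_add_of_mem_coprodSet hm ((finite_coprodSet hm σ).mem_toFinset.1 hp))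
      (hmul.basis_eq_algebraMap hm hcounit)

variable {D : Subalgebra K (WithConv (X →ₗ[K] K))} {F : Module.Basis (StutPerm m) K D}
  (hF : ∀ σ, toDual D (F σ) = b.coord σ)

include hF in
theorem dual_basis_empty (hcounit : CounitFormula b) : F (StutPerm.empty m) = 1 := by
  classical
  refine eq_of_evalAt b F hF fun σ => ?_
  rw [evalAt_basis_basis b F hF, evalAt_one, hcounit]

/-- The coalgebra structure transposed from the product. -/
abbrev factorCoalgebra (hmul : MulFormula hm b) : Coalgebra K D :=
  dualCoalgebra b F hF (factorComul hm F) (evalAt₂_comp_factorComul hm hF hmul)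

theorem size_add_of_mem_factorisations {ν : StutPerm m} {p : StutPerm m × StutPerm m}
    (hp : p ∈ (finite_factorisations hm ν).toFinset) : p.1.size + p.2.size = ν.size :=
  (size_of_mem_prodSet hm ((finite_factorisations hm ν).mem_toFinset.1 hp)).symm

theorem dual_basis_eq_algebraMap (hmul : MulFormula hm b) (hcounit : CounitFormula b)
    (σ : StutPerm m) (hσ : σ.size = 0) : F σ = algebraMap K D
      ((factorCoalgebra hm hF hmul).counit (F σ)) := by
  obtain rfl := StutPerm.eq_empty_of_size hm hσ
  change _ = algebraMap K D (evalAt D 1 (F _))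
  rw [dual_basis_empty hF hcounit, evalAt_one, ← hmul.1, hcounit, if_pos rfl, map_one]

theorem isHopf_dual (hmul : MulFormula hm b) (hcounit : CounitFormula b) (hX : IsHopf K X) :
    @IsHopf K D _ _ _ (factorCoalgebra hm hF hmul) :=
  letI := factorCoalgebra hm hF hmul
  have hδ := evalAt₂_comp_factorComul hm hF hmul
  { counit_one := (evalAt_one (D := D) (1 : X)).trans hX.counit_one
    counit_mul := dual_counit_mul hX.comul_one
    comul_one := dual_comul_one b F hF _ hδ hX.counit_mul
    comul_mul := dual_comul_mul b F hF _ hδ hX.comul_mul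
    exists_antipode := exists_isAntipode_of_comul F (factorComul_basis hm)
      (deg := StutPerm.size) (fun _ _ hp => size_add_of_mem_factorisations hm hp)
      (dual_basis_eq_algebraMap hm hF hmul hcounit) }

/-! ### Sums over sylvester classes -/

variable (F) in
/-- The sum over a sylvester class. -/
def sylvesterSum (T : MBinTree m) : D := ∑ σ ∈ (finite_sylvesterClass hm T).toFinset, F σ

include hF in
open Classical in
theorem evalAt_sylvesterSum (ν : StutPerm m) (T : MBinTree m) :
    evalAt D (b ν) (sylvesterSum hm F T) = if ν.toTree hm = T then 1 else 0 := by
  rw [sylvesterSum, map_sum]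
  simp only [evalAt_basis_basis b F hF]
  rw [Finset.sum_ite_eq]
  simp only [Set.Finite.mem_toFinset, ν.mem_sylvesterClass hm]

include hF in
theorem sylvesterSum_empty (hcounit : CounitFormula b) :
    sylvesterSum hm F ((StutPerm.empty m).toTree hm) = 1 := by
  classical
  refine eq_of_evalAt b F hF fun ν => ?_
  rw [evalAt_sylvesterSum hm hF, evalAt_one, hcounit]
  refine if_congr ⟨fun h => StutPerm.eq_empty_of_size hm ?_, fun h => by rw [h]⟩ rfl rfl
  rw [StutPerm.size_eq_of_toTree_eq hm h, StutPerm.size_empty]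

/-- The lower bound of the product of the trees `T₁` and `T₂`. -/
def MBinTree.under (T₁ T₂ : MBinTree m) : MBinTree m :=
  ⟨graftLeft T₂.tree T₁.tree, IsMBinary.graftLeft hm T₂.2 T₁.2⟩

/-- The upper bound of the product of the trees `T₁` and `T₂`. -/
def MBinTree.over (T₁ T₂ : MBinTree m) : MBinTree m :=
  ⟨graftRight T₁.tree T₂.tree, IsMBinary.graftRight hm T₁.2 T₂.2⟩

include hF in
-- The value at `b ν` counts the cuts of `ν` whose lower and upper parts have trees `T₁` and `T₂`.
-- The size of `T₁` allows at most one, and it exists exactly when the tree of `ν` lies in the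
-- interval, by `exists_low_high_iff`.
theorem sylvesterSum_mul (hcomul : ComulFormula hm b) (T₁ T₂ : MBinTree m) :
    sylvesterSum hm F T₁ * sylvesterSum hm F T₂ =
      ∑ T ∈ (finite_Icc hm (T₁.under hm T₂) (T₁.over hm T₂)).toFinset, sylvesterSum hm F T := by
  classical
  refine eq_of_evalAt b F hF fun ν => ?_
  rw [evalAt_mul (hcomul.repr hm ν), map_sum]
  simp only [evalAt_sylvesterSum hm hF, ite_zero_mul_ite_zero, mul_one]
  rw [Finset.sum_ite_eq, sum_eq_indicator _ _ _ fun _ _ => rfl]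
  · refine if_congr (Iff.trans ?_ ((ν.exists_low_high_iff hm T₁ T₂).trans
      (finite_Icc hm (T₁.under hm T₂) (T₁.over hm T₂)).mem_toFinset.symm)) rfl rfl
    simp only [Set.Finite.mem_toFinset, mem_coprodSet hm]
    constructor
    · rintro ⟨_, ⟨k, hk, rfl⟩, h⟩
      exact ⟨k, hk, h⟩
    · rintro ⟨k, hk, h⟩
      exact ⟨_, ⟨k, hk, rfl⟩, h⟩
  · intro p hp q hq h h'
    rw [Set.Finite.mem_toFinset] at hp hq
    exact eq_of_mem_coprodSet hm hp hq (StutPerm.size_eq_of_toTree_eq hm (h.1.trans h'.1.symm))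

include hF in
theorem exists_basis_sylvesterSum (hcomul : ComulFormula hm b) (hcounit : CounitFormula b) :
    ∃ (Q : Subalgebra K D) (P : Module.Basis (MBinTree m) K Q),
      ∀ T, (P T : D) = sylvesterSum hm F T := by
  classical
  suffices h : ∃ P : Module.Basis (MBinTree m) K (Algebra.adjoin K (Set.range (sylvesterSum hm F))),
      ∀ T, (P T : D) = sylvesterSum hm F T from ⟨_, h⟩
  refine exists_basis_adjoin (sylvesterSum hm F) ?_ ?_ fun T T' => ?_
  · refine linearIndependent_of_dual _
      (fun T => evalAt D (b (Function.surjInv (StutPerm.toTree_surjective hm) T))) ?_ ?_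
    · intro T T' h
      refine (evalAt_sylvesterSum hm hF _ T').trans (if_neg ?_)
      rwa [Function.surjInv_eq (StutPerm.toTree_surjective hm)]
    · intro T
      refine (evalAt_sylvesterSum hm hF _ T).trans (if_pos ?_)
      rw [Function.surjInv_eq (StutPerm.toTree_surjective hm)]
  · rw [← sylvesterSum_empty hm hF hcounit]
    exact Submodule.subset_span ⟨_, rfl⟩
  · rw [sylvesterSum_mul hm hF hcomul]
    exact sum_mem fun T _ => Submodule.subset_span ⟨T, rfl⟩

include hF in
-- The value is the number of `ν` with tree `T` in the product, which depends only on the trees of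
-- the factors by `card_prodSet_le` used both ways.
theorem evalAt_mul_sylvesterSum (hmul : MulFormula hm b) {α α' β β' : StutPerm m}
    (hα : α.toTree hm = α'.toTree hm) (hβ : β.toTree hm = β'.toTree hm) (T : MBinTree m) :
    evalAt D (b α * b β) (sylvesterSum hm F T) = evalAt D (b α' * b β') (sylvesterSum hm F T) := by
  classical
  have key : ∀ σ μ : StutPerm m, evalAt D (b σ * b μ) (sylvesterSum hm F T) =
      ((finite_prodSet hm σ μ).toFinset.filter fun ν => ν.toTree hm = T).card := by
    intro σ μ
    rw [Finset.natCast_card_filter, evalAt_apply, hmul.2, map_sum]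
    exact Finset.sum_congr rfl fun ν _ => evalAt_sylvesterSum hm hF ν T
  rw [key, key, le_antisymm (card_prodSet_le hm hα hβ T) (card_prodSet_le hm hα.symm hβ.symm T)]

/-! ### Stability of the sylvester sums under the coproduct. -/

section Projection

variable {Q : Subalgebra K D} {P : Module.Basis (MBinTree m) K Q}
  (hP : ∀ T, (P T : D) = sylvesterSum hm F T)

/-- The chosen representative of the sylvester class of `σ`. -/
def sylvesterRep (σ : StutPerm m) : StutPerm m :=
  Function.surjInv (StutPerm.toTree_surjective hm) (σ.toTree hm)

theorem toTree_sylvesterRep (σ : StutPerm m) : (sylvesterRep hm σ).toTree hm = σ.toTree hm :=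
  Function.surjInv_eq _ _

open Classical in
variable (F P) in
/-- The projection onto the span of the sums over sylvester classes that keeps the coefficients
of the chosen representatives. -/
def sylvesterProj : D →ₗ[K] Q :=
  F.constr K fun σ => if sylvesterRep hm σ = σ then P (σ.toTree hm) else 0

include hF hP in
-- On `F τ` both sides are 1 when `τ` is the representative of the class of `σ`, and 0 otherwise.
theorem evalAt_sylvesterProj (σ : StutPerm m) :
    evalAt D (b σ) ∘ₗ Q.val.toLinearMap ∘ₗ sylvesterProj hm F P =
      evalAt D (b (sylvesterRep hm σ)) := by
  classical
  refine F.ext fun τ => ?_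
  rw [evalAt_basis_basis b F hF, LinearMap.comp_apply, LinearMap.comp_apply, sylvesterProj,
    F.constr_basis]
  by_cases h : sylvesterRep hm τ = τ
  · rw [if_pos h, AlgHom.toLinearMap_apply, Subalgebra.coe_val, hP, evalAt_sylvesterSum hm hF]
    refine if_congr ⟨fun h' => ?_, ?_⟩ rfl rfl
    · rw [← h, sylvesterRep, sylvesterRep, h']
    · rintro rfl
      exact (toTree_sylvesterRep hm σ).symm
  · rw [if_neg h, LinearMap.map_zero, LinearMap.map_zero, if_neg]
    rintro rfl
    exact h (by rw [sylvesterRep, toTree_sylvesterRep, ← sylvesterRep])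

include hF hP in
-- The values of the coproduct of `z` at `b σ ⊗ b τ` are unchanged when `σ` and `τ` are replaced by
-- their representatives. So it is fixed by the projection applied to both factors, and lies in the
-- image of `Q ⊗ Q`.
theorem factorComul_mem_range (hmul : MulFormula hm b) (z : Q) : factorComul hm F z ∈
    LinearMap.range (TensorProduct.map Q.val.toLinearMap Q.val.toLinearMap) := by
  refine ⟨TensorProduct.map (sylvesterProj hm F P) (sylvesterProj hm F P) (factorComul hm F z),
    eq_of_evalAt₂ b F hF fun σ τ => ?_⟩
  have h1 : evalAt₂ D (b σ) (b τ) ∘ₗ TensorProduct.map Q.val.toLinearMap Q.val.toLinearMap ∘ₗ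
      TensorProduct.map (sylvesterProj hm F P) (sylvesterProj hm F P) =
      evalAt₂ D (b (sylvesterRep hm σ)) (b (sylvesterRep hm τ)) := by
    rw [evalAt₂, evalAt₂, ← evalAt_sylvesterProj hm hF hP σ, ← evalAt_sylvesterProj hm hF hP τ]
    exact TensorProduct.ext' fun x y => rfl
  have h2 : evalAt D (b (sylvesterRep hm σ) * b (sylvesterRep hm τ)) ∘ₗ Q.val.toLinearMap =
      evalAt D (b σ * b τ) ∘ₗ Q.val.toLinearMap := by
    refine P.ext fun T => ?_
    rw [LinearMap.comp_apply, LinearMap.comp_apply, AlgHom.toLinearMap_apply, Subalgebra.coe_val,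
      hP]
    exact evalAt_mul_sylvesterSum hm hF hmul (toTree_sylvesterRep hm σ) (toTree_sylvesterRep hm τ) T
  have hδ := evalAt₂_comp_factorComul hm hF hmul
  refine (LinearMap.congr_fun h1 _).trans ((LinearMap.congr_fun (hδ _ _) _).trans
    ((LinearMap.congr_fun h2 z).trans (LinearMap.congr_fun (hδ _ _) _).symm))

include P hP in
theorem isHopfSubalgebra_sylvester (hmul : MulFormula hm b) (hcounit : CounitFormula b) :
    @IsHopfSubalgebra K D _ _ _ (factorCoalgebra hm hF hmul) Q :=
  letI := factorCoalgebra hm hF hmul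
  isHopfSubalgebra_of_comul F (factorComul_basis hm) (deg := StutPerm.size)
    (fun _ _ hp => size_add_of_mem_factorisations hm hp)
    (dual_basis_eq_algebraMap hm hF hmul hcounit)
    fun z hz => factorComul_mem_range hm hF hP hmul ⟨z, hz⟩

end Projection

end IsHopf

end MStut

end

theorem mainTheorem10 (K : Type*) [Field K] (m : ℕ) (hm : 1 ≤ m)
    (A : Type*) [LinearOrder A] [Infinite A] :
    -- every `m`-stuttering word has exactly one `m`-standardisation
    (∀ u : List A, IsStutWord m u → ∃! σ : StutPerm m, HasMStd u σ) ∧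
    -- the product formula
    (∀ σ μ : StutPerm m, (prodSet σ μ).Finite ∧
      G K A σ * G K A μ = ∑ᶠ ν ∈ prodSet σ μ, G K A ν) ∧
    -- the coproduct formula: expansion over the doubled alphabet
    (∀ (B : Type*) [LinearOrder B] [Infinite B] (σ : StutPerm m), (coprodSet σ).Finite ∧
      separate (G K (A ⊕ₗ B) σ) =
        ∑ᶠ p ∈ coprodSet σ, seriesTensor K A B (G K A p.1) (G K B p.2)) ∧
    -- the `G_σ` form a basis of `FQSym^{(m)}`, which is a Hopf algebra
    ∃ b : Module.Basis (StutPerm m) K (FQSym K A m),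
      (∀ σ : StutPerm m, (b σ : NCSeries K A) = G K A σ) ∧
    ∃ _ : Coalgebra K (FQSym K A m), IsHopf K (FQSym K A m) ∧
      (∀ σ : StutPerm m,
        realizeTensor K A m (CoalgebraStruct.comul (R := K) (b σ)) =
          separate (G K (A ⊕ₗ A) σ) ∧
        CoalgebraStruct.comul (R := K) (b σ) =
          ∑ᶠ p ∈ coprodSet σ, b p.1 ⊗ₜ[K] b p.2) ∧
    -- the dual Hopf algebra, with the dual basis `F_σ`
    ∃ (D : Subalgebra K (WithConv (FQSym K A m →ₗ[K] K)))
      (F : Module.Basis (StutPerm m) K D),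
      (∀ σ : StutPerm m, toDual D (F σ) = b.coord σ) ∧
    ∃ _ : Coalgebra K D, IsHopf K D ∧
      (∀ (z : D) (x y : FQSym K A m),
        dualPairing D (CoalgebraStruct.comul (R := K) z) (x ⊗ₜ[K] y) = toDual D z (x * y)) ∧
    -- `PBT^{(m)}` is a Hopf subalgebra of it
    ∃ (Q : Subalgebra K D) (P : Module.Basis (MBinTree m) K Q),
      (∀ T : MBinTree m, (sylvesterClass T).Finite ∧
        (P T : D) = ∑ᶠ σ ∈ sylvesterClass T, F σ) ∧
      IsHopfSubalgebra K Q ∧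
      -- products are intervals of the `m`-Tamari order
      (∀ T₁ T₂ : MBinTree m, ∃ lo hi : MBinTree m,
        lo.tree = graftLeft T₂.tree T₁.tree ∧ hi.tree = graftRight T₁.tree T₂.tree ∧
        (Set.Icc lo hi).Finite ∧
        P T₁ * P T₂ = ∑ᶠ T ∈ Set.Icc lo hi, P T) := by
  refine ⟨fun u hu => existsUnique_hasMStd hm hu, fun σ μ => ⟨finite_prodSet hm σ μ, ?_⟩,
    fun B _ _ σ => ⟨finite_coprodSet hm σ, ?_⟩, ?_⟩
  · rw [G_mul_G K A hm, finsum_mem_eq_finite_toFinset_sum]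
  · rw [separate_G K A B hm, finsum_coprodSet hm]
  obtain ⟨b, hb⟩ := exists_basis_FQSym K A m hm
  refine ⟨b, hb, splitCoalgebra hm b, ?_⟩
  let := splitCoalgebra hm b
  have hmul : MulFormula hm b := ⟨basis_empty hb, basis_mul_basis hm hb⟩
  have hcomul : ComulFormula hm b := splitComul_eq_sum hm b
  have hcounit : CounitFormula b := splitCounit_basis b
  have hX : IsHopf K (FQSym K A m) := isHopf_of_basis hm hmul hcomul hcounit
    (splitCounit_mul hm hb) (splitComul_one hm hb) (splitComul_mul hm hb)
  refine ⟨hX, fun σ => ⟨realizeTensor_splitComul hm hb σ,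
    (hcomul σ).trans (finsum_mem_eq_finite_toFinset_sum _ (finite_coprodSet hm σ)).symm⟩, ?_⟩
  obtain ⟨D, F, hF⟩ := exists_dual_basis hm hcomul hcounit
  refine ⟨D, F, hF, factorCoalgebra hm hF hmul, isHopf_dual hm hF hmul hcounit hX, ?_, ?_⟩
  · exact fun z x y => (dualPairing_tmul _ x y).trans
      (LinearMap.congr_fun (evalAt₂_comp_factorComul hm hF hmul x y) z)
  obtain ⟨Q, P, hP⟩ := exists_basis_sylvesterSum hm hF hcomul hcounit
  refine ⟨Q, P, fun T => ⟨finite_sylvesterClass hm T, ?_⟩,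
    isHopfSubalgebra_sylvester hm hF hP hmul hcounit, fun T₁ T₂ => ⟨T₁.under hm T₂, T₁.over hm T₂,
      rfl, rfl, finite_Icc hm _ _, ?_⟩⟩
  · rw [hP, finsum_mem_eq_finite_toFinset_sum _ (finite_sylvesterClass hm T)]
    rfl
  · exact (mul_eq_sum_of_coe hP (sylvesterSum_mul hm hF hcomul T₁ T₂)).trans
      (finsum_mem_eq_finite_toFinset_sum _ (finite_Icc hm _ _)).symm
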